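/- Let $g,\eta_p,\lambda>0$. For $q=(h,hu,h\sigma_{xx},h\sigma_{zz})\in\mathbb R^4$, called admissible if $h,\sigma_{xx},\sigma_{zz}>0$, set $$P=\tfrac{gh^2}{2}+\tfrac{\eta_p}{2\lambda}h(\sigma_{zz}-\sigma_{xx}),\quad s_{xx}=\frac{\sigma_{xx}^{-1/2}}{h},\quad s_{zz}=\frac{\sigma_{zz}^{1/2}}{h},\quad a=\sqrt{\partial_hP|_{s}}=\Bigl(gh+\tfrac{\eta_p}{2\lambda}(3\sigma_{zz}+\sigma_{xx})\Bigr)^{1/2},$$ $$e=\tfrac{gh}{2}+\tfrac{\eta_p}{4\lambda}\bigl(\sigma_{xx}+\sigma_{zz}-\ln(\sigma_{xx}\sigma_{zz})-2\bigr),\qquad E=\tfrac{hu^2}{2}+he,\qquad G=(E+P)u,$$ $$F(q)=(hu,\;hu^2+P,\;h\sigma_{xx}u,\;h\sigma_{zz}u),\qquad N(q)=(0,0,-2h\sigma_{xx},2h\sigma_{zz}).$$ Consider the system $\partial_tq+\partial_xF(q)+N(q)\,\partial_xu=0$ (S). For admissible $q_l,q_r$ define $c_l,c_r$ by $$\frac{c_l}{h_l}=a_l+2\Bigl((u_l-u_r)_++\frac{(P_r-P_l)_+}{h_la_l+h_ra_r}\Bigr),\qquad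 \frac{c_r}{h_r}=a_r+2\Bigl((u_l-u_r)_++\frac{(P_l-P_r)_+}{h_la_l+h_ra_r}\Bigr),$$ and $$u_*=\frac{c_lu_l+c_ru_r+P_l-P_r}{c_l+c_r},\qquad \pi_*=\frac{c_rP_l+c_lP_r-c_lc_r(u_r-u_l)}{c_l+c_r},$$ $$\frac1{h_l^*}=\frac1{h_l}+\frac{c_r(u_r-u_l)+P_l-P_r}{c_l(c_l+c_r)},\qquad \frac1{h_r^*}=\frac1{h_r}+\frac{c_l(u_r-u_l)+P_r-P_l}{c_r(c_l+c_r)}.$$ For $j\in\{l,r\}$ let the state $j$ be $(h_j,u_j,\sigma_{xx,j},\sigma_{zz,j},\pi=P_j,c_j,\hat e=e_j)$ and the state $j*$ be $$\Bigl(h_j^*,\;u_*,\;\sigma_{xx,j}\bigl(\tfrac{h_j}{h_j^*}\bigr)^2,\;\sigma_{zz,j}\bigl(\tfrac{h_j^*}{h_j}\bigr)^2,\;\pi_*,\;c_j,\;e_j-\tfrac{P_j^2}{2c_j^2}+\tfrac{\pi_*^2}{2c_j^2}\Bigr).$$ Let $\Sigma_1=u_l-c_l/h_l$, $\Sigma_2=u_*$,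 $\Sigma_3=u_r+c_r/h_r$ and $A(q_l,q_r)=\max_i|\Sigma_i|$. The relaxation solution is the function of $\xi=x/t$ equal to $l,\ l*,\ r*,\ r$ on the successive intervals separated by $\Sigma_1,\Sigma_2,\Sigma_3$, and $R(\xi,q_l,q_r)$ is its $(h,hu,h\sigma_{xx},h\sigma_{zz})$ part. Define the numerical fluxes $$\mathcal F_l=F(q_l)-\int_{-\infty}^0(R-q_l)\,d\xi,\qquad \mathcal F_r=F(q_r)+\int_0^\infty(R-q_r)\,d\xi,$$ $$\mathcal G_l=G(q_l)-\int_{-\infty}^0(E(R)-E(q_l))\,d\xi,\qquad \mathcal G_r=G(q_r)+\int_0^\infty(E(R)-E(q_r))\,d\xi,$$ and let $\mathcal G(q_l,q_r)$ be the value of $(hu^2/2+h\hat e+\pi)u$ in the relaxation solution at $\xi=0$. On a mesh with cells $(x_{i-1/2},x_{i+1/2})$, $i\in\mathbb Z$, of lengths $\Delta x_i>0$, and with time steps $\Delta t>0$ that may vary, the scheme, started from admissible data $(q_i^0)$, is $$q_i^{n+1}=q_i^n-\frac{\Delta t}{\Delta x_i}\bigl(\mathcal F_l(q_i^n,q_{i+1}^n)-\mathcal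 F_r(q_{i-1}^n,q_i^n)\bigr)$$ under the half CFL condition $\Delta t\,A(q_i^n,q_{i+1}^n)\le\frac12\min(\Delta x_i,\Delta x_{i+1})$ for all $i$, assumed at every time step considered. **Theorem.** For all admissible $q_l,q_r$ the numbers $c_l,c_r,h_l^*,h_r^*$ are positive, $\Sigma_1<\Sigma_2<\Sigma_3$, and the relaxation solution has end states $q_l,q_r$ and satisfies the Rankine–Hugoniot relations of the Suliciu relaxation system $$\partial_th+\partial_x(hu)=0,\qquad \partial_t(hu)+\partial_x(hu^2+\pi)=0,\qquad \partial_t(h\pi/c^2)+\partial_x(h\pi u/c^2+u)=0,$$ $$\partial_t(h\phi)+\partial_x(h\phi u)=0\quad\text{for }\phi=c,\ s_{xx},\ s_{zz},\ \hat e-\pi^2/2c^2.$$ For the components $k=3,4$ ($h\sigma_{xx}$ and $h\sigma_{zz}$), with $q_l^*,q_r^*$ the $q$-values of the states $l*,r*$, $$\mathcal F_{l,k}=F_k(q_l)+\min(0,\Sigma_1)(q_l^*-q_l)_k+\min(0,\Sigma_2)(q_r^*-q_l^*)_k+\min(0,\Sigma_3)(q_r-q_r^*)_k,$$ $$\mathcal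 F_{r,k}=F_k(q_r)-\max(0,\Sigma_1)(q_l^*-q_l)_k-\max(0,\Sigma_2)(q_r^*-q_l^*)_k-\max(0,\Sigma_3)(q_r-q_r^*)_k.$$ In the scheme, $q_i^{n+1}$ is the average over cell $i$ at time $t_{n+1}-0$ of the juxtaposition of the approximate Riemann solutions $R((x-x_{j+1/2})/(t-t_n),q_j^n,q_{j+1}^n)$ over the interfaces. Moreover: (i) The scheme is consistent with (S) for smooth solutions. For each admissible $q$: $\mathcal F_l(q,q)=\mathcal F_r(q,q)=F(q)$; both fluxes tend to $F(q)$ as $q_l,q_r\to q$; and $\mathcal F_r(q_l,q_r)-\mathcal F_l(q_l,q_r)=-(u_r-u_l)N(q)+o(|q_r-q_l|)$ as $q_l,q_r\to q$. For every admissible $C^1$ solution $Q$ of (S) on an open set of the $(t,x)$ plane and every point $(t,x)$ of that set, the truncation error on a uniform mesh, $$\frac{Q(t+\Delta t,x)-Q(t,x)}{\Delta t}+\frac{\mathcal F_l(Q(t,x),Q(t,x+\Delta x))-\mathcal F_r(Q(t,x-\Delta x),Q(t,x))}{\Delta x},$$ tends to $0$ as $\Delta t,\Delta x\to0^+$. (ii)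 $h,\sigma_{xx},\sigma_{zz}$ remain positive. (iii) The scheme is conservative in $h$ and $hu$: the first two components of $\mathcal F_l$ and $\mathcal F_r$ both equal the values of $hu$ and of $hu^2+\pi$ in the relaxation solution at $\xi=0$. Consequently the change over one time step of $\sum_{a\le i<b}\Delta x_i\,h_i$, respectively of $\sum_{a\le i<b}\Delta x_i\,(hu)_i$, is $-\Delta t$ times the difference of the corresponding fluxes at the two ends. (iv) $\mathcal G_r\le\mathcal G\le\mathcal G_l$ for all admissible $q_l,q_r$. For every function $\mathcal H$ with $\mathcal G_r\le\mathcal H\le\mathcal G_l$ on admissible pairs, in particular for $\mathcal H=\mathcal G$, $$E(q_i^{n+1})-E(q_i^n)+\frac{\Delta t}{\Delta x_i}\bigl(\mathcal H(q_i^n,q_{i+1}^n)-\mathcal H(q_{i-1}^n,q_i^n)\bigr)\le0.$$ (v) For $k>0$: if $s_{xx}\le k$ in all cells initially, then this holds at all later times; likewise for $s_{zz}\ge k$. (vi) Steady contact discontinuities are exactly resolved: if $u_l=u_r=0$ and $P_l=P_r$, then $R(\xi,q_l,q_r)=q_l$ for $\xi<0$ and $q_r$ for $\xi>0$; and if $u_i^0=0$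 and $P_i^0$ is constant in $i$, then $q_i^n=q_i^0$ for all $n$. (vii) There is an absolute constant $C>0$, independent of $g,\eta_p,\lambda$ and of the data, such that for all admissible $q_l,q_r$ both $\max(c_l/h_l,c_r/h_r)$ and $A(q_l,q_r)$ are at most $C(|u_l|+|u_r|+a_l+a_r)$. (viii) The numerical viscosity is sharp: for each admissible $q$ the eigenvalues of (S) in quasilinear form $\partial_tq+\mathsf A(q)\partial_xq=0$ are exactly $u-a,\ u,\ u+a$, and $\Sigma_1,\Sigma_2,\Sigma_3$ tend respectively to these values as $q_l,q_r\to q$. -/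

import Mathlib

open Filter Topology Asymptotics

noncomputable section

namespace ViscoSV

/-- Physical parameters: gravity `g`, polymer viscosity `etaP`, relaxation time `lam`. -/
structure Params where
  g : ℝ
  etaP : ℝ
  lam : ℝ

/-- The physical range of the parameters. -/
def Params.Positive (p : Params) : Prop := 0 < p.g ∧ 0 < p.etaP ∧ 0 < p.lam

/-- The pseudo-conservative variable `q = (h, h u, h σ_xx, h σ_zz)`. -/
abbrev State : Type := Fin 4 → ℝ

/-! ### Physical quantities as functions of `q` -/

def height (q : State) : ℝ := q 0

def vel (q : State) : ℝ := q 1 / q 0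

def sigxx (q : State) : ℝ := q 2 / q 0

def sigzz (q : State) : ℝ := q 3 / q 0

/-- `h > 0`, `σ_xx > 0`, `σ_zz > 0`. -/
def Admissible (q : State) : Prop := 0 < height q ∧ 0 < sigxx q ∧ 0 < sigzz q

/-- `s_xx = σ_xx^{-1/2} / h`. -/
def sxx (q : State) : ℝ := (Real.sqrt (sigxx q))⁻¹ / height q

/-- `s_zz = σ_zz^{1/2} / h`. -/
def szz (q : State) : ℝ := Real.sqrt (sigzz q) / height q

/-- `P = g h² / 2 + (η_p / 2λ) h (σ_zz - σ_xx)`. -/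
def pressure (p : Params) (q : State) : ℝ :=
  p.g * height q ^ 2 / 2 + p.etaP / (2 * p.lam) * height q * (sigzz q - sigxx q)

/-- The same pressure as a function of `h`, `s_xx`, `s_zz`
(`σ_xx = (h s_xx)⁻²`, `σ_zz = (h s_zz)²`). -/
def pressureS (p : Params) (h s1 s2 : ℝ) : ℝ :=
  p.g * h ^ 2 / 2 + p.etaP / (2 * p.lam) * h * ((h * s2) ^ 2 - 1 / (h * s1) ^ 2)

/-- `a = √(∂_h P)`, the derivative being taken at fixed `s = (s_xx, s_zz)`. -/
def soundSpeed (p : Params) (q : State) : ℝ :=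
  Real.sqrt (deriv (fun h => pressureS p h (sxx q) (szz q)) (height q))

/-- Internal energy `e`. -/
def internalEnergy (p : Params) (q : State) : ℝ :=
  p.g * height q / 2 +
    p.etaP / (4 * p.lam) * (sigxx q + sigzz q - Real.log (sigxx q * sigzz q) - 2)

/-- Energy `E = h u² / 2 + h e`. -/
def energy (p : Params) (q : State) : ℝ :=
  height q * vel q ^ 2 / 2 + height q * internalEnergy p q

/-- Energy flux `G = (E + P) u`. -/
def energyFlux (p : Params) (q : State) : ℝ := (energy p q + pressure p q) * vel q

/-- Pseudo-conservative flux `F = (h u, h u² + P, h σ_xx u, h σ_zz u)`. -/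
def flux (p : Params) (q : State) : State :=
  ![height q * vel q, height q * vel q ^ 2 + pressure p q,
    height q * sigxx q * vel q, height q * sigzz q * vel q]

/-- Coefficient of `∂_x u` in the nonconservative products: the system reads
`∂_t q + ∂_x F(q) + (∂_x u) ncVec(q) = 0`. -/
def ncVec (q : State) : State := ![0, 0, -2 * (height q * sigxx q), 2 * (height q * sigzz q)]

/-! ### The system of partial differential equations -/

/-- `Q` (of arguments `t`, `x`) is a `C¹` solution with values in the admissible states, on the
open set `Ω` of the `(t,x)` plane, of `∂_t q + ∂_x F(q) + (∂_x u) ncVec(q) = 0`. -/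
structure IsSmoothSolution (p : Params) (Ω : Set (ℝ × ℝ)) (Q : ℝ → ℝ → State) : Prop where
  isOpen : IsOpen Ω
  contDiffOn : ContDiffOn ℝ 1 (fun z : ℝ × ℝ => Q z.1 z.2) Ω
  admissible : ∀ t x, (t, x) ∈ Ω → Admissible (Q t x)
  equation : ∀ t x, (t, x) ∈ Ω → ∀ k : Fin 4,
    deriv (fun s => Q s x k) t + deriv (fun y => flux p (Q t y) k) x
      + deriv (fun y => vel (Q t y)) x * ncVec (Q t x) k = 0

/-- The matrix `A(q)`, as a linear map, of the quasilinear form `∂_t q + A(q) ∂_x q = 0`. -/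
def charMap (p : Params) (q : State) : State →L[ℝ] State :=
  fderiv ℝ (flux p) q + (fderiv ℝ vel q).smulRight (ncVec q)

/-- `μ` is a propagation speed (eigenvalue) of the system at the state `q`. -/
def IsCharSpeed (p : Params) (q : State) (μ : ℝ) : Prop :=
  Module.End.HasEigenvalue (charMap p q : State →ₗ[ℝ] State) μ

/-! ### The Riemann problem for the relaxation system -/

/-- States of the relaxation system (with the auxiliary energy variable `ehat`). -/
structure RelaxState where
  h : ℝ
  u : ℝ
  sigxx : ℝ
  sigzz : ℝ
  pi : ℝ
  c : ℝ
  ehat : ℝ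

/-- The part of a relaxation state that the approximate Riemann solver retains. -/
def RelaxState.toState (w : RelaxState) : State :=
  ![w.h, w.h * w.u, w.h * w.sigxx, w.h * w.sigzz]

/-- Quantities conserved by the relaxation system:
`h, h u, h π / c², h c, h s_xx, h s_zz, h (ê - π² / 2c²)`. -/
def RelaxState.conserved (w : RelaxState) : Fin 7 → ℝ :=
  ![w.h, w.h * w.u, w.h * w.pi / w.c ^ 2, w.h * w.c, w.h * sxx w.toState, w.h * szz w.toState,
    w.h * (w.ehat - w.pi ^ 2 / (2 * w.c ^ 2))]

/-- The corresponding fluxes. -/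
def RelaxState.relaxFlux (w : RelaxState) : Fin 7 → ℝ :=
  w.u • w.conserved + ![0, w.pi, w.u, 0, 0, 0, 0]

/-- Rankine-Hugoniot relations across a discontinuity of speed `S`. -/
def RankineHugoniot (S : ℝ) (w w' : RelaxState) : Prop :=
  w'.relaxFlux - w.relaxFlux = S • (w'.conserved - w.conserved)

/-- Relaxation speed `c_l`. -/
def cL (p : Params) (ql qr : State) : ℝ :=
  height ql * (soundSpeed p ql + 2 * (max 0 (vel ql - vel qr)
    + max 0 (pressure p qr - pressure p ql)
        / (height ql * soundSpeed p ql + height qr * soundSpeed p qr)))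

/-- Relaxation speed `c_r`. -/
def cR (p : Params) (ql qr : State) : ℝ :=
  height qr * (soundSpeed p qr + 2 * (max 0 (vel ql - vel qr)
    + max 0 (pressure p ql - pressure p qr)
        / (height ql * soundSpeed p ql + height qr * soundSpeed p qr)))

/-- The initial data: `q` completed with `π = P(q)`, the given `c`, and `ê = e(q)`. -/
def relaxInit (p : Params) (c : ℝ) (q : State) : RelaxState where
  h := height q
  u := vel q
  sigxx := sigxx q
  sigzz := sigzz q
  pi := pressure p q
  c := c
  ehat := internalEnergy p q

/-- The state "l". -/
def stateL (p : Params) (ql qr : State) : RelaxState := relaxInit p (cL p ql qr) ql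

/-- The state "r". -/
def stateR (p : Params) (ql qr : State) : RelaxState := relaxInit p (cR p ql qr) qr

/-- Intermediate velocity `u_*`. -/
def uStar (p : Params) (ql qr : State) : ℝ :=
  (cL p ql qr * vel ql + cR p ql qr * vel qr + pressure p ql - pressure p qr)
    / (cL p ql qr + cR p ql qr)

/-- Intermediate relaxation pressure `π_*`. -/
def piStar (p : Params) (ql qr : State) : ℝ :=
  (cR p ql qr * pressure p ql + cL p ql qr * pressure p qr
      - cL p ql qr * cR p ql qr * (vel qr - vel ql))
    / (cL p ql qr + cR p ql qr)

/-- Intermediate height `h_l^*`. -/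
def hStarL (p : Params) (ql qr : State) : ℝ :=
  (1 / height ql + (cR p ql qr * (vel qr - vel ql) + pressure p ql - pressure p qr)
    / (cL p ql qr * (cL p ql qr + cR p ql qr)))⁻¹

/-- Intermediate height `h_r^*`. -/
def hStarR (p : Params) (ql qr : State) : ℝ :=
  (1 / height qr + (cL p ql qr * (vel qr - vel ql) + pressure p qr - pressure p ql)
    / (cR p ql qr * (cL p ql qr + cR p ql qr)))⁻¹

/-- The state "l*". -/
def stateLS (p : Params) (ql qr : State) : RelaxState where
  h := hStarL p ql qr
  u := uStar p ql qr
  sigxx := sigxx ql * (height ql / hStarL p ql qr) ^ 2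
  sigzz := sigzz ql * (hStarL p ql qr / height ql) ^ 2
  pi := piStar p ql qr
  c := cL p ql qr
  ehat := internalEnergy p ql - pressure p ql ^ 2 / (2 * cL p ql qr ^ 2)
    + piStar p ql qr ^ 2 / (2 * cL p ql qr ^ 2)

/-- The state "r*". -/
def stateRS (p : Params) (ql qr : State) : RelaxState where
  h := hStarR p ql qr
  u := uStar p ql qr
  sigxx := sigxx qr * (height qr / hStarR p ql qr) ^ 2
  sigzz := sigzz qr * (hStarR p ql qr / height qr) ^ 2
  pi := piStar p ql qr
  c := cR p ql qr
  ehat := internalEnergy p qr - pressure p qr ^ 2 / (2 * cR p ql qr ^ 2)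
    + piStar p ql qr ^ 2 / (2 * cR p ql qr ^ 2)

/-- Wave speed `Σ₁ = u_l - c_l / h_l`. -/
def speed1 (p : Params) (ql qr : State) : ℝ := vel ql - cL p ql qr / height ql

/-- Wave speed `Σ₂ = u_*`. -/
def speed2 (p : Params) (ql qr : State) : ℝ := uStar p ql qr

/-- Wave speed `Σ₃ = u_r + c_r / h_r`. -/
def speed3 (p : Params) (ql qr : State) : ℝ := vel qr + cR p ql qr / height qr

/-- Self-similar solution of the relaxation Riemann problem, as a function of `ξ = x/t`. -/
def relaxSolution (p : Params) (ql qr : State) (ξ : ℝ) : RelaxState :=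
  if ξ < speed1 p ql qr then stateL p ql qr
  else if ξ < speed2 p ql qr then stateLS p ql qr
  else if ξ < speed3 p ql qr then stateRS p ql qr
  else stateR p ql qr

/-- The approximate Riemann solver `R(ξ, q_l, q_r)`. -/
def riemannSolver (p : Params) (ξ : ℝ) (ql qr : State) : State :=
  (relaxSolution p ql qr ξ).toState

/-- Maximal propagation speed `A(q_l, q_r) = max(|Σ₁|, |Σ₂|, |Σ₃|)`. -/
def maxSpeed (p : Params) (ql qr : State) : ℝ :=
  max |speed1 p ql qr| (max |speed2 p ql qr| |speed3 p ql qr|)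

/-! ### Numerical fluxes -/

/-- Left numerical flux `F(q_l) - ∫_{-∞}^0 (R(ξ,q_l,q_r) - q_l) dξ`. -/
def fluxL (p : Params) (ql qr : State) : State := fun k =>
  flux p ql k - ∫ ξ in Set.Iic (0 : ℝ), (riemannSolver p ξ ql qr k - ql k)

/-- Right numerical flux `F(q_r) + ∫_0^∞ (R(ξ,q_l,q_r) - q_r) dξ`. -/
def fluxR (p : Params) (ql qr : State) : State := fun k =>
  flux p qr k + ∫ ξ in Set.Ioi (0 : ℝ), (riemannSolver p ξ ql qr k - qr k)

/-- Closed formula for the left flux of a nonconservative component `k`. -/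
def fluxLFormula (p : Params) (ql qr : State) (k : Fin 4) : ℝ :=
  flux p ql k + min 0 (speed1 p ql qr) * ((stateLS p ql qr).toState k - ql k)
    + min 0 (speed2 p ql qr) * ((stateRS p ql qr).toState k - (stateLS p ql qr).toState k)
    + min 0 (speed3 p ql qr) * (qr k - (stateRS p ql qr).toState k)

/-- Closed formula for the right flux of a nonconservative component `k`. -/
def fluxRFormula (p : Params) (ql qr : State) (k : Fin 4) : ℝ :=
  flux p qr k - max 0 (speed1 p ql qr) * ((stateLS p ql qr).toState k - ql k)
    - max 0 (speed2 p ql qr) * ((stateRS p ql qr).toState k - (stateLS p ql qr).toState k)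
    - max 0 (speed3 p ql qr) * (qr k - (stateRS p ql qr).toState k)

/-- Flux `h u` of the relaxation solution at `x/t = 0`. -/
def massFlux (p : Params) (ql qr : State) : ℝ :=
  (relaxSolution p ql qr 0).h * (relaxSolution p ql qr 0).u

/-- Flux `h u² + π` of the relaxation solution at `x/t = 0`. -/
def momentumFlux (p : Params) (ql qr : State) : ℝ :=
  (relaxSolution p ql qr 0).h * (relaxSolution p ql qr 0).u ^ 2 + (relaxSolution p ql qr 0).pi

/-- Left numerical energy flux `G(q_l) - ∫_{-∞}^0 (E(R(ξ,q_l,q_r)) - E(q_l)) dξ`. -/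
def energyFluxL (p : Params) (ql qr : State) : ℝ :=
  energyFlux p ql
    - ∫ ξ in Set.Iic (0 : ℝ), (energy p (riemannSolver p ξ ql qr) - energy p ql)

/-- Right numerical energy flux `G(q_r) + ∫_0^∞ (E(R(ξ,q_l,q_r)) - E(q_r)) dξ`. -/
def energyFluxR (p : Params) (ql qr : State) : ℝ :=
  energyFlux p qr
    + ∫ ξ in Set.Ioi (0 : ℝ), (energy p (riemannSolver p ξ ql qr) - energy p qr)

/-- Numerical energy flux: `(h u² / 2 + h ê + π) u` at `x/t = 0`. -/
def numEnergyFlux (p : Params) (ql qr : State) : ℝ :=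
  ((relaxSolution p ql qr 0).h * (relaxSolution p ql qr 0).u ^ 2 / 2
    + (relaxSolution p ql qr 0).h * (relaxSolution p ql qr 0).ehat
    + (relaxSolution p ql qr 0).pi) * (relaxSolution p ql qr 0).u

/-! ### The finite volume scheme -/

/-- Length of the cell `i`, which is `(X i, X (i+1))`: `X i` stands for `x_{i-1/2}`. -/
def cellLength (X : ℤ → ℝ) (i : ℤ) : ℝ := X (i + 1) - X i

/-- Centre of the cell `i`. -/
def cellCenter (X : ℤ → ℝ) (i : ℤ) : ℝ := (X i + X (i + 1)) / 2

/-- One time step: `q_i - (Δt/Δx_i) (F_l(q_i, q_{i+1}) - F_r(q_{i-1}, q_i))`. -/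
def schemeStep (p : Params) (X : ℤ → ℝ) (dt : ℝ) (q : ℤ → State) (i : ℤ) : State :=
  q i - (dt / cellLength X i) • (fluxL p (q i) (q (i + 1)) - fluxR p (q (i - 1)) (q i))

/-- Average over the cell `i`, a time `dt` after the initial time, of the approximate solution made
of the approximate Riemann solutions issued from the interfaces of the mesh. -/
def cellAverage (p : Params) (X : ℤ → ℝ) (dt : ℝ) (q : ℤ → State) (i : ℤ) : State := fun k =>
  (1 / cellLength X i) *
    ((∫ x in (X i)..(cellCenter X i), riemannSolver p ((x - X i) / dt) (q (i - 1)) (q i) k)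
      + ∫ x in (cellCenter X i)..(X (i + 1)),
          riemannSolver p ((x - X (i + 1)) / dt) (q i) (q (i + 1)) k)

/-- `q n i` is computed by `N` steps of the scheme from admissible data `q 0`, on the mesh of
interfaces `X`, with time steps `dt n` that satisfy the half CFL condition. -/
structure SchemeRun (p : Params) (X : ℤ → ℝ) (dt : ℕ → ℝ) (q : ℕ → ℤ → State) (N : ℕ) :
    Prop where
  mesh : StrictMono X
  dt_pos : ∀ n < N, 0 < dt n
  init : ∀ i, Admissible (q 0 i)
  step : ∀ n < N, ∀ i, q (n + 1) i = schemeStep p X (dt n) (q n) i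
  cfl : ∀ n < N, ∀ i, dt n * maxSpeed p (q n i) (q n (i + 1))
    ≤ 1 / 2 * min (cellLength X i) (cellLength X (i + 1))

end ViscoSV

end

open ViscoSV

/-! The relaxation fan has only three jumps, so the statements about the solver reduce to algebra.
The mass flux `h (u - Σ)` takes the same value on both sides of each jump: `c_l` for the left
acoustic wave, `0` for the contact, `-c_r` for the right acoustic wave. A Rankine–Hugoniot relation
then becomes `m [φ] + [V] = 0` (`jump_eq_iff`), and the energy of the relaxation system is exactly
conserved as well.

The speeds `c` have the form `h (a + 2X)`, where `X` dominates the velocity drop across the wave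
(`neg_excess_le`). Half of the term `2X` absorbs this drop and keeps the intermediate height
positive. The other half bounds that height well enough to give `h² ∂_h P ≤ c²` at the intermediate
state (`star_height_bound`, `subcharacteristic`). This makes the physical energy of an intermediate
state at most its relaxation energy (`internalEnergy_le_of_wave`), and replacing the latter by the
former moves the left and right energy fluxes to opposite sides of the numerical one.

Under the half CFL condition the waves issued from an interface stay within the adjacent half cells.
The new cell value is thus a convex combination of fan states, with weights that serve for all
functions of the state at once (`exists_weights_left`, `exists_weights_right`). Jensen's inequality
(`schemeStep_mem`) then gives positivity, the bounds on `s_xx` and `s_zz` and the energy inequality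
from three facts: the constraints define convex sets, `E` is convex, and the intermediate states
inherit `s_xx`, `s_zz` from `l` or `r`.

For consistency, the jump of `q` through an acoustic wave is a continuous factor times the velocity
jump (`jump_eq_jumpRatio`), and the two velocity jumps add up to `u_r - u_l`. Near the diagonal the
factors in `F_r - F_l` have a common limit, which produces the nonconservative product. In the
truncation error the waves entering a cell come from two different interfaces. The right-going
contribution can be moved from one interface to the other because its difference quotient has the
same limit at both (`exists_tendsto_waveR_quotient`), and `C¹` regularity is enough for that. -/

namespace ViscoSV

/-! ### Sound speed -/

/-- The elastic coefficient `η_p / 2λ`. -/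
noncomputable def Params.elastic (p : Params) : ℝ := p.etaP / (2 * p.lam)

theorem Params.Positive.g_pos {p : Params} (hp : p.Positive) : 0 < p.g := hp.1

theorem Params.Positive.elastic_pos {p : Params} (hp : p.Positive) : 0 < p.elastic :=
  div_pos hp.2.1 (mul_pos two_pos hp.2.2)

theorem pressure_eq (p : Params) (q : State) :
    pressure p q = p.g * height q ^ 2 / 2 + p.elastic * height q * (sigzz q - sigxx q) := rfl

theorem internalEnergy_eq (p : Params) (q : State) :
    internalEnergy p q = p.g * height q / 2 +
      p.elastic / 2 * (sigxx q + sigzz q - Real.log (sigxx q * sigzz q) - 2) := by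
  have : p.etaP / (4 * p.lam) = p.elastic / 2 := by
    rw [Params.elastic, div_div]; congr 1; ring
  rw [internalEnergy, this]

theorem sxx_pos {q : State} (hq : Admissible q) : 0 < sxx q :=
  div_pos (inv_pos.2 (Real.sqrt_pos.2 hq.2.1)) hq.1

theorem szz_pos {q : State} (hq : Admissible q) : 0 < szz q :=
  div_pos (Real.sqrt_pos.2 hq.2.2) hq.1

theorem sxx_sq {q : State} (hq : Admissible q) : sxx q ^ 2 = 1 / (sigxx q * height q ^ 2) := by
  rw [sxx, div_pow, inv_pow, Real.sq_sqrt hq.2.1.le]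
  field_simp

theorem szz_sq {q : State} (hq : Admissible q) : szz q ^ 2 = sigzz q / height q ^ 2 := by
  rw [szz, div_pow, Real.sq_sqrt hq.2.2.le]

theorem hasDerivAt_pressureS (p : Params) {h s1 : ℝ} (s2 : ℝ) (hh : h ≠ 0) (hs : s1 ≠ 0) :
    HasDerivAt (fun h => pressureS p h s1 s2)
      (p.g * h + p.elastic * (3 * h ^ 2 * s2 ^ 2 + 1 / (h ^ 2 * s1 ^ 2))) h := by
  have h1 : (fun h => pressureS p h s1 s2) = fun h =>
      p.g * h ^ 2 / 2 + p.elastic * (h ^ 3 * s2 ^ 2 - h⁻¹ * (s1 ^ 2)⁻¹) := by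
    funext x
    -- At `x = 0` both expressions vanish, by the convention `0⁻¹ = 0`, so the functions agree
    -- everywhere.
    rcases eq_or_ne x 0 with rfl | hx
    · simp [pressureS]
    · rw [pressureS, ← Params.elastic]; field_simp
  rw [h1]
  have h2 := (((hasDerivAt_pow 2 h).const_mul p.g).div_const 2).add
    ((((hasDerivAt_pow 3 h).mul_const (s2 ^ 2)).sub
      ((hasDerivAt_inv hh).mul_const (s1 ^ 2)⁻¹)).const_mul p.elastic)
  refine h2.congr_deriv ?_
  field_simp
  ring

/-- The square of the sound speed. -/
noncomputable def soundSpeedSq (p : Params) (q : State) : ℝ :=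
  p.g * height q + p.elastic * (3 * sigzz q + sigxx q)

theorem soundSpeed_eq (p : Params) {q : State} (hq : Admissible q) :
    soundSpeed p q = Real.sqrt (soundSpeedSq p q) := by
  obtain ⟨h0, h1, h2⟩ := hq
  rw [soundSpeed, (hasDerivAt_pressureS p _ h0.ne' (sxx_pos ⟨h0, h1, h2⟩).ne').deriv,
    sxx_sq ⟨h0, h1, h2⟩, szz_sq ⟨h0, h1, h2⟩, soundSpeedSq]
  congr 1
  field_simp

theorem soundSpeedSq_pos {p : Params} (hp : p.Positive) {q : State} (hq : Admissible q) :
    0 < soundSpeedSq p q := by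
  have := hp.g_pos
  have := hp.elastic_pos
  obtain ⟨h0, h1, h2⟩ := hq
  unfold soundSpeedSq
  positivity

theorem soundSpeed_pos {p : Params} (hp : p.Positive) {q : State} (hq : Admissible q) :
    0 < soundSpeed p q := by
  rw [soundSpeed_eq p hq]
  exact Real.sqrt_pos.2 (soundSpeedSq_pos hp hq)

theorem soundSpeed_sq {p : Params} (hp : p.Positive) {q : State} (hq : Admissible q) :
    soundSpeed p q ^ 2 = soundSpeedSq p q := by
  rw [soundSpeed_eq p hq, Real.sq_sqrt (soundSpeedSq_pos hp hq).le]

/-! ### Relaxation speeds and intermediate states -/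

/-- The excess of velocity in the definition of `c_l` (and of `c_r`, with the pressures
exchanged). -/
noncomputable def excess (p : Params) (ql qr : State) (P P' : ℝ) : ℝ :=
  max 0 (vel ql - vel qr)
    + max 0 (P' - P) / (height ql * soundSpeed p ql + height qr * soundSpeed p qr)

variable {p : Params} {ql qr : State}

theorem cL_eq : cL p ql qr =
    height ql * (soundSpeed p ql + 2 * excess p ql qr (pressure p ql) (pressure p qr)) := rfl

theorem cR_eq : cR p ql qr =
    height qr * (soundSpeed p qr + 2 * excess p ql qr (pressure p qr) (pressure p ql)) := rfl

theorem impedance_pos (hp : p.Positive) (hl : Admissible ql) (hr : Admissible qr) :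
    0 < height ql * soundSpeed p ql + height qr * soundSpeed p qr :=
  add_pos (mul_pos hl.1 (soundSpeed_pos hp hl)) (mul_pos hr.1 (soundSpeed_pos hp hr))

theorem excess_nonneg (hp : p.Positive) (hl : Admissible ql) (hr : Admissible qr) (P P' : ℝ) :
    0 ≤ excess p ql qr P P' :=
  add_nonneg (le_max_left _ _) (div_nonneg (le_max_left _ _) (impedance_pos hp hl hr).le)

theorem height_mul_soundSpeed_le_cL (hp : p.Positive) (hl : Admissible ql) (hr : Admissible qr) :
    height ql * soundSpeed p ql ≤ cL p ql qr := by
  rw [cL_eq]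
  have := excess_nonneg hp hl hr (pressure p ql) (pressure p qr)
  exact mul_le_mul_of_nonneg_left (by linarith) hl.1.le

theorem height_mul_soundSpeed_le_cR (hp : p.Positive) (hl : Admissible ql) (hr : Admissible qr) :
    height qr * soundSpeed p qr ≤ cR p ql qr := by
  rw [cR_eq]
  have := excess_nonneg hp hl hr (pressure p qr) (pressure p ql)
  exact mul_le_mul_of_nonneg_left (by linarith) hr.1.le

theorem cL_pos (hp : p.Positive) (hl : Admissible ql) (hr : Admissible qr) : 0 < cL p ql qr :=
  (mul_pos hl.1 (soundSpeed_pos hp hl)).trans_le (height_mul_soundSpeed_le_cL hp hl hr)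

theorem cR_pos (hp : p.Positive) (hl : Admissible ql) (hr : Admissible qr) : 0 < cR p ql qr :=
  (mul_pos hr.1 (soundSpeed_pos hp hr)).trans_le (height_mul_soundSpeed_le_cR hp hl hr)

/-- The velocity jump is an average: the weight `cr / (cl + cr)` is at most `1`, so a compression
`y` contributes at most its positive part, and the pressure term is largest when `cl + cr` is
replaced by its lower bound `D`. The same inequality serves both waves, with the roles of `l` and
`r` exchanged. -/
theorem neg_excess_le {cl cr D v x y : ℝ} (hcl : 0 < cl) (hcr : 0 < cr) (hD : 0 < D)
    (hle : D ≤ cl + cr) (hv : v = -y) :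
    -(max 0 y + max 0 x / D) ≤ (cr * v - x) / (cl + cr) := by
  have hs : 0 < cl + cr := add_pos hcl hcr
  have h0 : 0 ≤ max 0 x := le_max_left _ _
  have h1 : max 0 x ≤ max 0 x / D * (cl + cr) := by
    rw [div_mul_eq_mul_div, le_div_iff₀ hD]
    exact mul_le_mul_of_nonneg_left hle h0
  have h2 : cr * y ≤ max 0 y * (cl + cr) := by
    have := le_max_right 0 y
    have := le_max_left 0 y
    nlinarith
  rw [le_div_iff₀ hs]
  have := le_max_right 0 x
  subst hv
  linarith

theorem uStar_sub_velL (hp : p.Positive) (hl : Admissible ql) (hr : Admissible qr) :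
    uStar p ql qr - vel ql =
      (cR p ql qr * (vel qr - vel ql) + pressure p ql - pressure p qr)
        / (cL p ql qr + cR p ql qr) := by
  have := cL_pos hp hl hr
  have := cR_pos hp hl hr
  rw [uStar]
  field_simp
  ring

theorem velR_sub_uStar (hp : p.Positive) (hl : Admissible ql) (hr : Admissible qr) :
    vel qr - uStar p ql qr =
      (cL p ql qr * (vel qr - vel ql) + pressure p qr - pressure p ql)
        / (cL p ql qr + cR p ql qr) := by
  have := cL_pos hp hl hr
  have := cR_pos hp hl hr
  rw [uStar]
  field_simp
  ring

theorem piStar_sub_pressureL (hp : p.Positive) (hl : Admissible ql) (hr : Admissible qr) :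
    piStar p ql qr - pressure p ql = -(cL p ql qr * (uStar p ql qr - vel ql)) := by
  have := cL_pos hp hl hr
  have := cR_pos hp hl hr
  rw [uStar, piStar]
  field_simp
  ring

theorem piStar_sub_pressureR (hp : p.Positive) (hl : Admissible ql) (hr : Admissible qr) :
    piStar p ql qr - pressure p qr = cR p ql qr * (uStar p ql qr - vel qr) := by
  have := cL_pos hp hl hr
  have := cR_pos hp hl hr
  rw [uStar, piStar]
  field_simp
  ring

theorem hStarL_eq (hp : p.Positive) (hl : Admissible ql) (hr : Admissible qr) :
    hStarL p ql qr = (1 / height ql + (uStar p ql qr - vel ql) / cL p ql qr)⁻¹ := by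
  rw [hStarL, uStar_sub_velL hp hl hr, div_div, mul_comm (cL p ql qr)]

theorem hStarR_eq (hp : p.Positive) (hl : Admissible ql) (hr : Admissible qr) :
    hStarR p ql qr = (1 / height qr + (vel qr - uStar p ql qr) / cR p ql qr)⁻¹ := by
  rw [hStarR, velR_sub_uStar hp hl hr, div_div, mul_comm (cR p ql qr)]

theorem neg_excess_le_uStar_sub (hp : p.Positive) (hl : Admissible ql) (hr : Admissible qr) :
    -excess p ql qr (pressure p ql) (pressure p qr) ≤ uStar p ql qr - vel ql := by
  rw [uStar_sub_velL hp hl hr, add_sub_assoc, ← neg_sub (pressure p qr), ← sub_eq_add_neg]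
  exact neg_excess_le (cL_pos hp hl hr) (cR_pos hp hl hr) (impedance_pos hp hl hr)
    (add_le_add (height_mul_soundSpeed_le_cL hp hl hr) (height_mul_soundSpeed_le_cR hp hl hr))
    (by ring)

theorem neg_excess_le_sub_uStar (hp : p.Positive) (hl : Admissible ql) (hr : Admissible qr) :
    -excess p ql qr (pressure p qr) (pressure p ql) ≤ vel qr - uStar p ql qr := by
  rw [velR_sub_uStar hp hl hr, add_sub_assoc, ← neg_sub (pressure p ql), ← sub_eq_add_neg,
    add_comm (cL p ql qr) (cR p ql qr)]
  refine neg_excess_le (cR_pos hp hl hr) (cL_pos hp hl hr) (impedance_pos hp hl hr) ?_ (by ring)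
  have := height_mul_soundSpeed_le_cL hp hl hr
  have := height_mul_soundSpeed_le_cR hp hl hr
  linarith

/-- Positivity of an intermediate height, and the bound on it that gives the subcharacteristic
condition. -/
theorem star_height_bound {h a X c d : ℝ} (hh : 0 < h) (ha : 0 < a) (hX : 0 ≤ X)
    (hc : c = h * (a + 2 * X)) (hd : -X ≤ d) :
    0 < (1 / h + d / c)⁻¹ ∧ (1 / h + d / c)⁻¹ * (a + X) ≤ h * (a + 2 * X) := by
  have hc0 : 0 < c := by rw [hc]; positivity
  -- By the choice of `c`, `1 / h = (a + 2X) / c`; the drop `d ≥ -X` consumes one of the two `X`,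
  -- and `a + X` is left.
  have key : (a + X) / c ≤ 1 / h + d / c := by
    have : 1 / h = (a + 2 * X) / c := by rw [hc]; field_simp
    rw [this, ← add_div]
    exact div_le_div_of_nonneg_right (by linarith) hc0.le
  have hpos : 0 < 1 / h + d / c := lt_of_lt_of_le (by positivity) key
  refine ⟨inv_pos.2 hpos, ?_⟩
  rw [inv_mul_le_iff₀ hpos, ← hc]
  rwa [div_le_iff₀ hc0] at key

theorem hStarL_pos (hp : p.Positive) (hl : Admissible ql) (hr : Admissible qr) :
    0 < hStarL p ql qr := by
  rw [hStarL_eq hp hl hr]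
  exact (star_height_bound hl.1 (soundSpeed_pos hp hl) (excess_nonneg hp hl hr _ _) cL_eq
    (neg_excess_le_uStar_sub hp hl hr)).1

theorem hStarR_pos (hp : p.Positive) (hl : Admissible ql) (hr : Admissible qr) :
    0 < hStarR p ql qr := by
  rw [hStarR_eq hp hl hr]
  exact (star_height_bound hr.1 (soundSpeed_pos hp hr) (excess_nonneg hp hl hr _ _) cR_eq
    (neg_excess_le_sub_uStar hp hl hr)).1

theorem cL_div_hStarL (hp : p.Positive) (hl : Admissible ql) (hr : Admissible qr) :
    cL p ql qr / hStarL p ql qr = cL p ql qr / height ql + (uStar p ql qr - vel ql) := by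
  have := cL_pos hp hl hr
  rw [hStarL_eq hp hl hr, div_inv_eq_mul]
  field_simp

theorem cR_div_hStarR (hp : p.Positive) (hl : Admissible ql) (hr : Admissible qr) :
    cR p ql qr / hStarR p ql qr = cR p ql qr / height qr + (vel qr - uStar p ql qr) := by
  have := cR_pos hp hl hr
  rw [hStarR_eq hp hl hr, div_inv_eq_mul]
  field_simp

/-- The speed of the left wave as seen from its right side: together with the definition of
`speed1`, it makes the mass flux through the wave equal to `c_l` on both sides. -/
theorem speed1_eq (hp : p.Positive) (hl : Admissible ql) (hr : Admissible qr) :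
    speed1 p ql qr = uStar p ql qr - cL p ql qr / hStarL p ql qr := by
  rw [cL_div_hStarL hp hl hr, speed1]; ring

theorem speed3_eq (hp : p.Positive) (hl : Admissible ql) (hr : Admissible qr) :
    speed3 p ql qr = uStar p ql qr + cR p ql qr / hStarR p ql qr := by
  rw [cR_div_hStarR hp hl hr, speed3]; ring

theorem speed1_lt_speed2 (hp : p.Positive) (hl : Admissible ql) (hr : Admissible qr) :
    speed1 p ql qr < speed2 p ql qr := by
  rw [speed1_eq hp hl hr, speed2]
  have := div_pos (cL_pos hp hl hr) (hStarL_pos hp hl hr)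
  linarith

theorem speed2_lt_speed3 (hp : p.Positive) (hl : Admissible ql) (hr : Admissible qr) :
    speed2 p ql qr < speed3 p ql qr := by
  rw [speed3_eq hp hl hr, speed2]
  have := div_pos (cR_pos hp hl hr) (hStarR_pos hp hl hr)
  linarith

/-- The mass flux through the left wave. -/
theorem hStarL_mul (hp : p.Positive) (hl : Admissible ql) (hr : Admissible qr) :
    hStarL p ql qr * (uStar p ql qr - speed1 p ql qr) = cL p ql qr := by
  have := hStarL_pos hp hl hr
  rw [speed1_eq hp hl hr]; field_simp; ring

theorem hStarR_mul (hp : p.Positive) (hl : Admissible ql) (hr : Admissible qr) :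
    hStarR p ql qr * (uStar p ql qr - speed3 p ql qr) = -cR p ql qr := by
  have := hStarR_pos hp hl hr
  rw [speed3_eq hp hl hr]; field_simp; ring

theorem height_mul_speed1 (hl : Admissible ql) :
    height ql * (vel ql - speed1 p ql qr) = cL p ql qr := by
  have := hl.1
  rw [speed1]; field_simp; ring

theorem height_mul_speed3 (hr : Admissible qr) :
    height qr * (vel qr - speed3 p ql qr) = -cR p ql qr := by
  have := hr.1
  rw [speed3]; field_simp; ring

/-! ### Intermediate states -/

@[simp] theorem height_toState (w : RelaxState) : height w.toState = w.h := rfl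

theorem vel_toState {w : RelaxState} (h : w.h ≠ 0) : vel w.toState = w.u := by
  simp [vel, RelaxState.toState, h]

theorem sigxx_toState {w : RelaxState} (h : w.h ≠ 0) : sigxx w.toState = w.sigxx := by
  simp [sigxx, RelaxState.toState, h]

theorem sigzz_toState {w : RelaxState} (h : w.h ≠ 0) : sigzz w.toState = w.sigzz := by
  simp [sigzz, RelaxState.toState, h]

theorem admissible_toState {w : RelaxState} (h : 0 < w.h) (h1 : 0 < w.sigxx) (h2 : 0 < w.sigzz) :
    Admissible w.toState :=
  ⟨h, by rwa [sigxx_toState h.ne'], by rwa [sigzz_toState h.ne']⟩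

theorem toState_relaxInit {q : State} (hq : height q ≠ 0) (c : ℝ) :
    (relaxInit p c q).toState = q := by
  have : q 0 ≠ 0 := hq
  ext k
  fin_cases k <;> simp [relaxInit, RelaxState.toState, height, vel, sigxx, sigzz] <;> field_simp

theorem toState_stateL (hl : Admissible ql) : (stateL p ql qr).toState = ql :=
  toState_relaxInit hl.1.ne' _

theorem toState_stateR (hr : Admissible qr) : (stateR p ql qr).toState = qr :=
  toState_relaxInit hr.1.ne' _

theorem admissible_stateLS (hp : p.Positive) (hl : Admissible ql) (hr : Admissible qr) :
    Admissible (stateLS p ql qr).toState := by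
  have h := hStarL_pos hp hl hr
  obtain ⟨h0, h1, h2⟩ := hl
  refine admissible_toState h ?_ ?_ <;> simp only [stateLS] <;> positivity

theorem admissible_stateRS (hp : p.Positive) (hl : Admissible ql) (hr : Admissible qr) :
    Admissible (stateRS p ql qr).toState := by
  have h := hStarR_pos hp hl hr
  obtain ⟨h0, h1, h2⟩ := hr
  refine admissible_toState h ?_ ?_ <;> simp only [stateRS] <;> positivity

theorem sxx_eq_of_wave {q q' : State} (hq : 0 < height q) (hq' : 0 < height q')
    (h : sigxx q' = sigxx q * (height q / height q') ^ 2) : sxx q' = sxx q := by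
  rw [sxx, sxx, h, Real.sqrt_mul' _ (sq_nonneg _), Real.sqrt_sq (by positivity), mul_inv, inv_div]
  field_simp

theorem szz_eq_of_wave {q q' : State} (hq : 0 < height q) (hq' : 0 < height q')
    (h : sigzz q' = sigzz q * (height q' / height q) ^ 2) : szz q' = szz q := by
  rw [szz, szz, h, Real.sqrt_mul' _ (sq_nonneg _), Real.sqrt_sq (by positivity)]
  field_simp

theorem sxx_stateLS (hp : p.Positive) (hl : Admissible ql) (hr : Admissible qr) :
    sxx (stateLS p ql qr).toState = sxx ql :=
  sxx_eq_of_wave hl.1 (hStarL_pos hp hl hr) (sigxx_toState (hStarL_pos hp hl hr).ne')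

theorem szz_stateLS (hp : p.Positive) (hl : Admissible ql) (hr : Admissible qr) :
    szz (stateLS p ql qr).toState = szz ql :=
  szz_eq_of_wave hl.1 (hStarL_pos hp hl hr) (sigzz_toState (hStarL_pos hp hl hr).ne')

theorem sxx_stateRS (hp : p.Positive) (hl : Admissible ql) (hr : Admissible qr) :
    sxx (stateRS p ql qr).toState = sxx qr :=
  sxx_eq_of_wave hr.1 (hStarR_pos hp hl hr) (sigxx_toState (hStarR_pos hp hl hr).ne')

theorem szz_stateRS (hp : p.Positive) (hl : Admissible ql) (hr : Admissible qr) :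
    szz (stateRS p ql qr).toState = szz qr :=
  szz_eq_of_wave hr.1 (hStarR_pos hp hl hr) (sigzz_toState (hStarR_pos hp hl hr).ne')

/-! ### Rankine-Hugoniot relations -/

/-- In the frame of the discontinuity, `h φ` is carried by the mass flux `m`, common to both sides.
Only the jump of `φ` and that of the extra flux `V` remain. -/
theorem jump_eq_iff {S m h h' u u' φ φ' V V' : ℝ} (hm : h * (u - S) = m) (hm' : h' * (u' - S) = m) :
    u' * (h' * φ') + V' - (u * (h * φ) + V) = S * (h' * φ' - h * φ) ↔
      m * (φ' - φ) + (V' - V) = 0 := by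
  subst hm
  constructor <;> intro H
  · linear_combination H - φ' * hm'
  · linear_combination H + φ' * hm'

theorem rankineHugoniot_of_wave {S m : ℝ} {w w' : RelaxState} (hm : w.h * (w.u - S) = m)
    (hm' : w'.h * (w'.u - S) = m) (hu : m * (w'.u - w.u) + (w'.pi - w.pi) = 0)
    (hpi : m * (w'.pi / w'.c ^ 2 - w.pi / w.c ^ 2) + (w'.u - w.u) = 0)
    (hc : m * (w'.c - w.c) = 0) (hx : m * (sxx w'.toState - sxx w.toState) = 0)
    (hz : m * (szz w'.toState - szz w.toState) = 0)
    (he : m * ((w'.ehat - w'.pi ^ 2 / (2 * w'.c ^ 2)) - (w.ehat - w.pi ^ 2 / (2 * w.c ^ 2))) = 0) :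
    RankineHugoniot S w w' := by
  have J := fun φ φ' V V' => (jump_eq_iff (φ := φ) (φ' := φ') (V := V) (V' := V') hm hm').2
  ext k
  fin_cases k
  · simpa [RelaxState.relaxFlux, RelaxState.conserved] using J 1 1 0 0 (by ring)
  · simpa [RelaxState.relaxFlux, RelaxState.conserved] using J _ _ _ _ hu
  · simpa [RelaxState.relaxFlux, RelaxState.conserved, mul_div_assoc] using J _ _ _ _ hpi
  · simpa [RelaxState.relaxFlux, RelaxState.conserved] using J w.c w'.c 0 0 (by simpa using hc)
  · simpa [RelaxState.relaxFlux, RelaxState.conserved] using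
      J (sxx w.toState) (sxx w'.toState) 0 0 (by simpa using hx)
  · simpa [RelaxState.relaxFlux, RelaxState.conserved] using
      J (szz w.toState) (szz w'.toState) 0 0 (by simpa using hz)
  · simpa [RelaxState.relaxFlux, RelaxState.conserved] using J _ _ 0 0 (by simpa using he)

theorem rankineHugoniot_left (hp : p.Positive) (hl : Admissible ql) (hr : Admissible qr) :
    RankineHugoniot (speed1 p ql qr) (stateL p ql qr) (stateLS p ql qr) := by
  have hc := cL_pos hp hl hr
  have hpi := piStar_sub_pressureL hp hl hr
  refine rankineHugoniot_of_wave (m := cL p ql qr) (height_mul_speed1 hl) (hStarL_mul hp hl hr)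
    ?_ ?_ ?_ ?_ ?_ ?_
  · simp only [stateL, stateLS, relaxInit]; linarith
  · simp only [stateL, stateLS, relaxInit]
    rw [← sub_div, hpi]
    field_simp
    ring
  · simp [stateL, stateLS, relaxInit]
  · rw [sxx_stateLS hp hl hr, toState_stateL hl]; ring
  · rw [szz_stateLS hp hl hr, toState_stateL hl]; ring
  · simp only [stateL, stateLS, relaxInit]; ring

theorem rankineHugoniot_middle (p : Params) (ql qr : State) :
    RankineHugoniot (speed2 p ql qr) (stateLS p ql qr) (stateRS p ql qr) := by
  -- No mass crosses the contact, so advected quantities may jump freely; only `u` and `π` have to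
  -- be continuous.
  refine rankineHugoniot_of_wave (m := 0) ?_ ?_ ?_ ?_ ?_ ?_ ?_ ?_ <;> simp [stateLS, stateRS, speed2]

theorem rankineHugoniot_right (hp : p.Positive) (hl : Admissible ql) (hr : Admissible qr) :
    RankineHugoniot (speed3 p ql qr) (stateRS p ql qr) (stateR p ql qr) := by
  have hc := cR_pos hp hl hr
  have hpi := piStar_sub_pressureR hp hl hr
  refine rankineHugoniot_of_wave (m := -cR p ql qr) (hStarR_mul hp hl hr) (height_mul_speed3 hr)
    ?_ ?_ ?_ ?_ ?_ ?_
  · simp only [stateR, stateRS, relaxInit]; linarith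
  · simp only [stateR, stateRS, relaxInit]
    rw [← sub_div, ← neg_sub (piStar p ql qr), hpi]
    field_simp
    ring
  · simp [stateR, stateRS, relaxInit]
  · rw [sxx_stateRS hp hl hr, toState_stateR hr]; ring
  · rw [szz_stateRS hp hl hr, toState_stateR hr]; ring
  · simp only [stateR, stateRS, relaxInit]; ring

/-! ### Subcharacteristic condition -/

/-- The subcharacteristic condition `h² ∂_h P ≤ c²` at an intermediate height `y`; here
`b₁ = σ_xx h²` and `b₂ = σ_zz / h²`. -/
theorem subcharacteristic {g K b1 b2 h a X y : ℝ} (hg : 0 < g) (hK : 0 < K) (hb1 : 0 < b1)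
    (hb2 : 0 < b2) (hh : 0 < h) (ha : 0 < a) (hX : 0 ≤ X) (hy : 0 < y)
    (hφ : g * h ^ 3 + 3 * K * b2 * h ^ 4 + K * b1 = (h * a) ^ 2)
    (hyX : y * (a + X) ≤ h * (a + 2 * X)) :
    g * y ^ 3 + 3 * K * b2 * y ^ 4 + K * b1 ≤ (h * (a + 2 * X)) ^ 2 := by
  -- The left side increases with `y`, so a rarefied state `y ≤ h` is immediate. For `y ≥ h` its
  -- growth has to be compared with that of `c²`.
  rcases le_total y h with hyh | hyh
  · calc g * y ^ 3 + 3 * K * b2 * y ^ 4 + K * b1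
        ≤ g * h ^ 3 + 3 * K * b2 * h ^ 4 + K * b1 := by gcongr
      _ = (h * a) ^ 2 := hφ
      _ ≤ (h * (a + 2 * X)) ^ 2 := by gcongr; linarith
  -- The powers of `y` are at most `4`, so the value at `y` is at most `(y / h)⁴` times the value at
  -- `h`.
  · have h1 : (g * y ^ 3 + 3 * K * b2 * y ^ 4 + K * b1) * h ^ 4 ≤ y ^ 4 * (h * a) ^ 2 := by
      rw [← hφ]
      have e1 : g * y ^ 3 * h ^ 3 * h ≤ g * y ^ 3 * h ^ 3 * y := by gcongr
      have e2 : K * b1 * h ^ 4 ≤ K * b1 * y ^ 4 := by gcongr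
      linarith
    -- Squaring the height bound and using `(a + X)² ≥ a (a + 2X)` leaves a common factor `a + 2X`
    -- to cancel.
    have h2 : y ^ 2 * a ≤ h ^ 2 * (a + 2 * X) := by
      have e1 : (y * (a + X)) ^ 2 ≤ (h * (a + 2 * X)) ^ 2 := by gcongr
      have e2 : y ^ 2 * (a * (a + 2 * X)) ≤ y ^ 2 * (a + X) ^ 2 := by
        gcongr
        nlinarith [sq_nonneg X]
      refine le_of_mul_le_mul_right (a := a + 2 * X) ?_ (by linarith)
      linarith
    have h3 : (y ^ 2 * a) ^ 2 ≤ (h ^ 2 * (a + 2 * X)) ^ 2 := by gcongr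
    refine le_of_mul_le_mul_right (a := h ^ 4) ?_ (by positivity)
    have h4 : (y ^ 2 * a) ^ 2 * h ^ 2 ≤ (h ^ 2 * (a + 2 * X)) ^ 2 * h ^ 2 := by gcongr
    linarith

theorem mul_soundSpeed_sq (hp : p.Positive) {q : State} (hq : Admissible q) :
    p.g * height q ^ 3 + 3 * p.elastic * (sigzz q / height q ^ 2) * height q ^ 4
      + p.elastic * (sigxx q * height q ^ 2) = (height q * soundSpeed p q) ^ 2 := by
  have := hq.1
  rw [mul_pow, soundSpeed_sq hp hq, soundSpeedSq]
  field_simp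
  ring

/-- The left side is the coefficient of the quadratic remainder in the expansion of `e` in `1 / h`
along a wave from height `x` to height `y`. It increases with both heights, and when they coincide
it is `h² ∂_h P`; so it is bounded by the value of `h² ∂_h P` at the larger height, and bounds at
the two ends suffice. -/
theorem energy_remainder_bound {g K b1 b2 x y C : ℝ} (hg : 0 < g) (hK : 0 < K)
    (hb2 : 0 < b2) (hx : 0 < x) (hy : 0 < y)
    (hCx : g * x ^ 3 + 3 * K * b2 * x ^ 4 + K * b1 ≤ C)
    (hCy : g * y ^ 3 + 3 * K * b2 * y ^ 4 + K * b1 ≤ C) :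
    g * (x ^ 2 * y) + K * b2 * (x ^ 2 * y * (y + 2 * x)) + K * b1 ≤ C := by
  have aux : ∀ M : ℝ, x ≤ M → y ≤ M → g * M ^ 3 + 3 * K * b2 * M ^ 4 + K * b1 ≤ C →
      g * (x ^ 2 * y) + K * b2 * (x ^ 2 * y * (y + 2 * x)) + K * b1 ≤ C := by
    intro M hxM hyM hM
    have hM0 : 0 ≤ M := hx.le.trans hxM
    calc _ ≤ g * (M ^ 2 * M) + K * b2 * (M ^ 2 * M * (M + 2 * M)) + K * b1 := by gcongr
      _ = g * M ^ 3 + 3 * K * b2 * M ^ 4 + K * b1 := by ring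
      _ ≤ C := hM
  rcases le_total x y with h | h
  · exact aux y h le_rfl hCy
  · exact aux x le_rfl h hCx

/-- The energy at an intermediate state is dominated by the relaxation energy. -/
theorem internalEnergy_le_of_wave (hp : p.Positive) {q q' : State} {c π : ℝ} (hq : Admissible q)
    (hq' : 0 < height q') (hx : sigxx q' = sigxx q * (height q / height q') ^ 2)
    (hz : sigzz q' = sigzz q * (height q' / height q) ^ 2) (hc : 0 < c)
    (hC : p.g * height q ^ 3 + 3 * p.elastic * (sigzz q / height q ^ 2) * height q ^ 4
      + p.elastic * (sigxx q * height q ^ 2) ≤ c ^ 2)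
    (hC' : p.g * height q' ^ 3 + 3 * p.elastic * (sigzz q / height q ^ 2) * height q' ^ 4
      + p.elastic * (sigxx q * height q ^ 2) ≤ c ^ 2)
    (hπ : π = pressure p q - c ^ 2 * (1 / height q' - 1 / height q)) :
    internalEnergy p q' ≤ internalEnergy p q - pressure p q ^ 2 / (2 * c ^ 2)
      + π ^ 2 / (2 * c ^ 2) := by
  obtain ⟨h0, h1, h2⟩ := hq
  have hB := energy_remainder_bound hp.g_pos hp.elastic_pos (div_pos h2 (pow_pos h0 2)) h0 hq' hC hC'
  -- The product `σ_xx σ_zz` does not change through the wave, so the logarithm cancels and the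
  -- comparison of energies is between rational functions.
  have hlog : sigxx q' * sigzz q' = sigxx q * sigzz q := by rw [hx, hz]; field_simp
  -- Both energies have the same tangent in `1 / h`, of slope `-P`. The relaxation energy has
  -- curvature `c²`, and the exact expansion `hid` below has instead the coefficient bounded in
  -- `hB`.
  have hr : internalEnergy p q - pressure p q ^ 2 / (2 * c ^ 2) + π ^ 2 / (2 * c ^ 2)
      = internalEnergy p q - pressure p q * (1 / height q' - 1 / height q)
        + c ^ 2 / 2 * (1 / height q' - 1 / height q) ^ 2 := by
    rw [hπ]; field_simp; ring
  have hle := mul_le_mul_of_nonneg_right hB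
    (sq_nonneg (1 / height q' - 1 / height q) : 0 ≤ (1 / height q' - 1 / height q) ^ 2)
  have hid : internalEnergy p q' = internalEnergy p q
      - pressure p q * (1 / height q' - 1 / height q)
        + (p.g * (height q ^ 2 * height q') + p.elastic * (sigzz q / height q ^ 2) *
          (height q ^ 2 * height q' * (height q' + 2 * height q))
          + p.elastic * (sigxx q * height q ^ 2)) / 2 * (1 / height q' - 1 / height q) ^ 2 := by
    rw [internalEnergy_eq, internalEnergy_eq, hlog, hx, hz, pressure_eq]
    field_simp
    ring
  rw [hr, hid]
  linarith

theorem internalEnergy_stateLS_le (hp : p.Positive) (hl : Admissible ql) (hr : Admissible qr) :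
    internalEnergy p (stateLS p ql qr).toState ≤ (stateLS p ql qr).ehat := by
  have hs := hStarL_pos hp hl hr
  have hc := cL_pos hp hl hr
  have ha := soundSpeed_pos hp hl
  have hX := excess_nonneg hp hl hr (pressure p ql) (pressure p qr)
  have hb := (star_height_bound hl.1 ha hX cL_eq (neg_excess_le_uStar_sub hp hl hr)).2
  rw [← hStarL_eq hp hl hr] at hb
  refine internalEnergy_le_of_wave hp (q' := (stateLS p ql qr).toState) hl hs
    (sigxx_toState hs.ne') (sigzz_toState hs.ne') hc ?_ ?_ ?_
  · rw [mul_soundSpeed_sq hp hl]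
    exact pow_le_pow_left₀ (mul_pos hl.1 ha).le (height_mul_soundSpeed_le_cL hp hl hr) 2
  · exact subcharacteristic hp.g_pos hp.elastic_pos (mul_pos hl.2.1 (pow_pos hl.1 2))
      (div_pos hl.2.2 (pow_pos hl.1 2)) hl.1 ha hX hs (mul_soundSpeed_sq hp hl) hb
  · have h1 := cL_div_hStarL hp hl hr
    have h2 := piStar_sub_pressureL hp hl hr
    rw [height_toState]
    -- `π + c² / h` is continuous across the acoustic wave.
    change piStar p ql qr = _ - _ * (1 / hStarL p ql qr - _)
    linear_combination h2 + cL p ql qr * h1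

theorem internalEnergy_stateRS_le (hp : p.Positive) (hl : Admissible ql) (hr : Admissible qr) :
    internalEnergy p (stateRS p ql qr).toState ≤ (stateRS p ql qr).ehat := by
  have hs := hStarR_pos hp hl hr
  have hc := cR_pos hp hl hr
  have ha := soundSpeed_pos hp hr
  have hX := excess_nonneg hp hl hr (pressure p qr) (pressure p ql)
  have hb := (star_height_bound hr.1 ha hX cR_eq (neg_excess_le_sub_uStar hp hl hr)).2
  rw [← hStarR_eq hp hl hr] at hb
  refine internalEnergy_le_of_wave hp (q' := (stateRS p ql qr).toState) hr hs
    (sigxx_toState hs.ne') (sigzz_toState hs.ne') hc ?_ ?_ ?_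
  · rw [mul_soundSpeed_sq hp hr]
    exact pow_le_pow_left₀ (mul_pos hr.1 ha).le (height_mul_soundSpeed_le_cR hp hl hr) 2
  · exact subcharacteristic hp.g_pos hp.elastic_pos (mul_pos hr.2.1 (pow_pos hr.1 2))
      (div_pos hr.2.2 (pow_pos hr.1 2)) hr.1 ha hX hs (mul_soundSpeed_sq hp hr) hb
  · have h1 := cR_div_hStarR hp hl hr
    have h2 := piStar_sub_pressureR hp hl hr
    rw [height_toState]
    change piStar p ql qr = _ - _ * (1 / hStarR p ql qr - _)
    linear_combination h2 + cR p ql qr * h1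

/-! ### Bounds on the speeds -/

/-- Together with `neg_pressure_le`, this controls a pressure jump by `h_l a_l² + h_r a_r²`, hence
by `(h_l a_l + h_r a_r) (a_l + a_r)`. The quotient in the definition of `c` is then at most `a_l +
a_r`, with no dependence on the parameters. -/
theorem pressure_le (hp : p.Positive) {q : State} (hq : Admissible q) :
    pressure p q ≤ height q * soundSpeed p q ^ 2 := by
  have hg := hp.g_pos
  have hK := hp.elastic_pos
  rw [soundSpeed_sq hp hq, soundSpeedSq, pressure_eq]
  obtain ⟨h0, h1, h2⟩ := hq
  have := mul_pos hg (pow_pos h0 2)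
  have := mul_pos (mul_pos hK h0) h1
  have := mul_pos (mul_pos hK h0) h2
  linarith

theorem neg_pressure_le (hp : p.Positive) {q : State} (hq : Admissible q) :
    -pressure p q ≤ height q * soundSpeed p q ^ 2 := by
  have hg := hp.g_pos
  have hK := hp.elastic_pos
  rw [soundSpeed_sq hp hq, soundSpeedSq, pressure_eq]
  obtain ⟨h0, h1, h2⟩ := hq
  have := mul_pos hg (pow_pos h0 2)
  have := mul_pos (mul_pos hK h0) h1
  have := mul_pos (mul_pos hK h0) h2
  linarith

theorem excess_le {P P' hl al hr ar ul ur : ℝ} (h0 : 0 < hl) (h1 : 0 < al) (h2 : 0 < hr)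
    (h3 : 0 < ar) (h : P' - P ≤ hl * al ^ 2 + hr * ar ^ 2) :
    max 0 (ul - ur) + max 0 (P' - P) / (hl * al + hr * ar) ≤ |ul| + |ur| + al + ar := by
  have e1 : max 0 (ul - ur) ≤ |ul| + |ur| :=
    max_le (by positivity) ((le_abs_self _).trans (abs_sub _ _))
  have e2 : max 0 (P' - P) / (hl * al + hr * ar) ≤ al + ar := by
    rw [div_le_iff₀ (by positivity)]
    refine max_le (by positivity) (h.trans ?_)
    have := mul_pos h0 h1
    have := mul_pos h2 h3
    nlinarith
  linarith

theorem cL_div_le (hp : p.Positive) (hl : Admissible ql) (hr : Admissible qr) :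
    cL p ql qr / height ql ≤ 3 * (|vel ql| + |vel qr| + soundSpeed p ql + soundSpeed p qr) := by
  have h1 := soundSpeed_pos hp hl
  have h2 := soundSpeed_pos hp hr
  have e := excess_le (ul := vel ql) (ur := vel qr) hl.1 h1 hr.1 h2
    (show pressure p qr - pressure p ql ≤ _ by
      linarith [neg_pressure_le hp hl, pressure_le hp hr])
  have := abs_nonneg (vel ql)
  have := abs_nonneg (vel qr)
  rw [cL_eq, mul_div_cancel_left₀ _ hl.1.ne', excess]
  linarith

theorem cR_div_le (hp : p.Positive) (hl : Admissible ql) (hr : Admissible qr) :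
    cR p ql qr / height qr ≤ 3 * (|vel ql| + |vel qr| + soundSpeed p ql + soundSpeed p qr) := by
  have h1 := soundSpeed_pos hp hl
  have h2 := soundSpeed_pos hp hr
  have e := excess_le (ul := vel ql) (ur := vel qr) hl.1 h1 hr.1 h2
    (show pressure p ql - pressure p qr ≤ _ by
      linarith [neg_pressure_le hp hr, pressure_le hp hl])
  have := abs_nonneg (vel ql)
  have := abs_nonneg (vel qr)
  rw [cR_eq, mul_div_cancel_left₀ _ hr.1.ne', excess]
  linarith

theorem maxSpeed_le (hp : p.Positive) (hl : Admissible ql) (hr : Admissible qr) :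
    maxSpeed p ql qr ≤ 4 * (|vel ql| + |vel qr| + soundSpeed p ql + soundSpeed p qr) := by
  have h1 := soundSpeed_pos hp hl
  have h2 := soundSpeed_pos hp hr
  have h3 := abs_le.1 (le_refl |vel ql|)
  have h4 := abs_le.1 (le_refl |vel qr|)
  have h5 := cL_div_le hp hl hr
  have h6 := cR_div_le hp hl hr
  have h7 := speed1_lt_speed2 hp hl hr
  have h8 := speed2_lt_speed3 hp hl hr
  have h9 := div_pos (cL_pos hp hl hr) hl.1
  have h10 := div_pos (cR_pos hp hl hr) hr.1
  rw [speed1] at h7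
  rw [speed3] at h8
  rw [maxSpeed, speed1, speed3]
  have := abs_nonneg (vel ql)
  have := abs_nonneg (vel qr)
  -- The extreme speeds have one bound each from `c / h` and the other from the neighbouring
  -- velocity; `u_*` lies between them.
  refine max_le ?_ (max_le ?_ ?_) <;> rw [abs_le] <;> constructor <;> linarith

/-! ### Integrals of step functions -/

/-- The step function with values `a`, `b`, `c`, `d` separated by `s₁`, `s₂`, `s₃`. -/
noncomputable def stepFun (s1 s2 s3 a b c d ξ : ℝ) : ℝ :=
  if ξ < s1 then a else if ξ < s2 then b else if ξ < s3 then c else d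

/-- Contribution of the waves of negative speeds to a numerical flux. -/
noncomputable def leftSum (s1 s2 s3 a b c d : ℝ) : ℝ :=
  min 0 s1 * (b - a) + min 0 s2 * (c - b) + min 0 s3 * (d - c)

/-- Contribution of the waves of positive speeds to a numerical flux. -/
noncomputable def rightSum (s1 s2 s3 a b c d : ℝ) : ℝ :=
  max 0 s1 * (b - a) + max 0 s2 * (c - b) + max 0 s3 * (d - c)

section StepFun

variable {s1 s2 s3 : ℝ} (a b c d : ℝ)

/-- A sum of Heaviside jumps, each of which can be integrated separately over the half line. The
ordering of the speeds makes the nested tests agree with the sum. -/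
theorem stepFun_sub_left (h12 : s1 < s2) (h23 : s2 < s3) (ξ : ℝ) :
    stepFun s1 s2 s3 a b c d ξ - a = (Set.Ici s1).indicator (fun _ => b - a) ξ
      + (Set.Ici s2).indicator (fun _ => c - b) ξ + (Set.Ici s3).indicator (fun _ => d - c) ξ := by
  simp only [stepFun, Set.indicator, Set.mem_Ici]
  split_ifs <;> linarith

theorem stepFun_sub_right (h12 : s1 < s2) (h23 : s2 < s3) (ξ : ℝ) :
    stepFun s1 s2 s3 a b c d ξ - d = (Set.Iio s1).indicator (fun _ => a - b) ξ
      + (Set.Iio s2).indicator (fun _ => b - c) ξ + (Set.Iio s3).indicator (fun _ => c - d) ξ := by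
  simp only [stepFun, Set.indicator, Set.mem_Iio]
  split_ifs <;> linarith

open MeasureTheory in
theorem integral_Iic_indicator_Ici (s J : ℝ) :
    IntegrableOn ((Set.Ici s).indicator fun _ => J) (Set.Iic (0 : ℝ)) ∧
      ∫ ξ in Set.Iic (0 : ℝ), (Set.Ici s).indicator (fun _ => J) ξ = -(min 0 s * J) := by
  constructor
  · rw [IntegrableOn, integrable_indicator_iff measurableSet_Ici, IntegrableOn,
      Measure.restrict_restrict measurableSet_Ici, Set.Ici_inter_Iic]
    exact integrableOn_const (by simp)
  · rw [setIntegral_indicator measurableSet_Ici, Set.inter_comm, Set.Ici_inter_Iic,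
      setIntegral_const, smul_eq_mul, Real.volume_real_Icc]
    rcases le_total 0 s with h | h
    · rw [max_eq_right (by linarith), min_eq_left h]; ring
    · rw [max_eq_left (by linarith), min_eq_right h]; ring

open MeasureTheory in
theorem integral_Ioi_indicator_Iio (s J : ℝ) :
    IntegrableOn ((Set.Iio s).indicator fun _ => J) (Set.Ioi (0 : ℝ)) ∧
      ∫ ξ in Set.Ioi (0 : ℝ), (Set.Iio s).indicator (fun _ => J) ξ = max 0 s * J := by
  constructor
  · rw [IntegrableOn, integrable_indicator_iff measurableSet_Iio, IntegrableOn,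
      Measure.restrict_restrict measurableSet_Iio, Set.inter_comm, Set.Ioi_inter_Iio]
    exact integrableOn_const (by simp)
  · rw [setIntegral_indicator measurableSet_Iio, Set.Ioi_inter_Iio,
      setIntegral_const, smul_eq_mul, Real.volume_real_Ioo, sub_zero, max_comm]

theorem integral_stepFun_sub_left (h12 : s1 < s2) (h23 : s2 < s3) :
    ∫ ξ in Set.Iic (0 : ℝ), (stepFun s1 s2 s3 a b c d ξ - a) = -leftSum s1 s2 s3 a b c d := by
  simp_rw [stepFun_sub_left a b c d h12 h23]
  obtain ⟨i1, e1⟩ := integral_Iic_indicator_Ici s1 (b - a)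
  obtain ⟨i2, e2⟩ := integral_Iic_indicator_Ici s2 (c - b)
  obtain ⟨i3, e3⟩ := integral_Iic_indicator_Ici s3 (d - c)
  refine (MeasureTheory.integral_add (i1.add i2) i3).trans ?_
  rw [MeasureTheory.integral_add' i1 i2, e1, e2, e3,
    leftSum]
  ring

theorem integral_stepFun_sub_right (h12 : s1 < s2) (h23 : s2 < s3) :
    ∫ ξ in Set.Ioi (0 : ℝ), (stepFun s1 s2 s3 a b c d ξ - d) = -rightSum s1 s2 s3 a b c d := by
  simp_rw [stepFun_sub_right a b c d h12 h23]
  obtain ⟨i1, e1⟩ := integral_Ioi_indicator_Iio s1 (a - b)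
  obtain ⟨i2, e2⟩ := integral_Ioi_indicator_Iio s2 (b - c)
  obtain ⟨i3, e3⟩ := integral_Ioi_indicator_Iio s3 (c - d)
  refine (MeasureTheory.integral_add (i1.add i2) i3).trans ?_
  rw [MeasureTheory.integral_add' i1 i2, e1, e2, e3,
    rightSum]
  ring

theorem intervalIntegrable_stepFun (h12 : s1 < s2) (h23 : s2 < s3) (x y : ℝ) :
    IntervalIntegrable (stepFun s1 s2 s3 a b c d) MeasureTheory.volume x y := by
  have h : stepFun s1 s2 s3 a b c d = fun ξ => a + ((Set.Ici s1).indicator (fun _ => b - a) ξ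
      + (Set.Ici s2).indicator (fun _ => c - b) ξ
      + (Set.Ici s3).indicator (fun _ => d - c) ξ) := by
    funext ξ
    rw [← stepFun_sub_left a b c d h12 h23 ξ]; ring
  have hi : ∀ s J : ℝ, IntervalIntegrable ((Set.Ici s).indicator fun _ => J)
      MeasureTheory.volume x y := fun s J =>
    ⟨MeasureTheory.IntegrableOn.indicator (by simp) measurableSet_Ici,
      MeasureTheory.IntegrableOn.indicator (by simp) measurableSet_Ici⟩
  rw [h]
  exact intervalIntegrable_const.add (((hi _ _).add (hi _ _)).add (hi _ _))

/-- To the left of `-L` no wave has passed and the integrand of the half-line integral is zero, so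
that integral can be cut at `-L`. This is where the CFL condition enters. -/
theorem integral_stepFun_neg (h12 : s1 < s2) (h23 : s2 < s3) {L : ℝ} (hL : 0 ≤ L) (h1 : -L ≤ s1) :
    ∫ ξ in (-L)..0, stepFun s1 s2 s3 a b c d ξ = L * a - leftSum s1 s2 s3 a b c d := by
  have h : ∫ ξ in (-L)..0, (stepFun s1 s2 s3 a b c d ξ - a) = -leftSum s1 s2 s3 a b c d := by
    rw [← integral_stepFun_sub_left a b c d h12 h23, intervalIntegral.integral_of_le (by linarith),
      ← MeasureTheory.integral_Icc_eq_integral_Ioc]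
    refine (MeasureTheory.setIntegral_eq_of_subset_of_forall_sdiff_eq_zero measurableSet_Iic
      (fun x hx => hx.2) fun x hx => ?_).symm
    have : x < -L := by
      by_contra h
      exact hx.2 ⟨not_lt.1 h, hx.1⟩
    rw [stepFun, if_pos (by linarith), sub_self]
  rw [intervalIntegral.integral_sub (intervalIntegrable_stepFun a b c d h12 h23 _ _)
    intervalIntegrable_const, intervalIntegral.integral_const, smul_eq_mul] at h
  linarith

theorem integral_stepFun_pos (h12 : s1 < s2) (h23 : s2 < s3) {L : ℝ} (hL : 0 ≤ L) (h3 : s3 ≤ L) :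
    ∫ ξ in (0 : ℝ)..L, stepFun s1 s2 s3 a b c d ξ = L * d - rightSum s1 s2 s3 a b c d := by
  have h : ∫ ξ in (0 : ℝ)..L, (stepFun s1 s2 s3 a b c d ξ - d) = -rightSum s1 s2 s3 a b c d := by
    rw [← integral_stepFun_sub_right a b c d h12 h23, intervalIntegral.integral_of_le hL]
    refine (MeasureTheory.setIntegral_eq_of_subset_of_forall_sdiff_eq_zero measurableSet_Ioi
      (fun x hx => hx.1) fun x hx => ?_).symm
    have : L < x := by
      by_contra h
      exact hx.2 ⟨hx.1, not_lt.1 h⟩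
    rw [stepFun, if_neg (by linarith), if_neg (by linarith), if_neg (by linarith), sub_self]
  rw [intervalIntegral.integral_sub (intervalIntegrable_stepFun a b c d h12 h23 _ _)
    intervalIntegrable_const, intervalIntegral.integral_const, smul_eq_mul] at h
  linarith

/-- The sign of each speed disappears from the sum, which is why `F_r - F_l` has a smooth closed
form even where a wave speed changes sign. -/
theorem leftSum_add_rightSum : leftSum s1 s2 s3 a b c d + rightSum s1 s2 s3 a b c d
    = s1 * (b - a) + s2 * (c - b) + s3 * (d - c) := by
  have h : ∀ s : ℝ, min 0 s + max 0 s = s := fun s => by rw [min_add_max, zero_add]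
  rw [leftSum, rightSum]
  linear_combination (b - a) * h s1 + (c - b) * h s2 + (d - c) * h s3

/-- The weights of the four values in the average of a step function over a half cell. -/
theorem sub_leftSum_eq (μ : ℝ) : a - μ * leftSum s1 s2 s3 a b c d =
    (1 + μ * min 0 s1) * a + μ * (min 0 s2 - min 0 s1) * b + μ * (min 0 s3 - min 0 s2) * c
      + μ * -min 0 s3 * d := by
  rw [leftSum]; ring

theorem sub_rightSum_eq (μ : ℝ) : d - μ * rightSum s1 s2 s3 a b c d =
    μ * max 0 s1 * a + μ * (max 0 s2 - max 0 s1) * b + μ * (max 0 s3 - max 0 s2) * c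
      + (1 - μ * max 0 s3) * d := by
  rw [rightSum]; ring

/-- Value at `0` of the flux associated with a step function that satisfies the Rankine-Hugoniot
relations. -/
theorem add_leftSum_eq_stepFun {α β γ δ : ℝ} (h12 : s1 < s2) (h23 : s2 < s3)
    (h1 : β - α = s1 * (b - a)) (h2 : γ - β = s2 * (c - b)) (h3 : δ - γ = s3 * (d - c)) :
    α + leftSum s1 s2 s3 a b c d = stepFun s1 s2 s3 α β γ δ 0 := by
  rw [leftSum, stepFun]
  split_ifs with e1 e2 e3
  · rw [min_eq_left e1.le, min_eq_left (by linarith), min_eq_left (by linarith)]; ring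
  · rw [min_eq_right (by linarith), min_eq_left (by linarith), min_eq_left (by linarith)]; linarith
  · rw [min_eq_right (by linarith), min_eq_right (by linarith), min_eq_left (by linarith)]; linarith
  · rw [min_eq_right (by linarith), min_eq_right (by linarith), min_eq_right (by linarith)]
    linarith

theorem sub_rightSum_eq_stepFun {α β γ δ : ℝ} (h12 : s1 < s2) (h23 : s2 < s3)
    (h1 : β - α = s1 * (b - a)) (h2 : γ - β = s2 * (c - b)) (h3 : δ - γ = s3 * (d - c)) :
    δ - rightSum s1 s2 s3 a b c d = stepFun s1 s2 s3 α β γ δ 0 := by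
  rw [← add_leftSum_eq_stepFun a b c d h12 h23 h1 h2 h3]
  linarith [leftSum_add_rightSum (s1 := s1) (s2 := s2) (s3 := s3) a b c d]

end StepFun

/-! ### Numerical fluxes in closed form -/

/-- `∑ min(0, Σ_i) [f]_i`, the jumps being those of `f` of the approximate Riemann solver. -/
noncomputable def waveL (p : Params) (f : State → ℝ) (ql qr : State) : ℝ :=
  leftSum (speed1 p ql qr) (speed2 p ql qr) (speed3 p ql qr)
    (f ql) (f (stateLS p ql qr).toState) (f (stateRS p ql qr).toState) (f qr)

/-- `∑ max(0, Σ_i) [f]_i`, the jumps being those of `f` of the approximate Riemann solver. -/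
noncomputable def waveR (p : Params) (f : State → ℝ) (ql qr : State) : ℝ :=
  rightSum (speed1 p ql qr) (speed2 p ql qr) (speed3 p ql qr)
    (f ql) (f (stateLS p ql qr).toState) (f (stateRS p ql qr).toState) (f qr)

theorem map_relaxSolution {α : Type*} (f : RelaxState → α) (p : Params) (ql qr : State) (ξ : ℝ) :
    f (relaxSolution p ql qr ξ) = if ξ < speed1 p ql qr then f (stateL p ql qr)
      else if ξ < speed2 p ql qr then f (stateLS p ql qr)
      else if ξ < speed3 p ql qr then f (stateRS p ql qr) else f (stateR p ql qr) := by
  rw [relaxSolution, apply_ite f, apply_ite f, apply_ite f]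

theorem map_riemannSolver (f : State → ℝ) (hl : Admissible ql) (hr : Admissible qr) (ξ : ℝ) :
    f (riemannSolver p ξ ql qr) = stepFun (speed1 p ql qr) (speed2 p ql qr) (speed3 p ql qr)
      (f ql) (f (stateLS p ql qr).toState) (f (stateRS p ql qr).toState) (f qr) ξ := by
  rw [riemannSolver, map_relaxSolution (fun w => f w.toState), toState_stateL hl,
    toState_stateR hr, stepFun]

theorem integral_riemannSolver_left (hp : p.Positive) (f : State → ℝ) (hl : Admissible ql)
    (hr : Admissible qr) :
    ∫ ξ in Set.Iic (0 : ℝ), (f (riemannSolver p ξ ql qr) - f ql) = -waveL p f ql qr := by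
  simp_rw [map_riemannSolver f hl hr]
  exact integral_stepFun_sub_left _ _ _ _ (speed1_lt_speed2 hp hl hr) (speed2_lt_speed3 hp hl hr)

theorem integral_riemannSolver_right (hp : p.Positive) (f : State → ℝ) (hl : Admissible ql)
    (hr : Admissible qr) :
    ∫ ξ in Set.Ioi (0 : ℝ), (f (riemannSolver p ξ ql qr) - f qr) = -waveR p f ql qr := by
  simp_rw [map_riemannSolver f hl hr]
  exact integral_stepFun_sub_right _ _ _ _ (speed1_lt_speed2 hp hl hr) (speed2_lt_speed3 hp hl hr)

theorem fluxL_eq (hp : p.Positive) (hl : Admissible ql) (hr : Admissible qr) (k : Fin 4) :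
    fluxL p ql qr k = flux p ql k + waveL p (fun q => q k) ql qr := by
  rw [fluxL, integral_riemannSolver_left hp (fun q => q k) hl hr, sub_neg_eq_add]

theorem fluxR_eq (hp : p.Positive) (hl : Admissible ql) (hr : Admissible qr) (k : Fin 4) :
    fluxR p ql qr k = flux p qr k - waveR p (fun q => q k) ql qr := by
  rw [fluxR, integral_riemannSolver_right hp (fun q => q k) hl hr, ← sub_eq_add_neg]

theorem energyFluxL_eq (hp : p.Positive) (hl : Admissible ql) (hr : Admissible qr) :
    energyFluxL p ql qr = energyFlux p ql + waveL p (energy p) ql qr := by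
  rw [energyFluxL, integral_riemannSolver_left hp (energy p) hl hr, sub_neg_eq_add]

theorem energyFluxR_eq (hp : p.Positive) (hl : Admissible ql) (hr : Admissible qr) :
    energyFluxR p ql qr = energyFlux p qr - waveR p (energy p) ql qr := by
  rw [energyFluxR, integral_riemannSolver_right hp (energy p) hl hr, ← sub_eq_add_neg]

theorem fluxL_eq_formula (hp : p.Positive) (hl : Admissible ql) (hr : Admissible qr) (k : Fin 4) :
    fluxL p ql qr k = fluxLFormula p ql qr k := by
  rw [fluxL_eq hp hl hr, waveL, leftSum, fluxLFormula]; ring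

theorem fluxR_eq_formula (hp : p.Positive) (hl : Admissible ql) (hr : Admissible qr) (k : Fin 4) :
    fluxR p ql qr k = fluxRFormula p ql qr k := by
  rw [fluxR_eq hp hl hr, waveR, rightSum, fluxRFormula]; ring

theorem abs_speed_le_maxSpeed (p : Params) (ql qr : State) :
    |speed1 p ql qr| ≤ maxSpeed p ql qr ∧ |speed3 p ql qr| ≤ maxSpeed p ql qr :=
  ⟨le_max_left _ _, (le_max_right _ _).trans (le_max_right _ _)⟩

/-! ### Averages over half cells -/

/-- The change of variable `ξ = (x - X) / dt` turns the half cell into `(-L, 0)` with `L = (X - C) /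
dt`, and the CFL condition says that the fan is no wider. -/
theorem integral_left_half (hp : p.Positive) (f : State → ℝ) (hl : Admissible ql)
    (hr : Admissible qr) {dt X C : ℝ} (hdt : 0 < dt) (hC : C ≤ X)
    (hA : dt * maxSpeed p ql qr ≤ X - C) :
    ∫ x in C..X, f (riemannSolver p ((x - X) / dt) ql qr) =
      (X - C) * f ql - dt * waveL p f ql qr := by
  have h1 := (abs_le.1 (abs_speed_le_maxSpeed p ql qr).1).1
  have h2 : maxSpeed p ql qr ≤ (X - C) / dt := by rw [le_div_iff₀ hdt]; linarith
  have h3 : (C - X) / dt = -((X - C) / dt) := by rw [← neg_sub, neg_div]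
  rw [intervalIntegral.integral_comp_sub_right (fun y => f (riemannSolver p (y / dt) ql qr)),
    intervalIntegral.integral_comp_div (fun y => f (riemannSolver p y ql qr)) hdt.ne', sub_self,
    zero_div, h3]
  simp_rw [map_riemannSolver f hl hr]
  rw [integral_stepFun_neg _ _ _ _ (speed1_lt_speed2 hp hl hr) (speed2_lt_speed3 hp hl hr)
    (div_nonneg (by linarith) hdt.le) (by linarith), smul_eq_mul, ← waveL]
  field_simp

theorem integral_right_half (hp : p.Positive) (f : State → ℝ) (hl : Admissible ql)
    (hr : Admissible qr) {dt X C : ℝ} (hdt : 0 < dt) (hC : X ≤ C)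
    (hA : dt * maxSpeed p ql qr ≤ C - X) :
    ∫ x in X..C, f (riemannSolver p ((x - X) / dt) ql qr) =
      (C - X) * f qr - dt * waveR p f ql qr := by
  have h1 := (abs_le.1 (abs_speed_le_maxSpeed p ql qr).2).2
  have h2 : maxSpeed p ql qr ≤ (C - X) / dt := by rw [le_div_iff₀ hdt]; linarith
  rw [intervalIntegral.integral_comp_sub_right (fun y => f (riemannSolver p (y / dt) ql qr)),
    intervalIntegral.integral_comp_div (fun y => f (riemannSolver p y ql qr)) hdt.ne', sub_self,
    zero_div]
  simp_rw [map_riemannSolver f hl hr]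
  rw [integral_stepFun_pos _ _ _ _ (speed1_lt_speed2 hp hl hr) (speed2_lt_speed3 hp hl hr)
    (div_nonneg (by linarith) hdt.le) (by linarith), smul_eq_mul, ← waveR]
  field_simp

/-- The four constant states of the approximate Riemann solver. -/
noncomputable def fanStates (p : Params) (ql qr : State) : Fin 4 → State :=
  ![ql, (stateLS p ql qr).toState, (stateRS p ql qr).toState, qr]

theorem admissible_fanStates (hp : p.Positive) (hl : Admissible ql) (hr : Admissible qr)
    (j : Fin 4) : Admissible (fanStates p ql qr j) := by
  fin_cases j
  exacts [hl, admissible_stateLS hp hl hr, admissible_stateRS hp hl hr, hr]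

/-- The weights are the fractions of the half cell occupied by the four states. They are fixed
before `f`: the coordinates identify the averaged state as a barycentre, and the same weights then
apply to a convex `f`. -/
theorem exists_weights_left (hp : p.Positive) (hl : Admissible ql) (hr : Admissible qr) {μ : ℝ}
    (hμ : 0 ≤ μ) (hA : μ * maxSpeed p ql qr ≤ 1) :
    ∃ w : Fin 4 → ℝ, (∀ j, 0 ≤ w j) ∧ ∑ j, w j = 1 ∧ ∀ f : State → ℝ,
      f ql - μ * waveL p f ql qr = ∑ j, w j * f (fanStates p ql qr j) := by
  have h12 := (speed1_lt_speed2 hp hl hr).le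
  have h23 := (speed2_lt_speed3 hp hl hr).le
  have h1 := mul_le_mul_of_nonneg_left (abs_speed_le_maxSpeed p ql qr).1 hμ
  set s1 := speed1 p ql qr
  set s2 := speed2 p ql qr
  set s3 := speed3 p ql qr
  refine ⟨![1 + μ * min 0 s1, μ * (min 0 s2 - min 0 s1), μ * (min 0 s3 - min 0 s2), μ * -min 0 s3],
    ?_, ?_, fun f => ?_⟩
  -- Only the first weight needs the CFL condition; the others are nonnegative because the speeds
  -- are ordered.
  · have h2 : -|s1| ≤ min 0 s1 := le_min (by simp) (neg_abs_le s1)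
    have h3 := mul_le_mul_of_nonneg_left h2 hμ
    have h4 := min_le_min_left 0 h12
    have h5 := min_le_min_left 0 h23
    have h6 := min_le_left 0 s3
    intro j
    fin_cases j
    · change 0 ≤ 1 + μ * min 0 s1
      linarith
    · exact mul_nonneg hμ (by linarith)
    · exact mul_nonneg hμ (by linarith)
    · exact mul_nonneg hμ (by linarith)
  · simp only [Fin.sum_univ_four, Matrix.cons_val]
    ring
  · rw [waveL, sub_leftSum_eq]
    simp [Fin.sum_univ_four, fanStates, s1, s2, s3]

theorem exists_weights_right (hp : p.Positive) (hl : Admissible ql) (hr : Admissible qr) {μ : ℝ}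
    (hμ : 0 ≤ μ) (hA : μ * maxSpeed p ql qr ≤ 1) :
    ∃ w : Fin 4 → ℝ, (∀ j, 0 ≤ w j) ∧ ∑ j, w j = 1 ∧ ∀ f : State → ℝ,
      f qr - μ * waveR p f ql qr = ∑ j, w j * f (fanStates p ql qr j) := by
  have h12 := (speed1_lt_speed2 hp hl hr).le
  have h23 := (speed2_lt_speed3 hp hl hr).le
  have h1 := mul_le_mul_of_nonneg_left (abs_speed_le_maxSpeed p ql qr).2 hμ
  set s1 := speed1 p ql qr
  set s2 := speed2 p ql qr
  set s3 := speed3 p ql qr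
  refine ⟨![μ * max 0 s1, μ * (max 0 s2 - max 0 s1), μ * (max 0 s3 - max 0 s2), 1 - μ * max 0 s3],
    ?_, ?_, fun f => ?_⟩
  · have h2 : max 0 s3 ≤ |s3| := max_le (by simp) (le_abs_self s3)
    have h3 := mul_le_mul_of_nonneg_left h2 hμ
    have h4 := max_le_max_left 0 h12
    have h5 := max_le_max_left 0 h23
    have h6 := le_max_left 0 s1
    intro j
    fin_cases j
    · exact mul_nonneg hμ h6
    · exact mul_nonneg hμ (by linarith)
    · exact mul_nonneg hμ (by linarith)
    · change 0 ≤ 1 - μ * max 0 s3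
      linarith
  · simp only [Fin.sum_univ_four, Matrix.cons_val]
    ring
  · rw [waveR, sub_rightSum_eq]
    simp [Fin.sum_univ_four, fanStates, s1, s2, s3]

/-- The state obtained by averaging the approximate Riemann solver over the left half cell. -/
noncomputable def halfL (p : Params) (μ : ℝ) (ql qr : State) : State :=
  fun k => ql k - μ * waveL p (fun q => q k) ql qr

/-- The state obtained by averaging the approximate Riemann solver over the right half cell. -/
noncomputable def halfR (p : Params) (μ : ℝ) (ql qr : State) : State :=
  fun k => qr k - μ * waveR p (fun q => q k) ql qr

theorem halfL_mem {S : Set State} (hS : Convex ℝ S) (hp : p.Positive) (hl : Admissible ql)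
    (hr : Admissible qr) {μ : ℝ} (hμ : 0 ≤ μ) (hA : μ * maxSpeed p ql qr ≤ 1)
    (h : ∀ j, fanStates p ql qr j ∈ S) :
    halfL p μ ql qr ∈ S ∧ ∀ f : State → ℝ, ConvexOn ℝ S f →
      f (halfL p μ ql qr) ≤ f ql - μ * waveL p f ql qr := by
  obtain ⟨w, h0, h1, h2⟩ := exists_weights_left hp hl hr hμ hA
  have e : halfL p μ ql qr = ∑ j, w j • fanStates p ql qr j := by
    ext k
    rw [halfL, h2 (fun q => q k)]
    simp [Finset.sum_apply]
  refine ⟨?_, fun f hf => ?_⟩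
  · rw [e]
    exact hS.sum_mem (fun j _ => h0 j) h1 fun j _ => h j
  · rw [e, h2 f]
    exact hf.map_sum_le (fun j _ => h0 j) h1 fun j _ => h j

theorem halfR_mem {S : Set State} (hS : Convex ℝ S) (hp : p.Positive) (hl : Admissible ql)
    (hr : Admissible qr) {μ : ℝ} (hμ : 0 ≤ μ) (hA : μ * maxSpeed p ql qr ≤ 1)
    (h : ∀ j, fanStates p ql qr j ∈ S) :
    halfR p μ ql qr ∈ S ∧ ∀ f : State → ℝ, ConvexOn ℝ S f →
      f (halfR p μ ql qr) ≤ f qr - μ * waveR p f ql qr := by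
  obtain ⟨w, h0, h1, h2⟩ := exists_weights_right hp hl hr hμ hA
  have e : halfR p μ ql qr = ∑ j, w j • fanStates p ql qr j := by
    ext k
    rw [halfR, h2 (fun q => q k)]
    simp [Finset.sum_apply]
  refine ⟨?_, fun f hf => ?_⟩
  · rw [e]
    exact hS.sum_mem (fun j _ => h0 j) h1 fun j _ => h j
  · rw [e, h2 f]
    exact hf.map_sum_le (fun j _ => h0 j) h1 fun j _ => h j

/-! ### One time step as a convex combination of fan states -/

theorem schemeStep_eq (hp : p.Positive) {X : ℤ → ℝ} {dt : ℝ} {q : ℤ → State}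
    (hq : ∀ i, Admissible (q i)) (i : ℤ) (k : Fin 4) :
    schemeStep p X dt q i k = q i k - dt / cellLength X i *
      (waveL p (fun q => q k) (q i) (q (i + 1)) + waveR p (fun q => q k) (q (i - 1)) (q i)) := by
  simp only [schemeStep, Pi.sub_apply, Pi.smul_apply, smul_eq_mul]
  -- Both fluxes contain `F(q i)`, which cancels: only the waves entering the cell from its two
  -- interfaces remain.
  rw [fluxL_eq hp (hq _) (hq _), fluxR_eq hp (hq _) (hq _)]
  ring

theorem schemeStep_eq_half (hp : p.Positive) {X : ℤ → ℝ} {dt : ℝ} {q : ℤ → State}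
    (hq : ∀ i, Admissible (q i)) (i : ℤ) :
    schemeStep p X dt q i =
      (1 / 2 : ℝ) • halfR p (2 * (dt / cellLength X i)) (q (i - 1)) (q i)
        + (1 / 2 : ℝ) • halfL p (2 * (dt / cellLength X i)) (q i) (q (i + 1)) := by
  ext k
  rw [schemeStep_eq hp hq]
  simp only [halfL, halfR, Pi.add_apply, Pi.smul_apply, smul_eq_mul]
  ring

/-- The hypotheses of one time step. -/
structure StepData (p : Params) (X : ℤ → ℝ) (dt : ℝ) (q : ℤ → State) : Prop where
  mesh : StrictMono X
  dt_pos : 0 < dt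
  adm : ∀ i, Admissible (q i)
  cfl : ∀ i, dt * maxSpeed p (q i) (q (i + 1)) ≤ 1 / 2 * min (cellLength X i) (cellLength X (i + 1))

section Step

variable {X : ℤ → ℝ} {dt : ℝ} {q : ℤ → State}

theorem cellLength_pos (hX : StrictMono X) (i : ℤ) : 0 < cellLength X i :=
  sub_pos.2 (hX (lt_add_one i))

theorem StepData.cfl_left (h : StepData p X dt q) (i : ℤ) :
    dt * maxSpeed p (q i) (q (i + 1)) ≤ cellLength X i / 2 := by
  have := h.cfl i
  have := min_le_left (cellLength X i) (cellLength X (i + 1))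
  linarith

theorem StepData.cfl_right (h : StepData p X dt q) (i : ℤ) :
    dt * maxSpeed p (q (i - 1)) (q i) ≤ cellLength X i / 2 := by
  have h1 := h.cfl (i - 1)
  rw [sub_add_cancel] at h1
  have := min_le_right (cellLength X (i - 1)) (cellLength X i)
  linarith

theorem schemeStep_eq_cellAverage (hp : p.Positive) (h : StepData p X dt q) (i : ℤ) :
    schemeStep p X dt q i = cellAverage p X dt q i := by
  have hΔ := cellLength_pos h.mesh i
  have e1 : cellCenter X i - X i = cellLength X i / 2 := by rw [cellCenter, cellLength]; ring
  have e2 : X (i + 1) - cellCenter X i = cellLength X i / 2 := by rw [cellCenter, cellLength]; ring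
  ext k
  rw [schemeStep_eq hp h.adm, cellAverage,
    integral_right_half hp (fun q => q k) (h.adm _) (h.adm _) h.dt_pos (by linarith)
      (by rw [e1]; exact h.cfl_right i),
    integral_left_half hp (fun q => q k) (h.adm _) (h.adm _) h.dt_pos (by linarith)
      (by rw [e2]; exact h.cfl_left i), e1, e2]
  field_simp
  ring

/-- The factor `2` is there because each average is over half of the cell. -/
theorem StepData.ratio (h : StepData p X dt q) (i : ℤ) : 0 ≤ 2 * (dt / cellLength X i) ∧
    2 * (dt / cellLength X i) * maxSpeed p (q (i - 1)) (q i) ≤ 1 ∧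
    2 * (dt / cellLength X i) * maxSpeed p (q i) (q (i + 1)) ≤ 1 := by
  have hΔ := cellLength_pos h.mesh i
  have hdt := h.dt_pos
  have h1 := h.cfl_left i
  have h2 := h.cfl_right i
  refine ⟨by positivity, ?_, ?_⟩
  · rw [← mul_div_assoc, div_mul_eq_mul_div, div_le_one hΔ]; linarith
  · rw [← mul_div_assoc, div_mul_eq_mul_div, div_le_one hΔ]; linarith

/-- Convex invariant sets, and Jensen's inequality for one time step. -/
theorem schemeStep_mem (hp : p.Positive) (h : StepData p X dt q) {S : Set State}
    (hS : Convex ℝ S) (hfan : ∀ i j, fanStates p (q i) (q (i + 1)) j ∈ S) (i : ℤ) :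
    schemeStep p X dt q i ∈ S ∧ ∀ f : State → ℝ, ConvexOn ℝ S f →
      f (schemeStep p X dt q i) ≤ f (q i) - dt / cellLength X i *
        (waveL p f (q i) (q (i + 1)) + waveR p f (q (i - 1)) (q i)) := by
  obtain ⟨h0, h1, h2⟩ := h.ratio i
  have hfan' : ∀ j, fanStates p (q (i - 1)) (q i) j ∈ S := by simpa using hfan (i - 1)
  obtain ⟨l1, l2⟩ := halfL_mem hS hp (h.adm i) (h.adm (i + 1)) h0 h2 (hfan i)
  obtain ⟨r1, r2⟩ := halfR_mem hS hp (h.adm (i - 1)) (h.adm i) h0 h1 hfan'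
  rw [schemeStep_eq_half hp h.adm]
  refine ⟨hS r1 l1 (by norm_num) (by norm_num) (by norm_num), fun f hf => ?_⟩
  have h3 := hf.2 r1 l1 (show (0 : ℝ) ≤ 1 / 2 by norm_num) (show (0 : ℝ) ≤ 1 / 2 by norm_num)
    (by norm_num)
  rw [smul_eq_mul, smul_eq_mul] at h3
  linarith [l2 f hf, r2 f hf]

end Step

/-! ### Convexity -/

theorem admissible_iff {q : State} : Admissible q ↔ 0 < q 0 ∧ 0 < q 2 ∧ 0 < q 3 := by
  refine ⟨fun ⟨h0, h1, h2⟩ => ⟨h0, (div_pos_iff_of_pos_right h0).1 h1,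
    (div_pos_iff_of_pos_right h0).1 h2⟩, fun ⟨h0, h1, h2⟩ => ⟨h0, div_pos h1 h0, div_pos h2 h0⟩⟩

theorem convex_admissible : Convex ℝ {q : State | Admissible q} := by
  have h : {q : State | Admissible q} = {q | 0 < q 0} ∩ ({q | 0 < q 2} ∩ {q | 0 < q 3}) := by
    ext q; simp [admissible_iff]
  have hk : ∀ k : Fin 4, Convex ℝ {q : State | 0 < q k} := fun k =>
    convex_halfSpace_gt (LinearMap.proj k : State →ₗ[ℝ] ℝ).isLinear 0
  rw [h]
  exact (hk 0).inter ((hk 2).inter (hk 3))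

/-- In the conservative variables the energy is a sum of perspectives with respect to `q 0` of `x²`
and `-log x`, a square and linear terms; its convexity can be read off. -/
theorem energy_eq {q : State} (hq : Admissible q) : energy p q =
    q 1 ^ 2 / q 0 / 2 + p.g * q 0 ^ 2 / 2 + p.elastic / 2 * (q 2 + q 3 - 2 * q 0
      + q 0 * (-Real.log (q 2 / q 0)) + q 0 * (-Real.log (q 3 / q 0))) := by
  obtain ⟨h0, h1, h2⟩ := hq
  rw [energy, internalEnergy_eq, Real.log_mul h1.ne' h2.ne']
  have : q 0 ≠ 0 := h0.ne'
  simp only [height, vel, sigxx, sigzz]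
  field_simp
  ring

/-- Convexity of the perspective of a convex function. -/
theorem perspective_le {φ : ℝ → ℝ} {S : Set ℝ} (hφ : ConvexOn ℝ S φ) {x y x' y' a b : ℝ}
    (hx : 0 < x) (hx' : 0 < x') (hy : y / x ∈ S) (hy' : y' / x' ∈ S) (ha : 0 ≤ a) (hb : 0 ≤ b)
    (hab : a + b = 1) :
    (a * x + b * x') * φ ((a * y + b * y') / (a * x + b * x')) ≤
      a * (x * φ (y / x)) + b * (x' * φ (y' / x')) := by
  have hpos : 0 < a * x + b * x' := by
    rcases ha.eq_or_lt with rfl | ha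
    · have : b = 1 := by linarith
      subst this; simpa using hx'
    · have := mul_pos ha hx
      have := mul_nonneg hb hx'.le
      linarith
  have h := hφ.2 hy hy' (div_nonneg (mul_nonneg ha hx.le) hpos.le)
    (div_nonneg (mul_nonneg hb hx'.le) hpos.le) (by rw [← add_div, div_self hpos.ne'])
  simp only [smul_eq_mul] at h
  have e : a * x / (a * x + b * x') * (y / x) + b * x' / (a * x + b * x') * (y' / x')
      = (a * y + b * y') / (a * x + b * x') := by field_simp
  rw [e] at h
  have h' := mul_le_mul_of_nonneg_left h hpos.le
  refine h'.trans (le_of_eq ?_)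
  field_simp

theorem convexOn_energy (hp : p.Positive) : ConvexOn ℝ {q : State | Admissible q} (energy p) := by
  refine ⟨convex_admissible, fun q hq q' hq' a b ha hb hab => ?_⟩
  have hm := convex_admissible hq hq' ha hb hab
  rw [energy_eq hm, energy_eq hq, energy_eq hq']
  obtain ⟨h0, h2, h3⟩ := admissible_iff.1 hq
  obtain ⟨h0', h2', h3'⟩ := admissible_iff.1 hq'
  have hlog : ConvexOn ℝ (Set.Ioi 0) fun x => -Real.log x := strictConcaveOn_log_Ioi.concaveOn.neg
  have hsq : ConvexOn ℝ Set.univ fun x : ℝ => x ^ 2 := even_two.convexOn_pow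
  have i1 := perspective_le hsq h0 h0' (y := q 1) (y' := q' 1) (Set.mem_univ _) (Set.mem_univ _)
    ha hb hab
  have i2 := perspective_le hlog h0 h0' (div_pos h2 h0) (div_pos h2' h0') ha hb hab
  have i3 := perspective_le hlog h0 h0' (div_pos h3 h0) (div_pos h3' h0') ha hb hab
  have i4 := hsq.2 (Set.mem_univ (q 0)) (Set.mem_univ (q' 0)) ha hb hab
  have hpos : 0 < (a • q + b • q') 0 := hm.1
  simp only [Pi.add_apply, Pi.smul_apply, smul_eq_mul] at i4 hpos ⊢
  have e : ∀ x y : ℝ, 0 < x → x * (y / x) ^ 2 = y ^ 2 / x := fun x y hx => by field_simp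
  rw [e _ _ hpos, e _ _ h0, e _ _ h0'] at i1
  have k1 := mul_le_mul_of_nonneg_left i2 (half_pos hp.elastic_pos).le
  have k2 := mul_le_mul_of_nonneg_left i3 (half_pos hp.elastic_pos).le
  have k3 := mul_le_mul_of_nonneg_left i4 (half_pos hp.g_pos).le
  linarith

/-- The constraint is the region above a branch of hyperbola in the variables `(q 0, q 2)`, which is
convex although `s_xx` itself is not compared by convexity here. -/
theorem sxx_le_iff {q : State} (hq : Admissible q) {k : ℝ} (hk : 0 < k) :
    sxx q ≤ k ↔ 1 / k ^ 2 ≤ q 0 * q 2 := by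
  have h0 : 0 < q 0 := hq.1
  have h2 := (admissible_iff.1 hq).2.1
  have e : sigxx q * height q ^ 2 = q 0 * q 2 := by
    simp only [sigxx, height]; field_simp
  rw [← pow_le_pow_iff_left₀ (sxx_pos hq).le hk.le two_ne_zero, sxx_sq hq, e,
    one_div_le (mul_pos h0 h2) (pow_pos hk 2)]

/-- The constraint is the epigraph of a cubic, convex for `q 0 ≥ 0`. -/
theorem le_szz_iff {q : State} (hq : Admissible q) {k : ℝ} (hk : 0 < k) :
    k ≤ szz q ↔ k ^ 2 * q 0 ^ 3 ≤ q 3 := by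
  have h0 : 0 < q 0 := hq.1
  have e : sigzz q / height q ^ 2 = q 3 / q 0 ^ 3 := by
    simp only [sigzz, height]; field_simp
  rw [← pow_le_pow_iff_left₀ hk.le (szz_pos hq).le two_ne_zero, szz_sq hq, e,
    le_div_iff₀ (pow_pos h0 3)]

theorem convex_sxx_le {k : ℝ} (hk : 0 < k) : Convex ℝ {q : State | Admissible q ∧ sxx q ≤ k} := by
  rintro q ⟨hq, hs⟩ q' ⟨hq', hs'⟩ a b ha hb hab
  have hm := convex_admissible hq hq' ha hb hab
  refine ⟨hm, ?_⟩
  rw [sxx_le_iff hm hk]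
  rw [sxx_le_iff hq hk] at hs
  rw [sxx_le_iff hq' hk] at hs'
  obtain ⟨h0, h2, -⟩ := admissible_iff.1 hq
  obtain ⟨h0', h2', -⟩ := admissible_iff.1 hq'
  simp only [Pi.add_apply, Pi.smul_apply, smul_eq_mul]
  set r := 1 / k ^ 2
  have hr : 0 < r := by positivity
  -- Arithmetic–geometric mean: the sum squared is at least four times the product of its two terms,
  -- which regroups into the product of the two constraints.
  have hcross : 2 * r ≤ q 0 * q' 2 + q' 0 * q 2 := by
    refine le_of_sq_le_sq ?_ (by positivity)
    have h4 : r * r ≤ (q 0 * q 2) * (q' 0 * q' 2) := mul_le_mul hs hs' hr.le (by positivity)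
    nlinarith [sq_nonneg (q 0 * q' 2 - q' 0 * q 2)]
  -- `1 = (a + b)²`, expanded to match the square and cross terms of the product of the averaged
  -- coordinates.
  have hab2 : r = (a * a + b * b) * r + a * b * (2 * r) := by
    linear_combination (-(a + b) * r - r) * hab
  have m1 := mul_le_mul_of_nonneg_left hs (mul_nonneg ha ha)
  have m2 := mul_le_mul_of_nonneg_left hs' (mul_nonneg hb hb)
  have m3 := mul_le_mul_of_nonneg_left hcross (mul_nonneg ha hb)
  linarith

theorem convex_le_szz {k : ℝ} (hk : 0 < k) : Convex ℝ {q : State | Admissible q ∧ k ≤ szz q} := by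
  rintro q ⟨hq, hs⟩ q' ⟨hq', hs'⟩ a b ha hb hab
  have hm := convex_admissible hq hq' ha hb hab
  refine ⟨hm, ?_⟩
  rw [le_szz_iff hm hk]
  rw [le_szz_iff hq hk] at hs
  rw [le_szz_iff hq' hk] at hs'
  have hc := (convexOn_pow (𝕜 := ℝ) 3).2 hq.1.le hq'.1.le ha hb hab
  simp only [Pi.add_apply, Pi.smul_apply, smul_eq_mul, height] at hc ⊢
  have m1 := mul_le_mul_of_nonneg_left hc (pow_pos hk 2).le
  have m2 := mul_le_mul_of_nonneg_left hs ha
  have m3 := mul_le_mul_of_nonneg_left hs' hb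
  linarith

/-! ### Conservativity and energy flux -/

theorem RankineHugoniot.mass {S : ℝ} {w w' : RelaxState} (h : RankineHugoniot S w w') :
    w'.h * w'.u - w.h * w.u = S * (w'.h - w.h) := by
  have := congrFun h 0
  simp only [RelaxState.relaxFlux, RelaxState.conserved, Pi.sub_apply, Pi.add_apply, Pi.smul_apply,
    smul_eq_mul, Matrix.cons_val] at this
  linarith

theorem RankineHugoniot.momentum {S : ℝ} {w w' : RelaxState} (h : RankineHugoniot S w w') :
    w'.h * w'.u ^ 2 + w'.pi - (w.h * w.u ^ 2 + w.pi) = S * (w'.h * w'.u - w.h * w.u) := by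
  have := congrFun h 1
  simp only [RelaxState.relaxFlux, RelaxState.conserved, Pi.sub_apply, Pi.add_apply, Pi.smul_apply,
    smul_eq_mul, Matrix.cons_val] at this
  linarith

theorem massFlux_eq (p : Params) (ql qr : State) : massFlux p ql qr =
    stepFun (speed1 p ql qr) (speed2 p ql qr) (speed3 p ql qr) (flux p ql 0)
      ((stateLS p ql qr).h * (stateLS p ql qr).u) ((stateRS p ql qr).h * (stateRS p ql qr).u)
      (flux p qr 0) 0 :=
  map_relaxSolution (fun w => w.h * w.u) p ql qr 0

theorem momentumFlux_eq (p : Params) (ql qr : State) : momentumFlux p ql qr =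
    stepFun (speed1 p ql qr) (speed2 p ql qr) (speed3 p ql qr) (flux p ql 1)
      ((stateLS p ql qr).h * (stateLS p ql qr).u ^ 2 + (stateLS p ql qr).pi)
      ((stateRS p ql qr).h * (stateRS p ql qr).u ^ 2 + (stateRS p ql qr).pi)
      (flux p qr 1) 0 :=
  map_relaxSolution (fun w => w.h * w.u ^ 2 + w.pi) p ql qr 0

theorem height_mul_vel {q : State} (hq : Admissible q) : height q * vel q = q 1 :=
  mul_div_cancel₀ _ hq.1.ne'

theorem flux_eq_massFlux (hp : p.Positive) (hl : Admissible ql) (hr : Admissible qr) :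
    fluxL p ql qr 0 = massFlux p ql qr ∧ fluxR p ql qr 0 = massFlux p ql qr := by
  have h1 := (rankineHugoniot_left hp hl hr).mass
  have h2 := (rankineHugoniot_middle p ql qr).mass
  have h3 := (rankineHugoniot_right hp hl hr).mass
  rw [fluxL_eq hp hl hr, fluxR_eq hp hl hr, massFlux_eq]
  exact ⟨add_leftSum_eq_stepFun _ _ _ _ (speed1_lt_speed2 hp hl hr) (speed2_lt_speed3 hp hl hr)
    h1 h2 h3, sub_rightSum_eq_stepFun _ _ _ _ (speed1_lt_speed2 hp hl hr)
    (speed2_lt_speed3 hp hl hr) h1 h2 h3⟩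

theorem flux_eq_momentumFlux (hp : p.Positive) (hl : Admissible ql) (hr : Admissible qr) :
    fluxL p ql qr 1 = momentumFlux p ql qr ∧ fluxR p ql qr 1 = momentumFlux p ql qr := by
  have h1 := (rankineHugoniot_left hp hl hr).momentum
  have h2 := (rankineHugoniot_middle p ql qr).momentum
  have h3 := (rankineHugoniot_right hp hl hr).momentum
  have el : (stateL p ql qr).h * (stateL p ql qr).u = ql 1 := height_mul_vel hl
  have er : (stateR p ql qr).h * (stateR p ql qr).u = qr 1 := height_mul_vel hr
  rw [el] at h1
  rw [er] at h3
  rw [fluxL_eq hp hl hr, fluxR_eq hp hl hr, momentumFlux_eq]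
  exact ⟨add_leftSum_eq_stepFun _ _ _ _ (speed1_lt_speed2 hp hl hr) (speed2_lt_speed3 hp hl hr)
    h1 h2 h3, sub_rightSum_eq_stepFun _ _ _ _ (speed1_lt_speed2 hp hl hr)
    (speed2_lt_speed3 hp hl hr) h1 h2 h3⟩

/-- Energy of a relaxation state. -/
noncomputable def RelaxState.energy (w : RelaxState) : ℝ := w.h * w.u ^ 2 / 2 + w.h * w.ehat

/-- The energy balance across a wave. -/
theorem energy_jump {S m : ℝ} {w w' : RelaxState} (hm : w.h * (w.u - S) = m)
    (hm' : w'.h * (w'.u - S) = m)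
    (he : m * (w'.u ^ 2 / 2 + w'.ehat - (w.u ^ 2 / 2 + w.ehat))
      + (w'.pi * w'.u - w.pi * w.u) = 0) :
    (w'.energy + w'.pi) * w'.u - (w.energy + w.pi) * w.u = S * (w'.energy - w.energy) := by
  have := (jump_eq_iff (φ := w.u ^ 2 / 2 + w.ehat) (φ' := w'.u ^ 2 / 2 + w'.ehat)
    (V := w.pi * w.u) (V' := w'.pi * w'.u) hm hm').2 he
  rw [RelaxState.energy, RelaxState.energy]
  linarith

/-- The relaxation energy is conserved exactly: `ê - π² / 2c²` is constant across the wave and `[π]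
= -c_l [u]`, so the work of the pressure compensates the changes of kinetic energy and of `π² /
2c²`. -/
theorem energy_jump_left (hp : p.Positive) (hl : Admissible ql) (hr : Admissible qr) :
    ((stateLS p ql qr).energy + (stateLS p ql qr).pi) * (stateLS p ql qr).u
        - energyFlux p ql =
      speed1 p ql qr * ((stateLS p ql qr).energy - energy p ql) := by
  have hc := cL_pos hp hl hr
  have hπ : piStar p ql qr = pressure p ql - cL p ql qr * (uStar p ql qr - vel ql) := by
    linarith [piStar_sub_pressureL hp hl hr]
  refine energy_jump (w := stateL p ql qr) (height_mul_speed1 hl) (hStarL_mul hp hl hr) ?_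
  simp only [stateL, stateLS, relaxInit]
  rw [hπ]
  field_simp
  ring

theorem energy_jump_middle (p : Params) (ql qr : State) :
    ((stateRS p ql qr).energy + (stateRS p ql qr).pi) * (stateRS p ql qr).u
        - ((stateLS p ql qr).energy + (stateLS p ql qr).pi) * (stateLS p ql qr).u =
      speed2 p ql qr * ((stateRS p ql qr).energy - (stateLS p ql qr).energy) := by
  simp only [stateLS, stateRS, speed2]
  ring

theorem energy_jump_right (hp : p.Positive) (hl : Admissible ql) (hr : Admissible qr) :
    energyFlux p qr
        - ((stateRS p ql qr).energy + (stateRS p ql qr).pi) * (stateRS p ql qr).u =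
      speed3 p ql qr * (energy p qr - (stateRS p ql qr).energy) := by
  have hc := cR_pos hp hl hr
  have hπ : piStar p ql qr = pressure p qr + cR p ql qr * (uStar p ql qr - vel qr) := by
    linarith [piStar_sub_pressureR hp hl hr]
  refine energy_jump (w' := stateR p ql qr) (hStarR_mul hp hl hr) (height_mul_speed3 hr) ?_
  simp only [stateR, stateRS, relaxInit]
  rw [hπ]
  field_simp
  ring

theorem numEnergyFlux_eq (p : Params) (ql qr : State) : numEnergyFlux p ql qr =
    stepFun (speed1 p ql qr) (speed2 p ql qr) (speed3 p ql qr) (energyFlux p ql)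
      (((stateLS p ql qr).energy + (stateLS p ql qr).pi) * (stateLS p ql qr).u)
      (((stateRS p ql qr).energy + (stateRS p ql qr).pi) * (stateRS p ql qr).u)
      (energyFlux p qr) 0 :=
  map_relaxSolution (fun w => (w.h * w.u ^ 2 / 2 + w.h * w.ehat + w.pi) * w.u) p ql qr 0

theorem energy_stateLS_le (hp : p.Positive) (hl : Admissible ql) (hr : Admissible qr) :
    energy p (stateLS p ql qr).toState ≤ (stateLS p ql qr).energy := by
  have h := hStarL_pos hp hl hr
  rw [energy, RelaxState.energy, height_toState, vel_toState (w := stateLS p ql qr) h.ne']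
  have := mul_le_mul_of_nonneg_left (internalEnergy_stateLS_le hp hl hr) h.le
  exact add_le_add le_rfl this

theorem energy_stateRS_le (hp : p.Positive) (hl : Admissible ql) (hr : Admissible qr) :
    energy p (stateRS p ql qr).toState ≤ (stateRS p ql qr).energy := by
  have h := hStarR_pos hp hl hr
  rw [energy, RelaxState.energy, height_toState, vel_toState (w := stateRS p ql qr) h.ne']
  have := mul_le_mul_of_nonneg_left (internalEnergy_stateRS_le hp hl hr) h.le
  exact add_le_add le_rfl this

/-- By exact conservation the numerical flux is the left flux computed with the relaxation energies
of the intermediate states. These energies enter with nonpositive coefficients `min 0 Σ_i - min 0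
Σ_{i+1}`, so passing to the smaller physical energies increases the flux. -/
theorem numEnergyFlux_le (hp : p.Positive) (hl : Admissible ql) (hr : Admissible qr) :
    numEnergyFlux p ql qr ≤ energyFluxL p ql qr := by
  have h12 := speed1_lt_speed2 hp hl hr
  have h23 := speed2_lt_speed3 hp hl hr
  rw [numEnergyFlux_eq, energyFluxL_eq hp hl hr, waveL,
    ← add_leftSum_eq_stepFun _ _ _ _ h12 h23 (energy_jump_left hp hl hr)
      (energy_jump_middle p ql qr) (energy_jump_right hp hl hr), leftSum, leftSum]
  have k1 := mul_le_mul_of_nonneg_left (energy_stateLS_le hp hl hr)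
    (sub_nonneg.2 (min_le_min_left 0 h12.le))
  have k2 := mul_le_mul_of_nonneg_left (energy_stateRS_le hp hl hr)
    (sub_nonneg.2 (min_le_min_left 0 h23.le))
  linarith

/-- In `-rightSum` the intermediate energies have nonnegative coefficients, so smaller physical
energies lower the flux. -/
theorem le_numEnergyFlux (hp : p.Positive) (hl : Admissible ql) (hr : Admissible qr) :
    energyFluxR p ql qr ≤ numEnergyFlux p ql qr := by
  have h12 := speed1_lt_speed2 hp hl hr
  have h23 := speed2_lt_speed3 hp hl hr
  rw [numEnergyFlux_eq, energyFluxR_eq hp hl hr, waveR,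
    ← sub_rightSum_eq_stepFun _ _ _ _ h12 h23 (energy_jump_left hp hl hr)
      (energy_jump_middle p ql qr) (energy_jump_right hp hl hr), rightSum, rightSum]
  have k1 := mul_le_mul_of_nonneg_left (energy_stateLS_le hp hl hr)
    (sub_nonneg.2 (max_le_max_left 0 h12.le))
  have k2 := mul_le_mul_of_nonneg_left (energy_stateRS_le hp hl hr)
    (sub_nonneg.2 (max_le_max_left 0 h23.le))
  linarith

/-! ### Runs of the scheme -/

section Run

variable {X : ℤ → ℝ} {dt : ℕ → ℝ} {q : ℕ → ℤ → State} {N : ℕ}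

theorem fanStates_mem {S : Set State} (h1 : ql ∈ S) (h2 : (stateLS p ql qr).toState ∈ S) (h3 : (stateRS p ql qr).toState ∈ S)
    (h4 : qr ∈ S) (j : Fin 4) : fanStates p ql qr j ∈ S := by
  fin_cases j
  exacts [h1, h2, h3, h4]

theorem SchemeRun.admissible (hp : p.Positive) (h : SchemeRun p X dt q N) {n : ℕ} (hn : n ≤ N)
    (i : ℤ) : Admissible (q n i) := by
  induction n generalizing i with
  | zero => exact h.init i
  | succ n ih =>
    have hn' : n < N := hn
    have ha := ih hn'.le
    rw [h.step n hn' i]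
    exact (schemeStep_mem hp ⟨h.mesh, h.dt_pos n hn', ha, h.cfl n hn'⟩ convex_admissible
      (fun i j => admissible_fanStates hp (ha _) (ha _) j) i).1

theorem SchemeRun.stepData (hp : p.Positive) (h : SchemeRun p X dt q N) {n : ℕ} (hn : n < N) :
    StepData p X (dt n) (q n) :=
  ⟨h.mesh, h.dt_pos n hn, fun i => h.admissible hp hn.le i, h.cfl n hn⟩

theorem SchemeRun.sxx_le (hp : p.Positive) (h : SchemeRun p X dt q N) {k : ℝ} (hk : 0 < k)
    (h0 : ∀ i, sxx (q 0 i) ≤ k) {n : ℕ} (hn : n ≤ N) (i : ℤ) : sxx (q n i) ≤ k := by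
  induction n generalizing i with
  | zero => exact h0 i
  | succ n ih =>
    have hn' : n < N := hn
    have ha := fun i => h.admissible hp hn'.le i
    have hs := ih hn'.le
    rw [h.step n hn' i]
    -- Each intermediate state has the `s_xx` of the end state on its side of the contact, so the
    -- whole fan satisfies the bound.
    have hfan : ∀ i j, fanStates p (q n i) (q n (i + 1)) j ∈
        {q : State | Admissible q ∧ sxx q ≤ k} := fun i j =>
      fanStates_mem (S := {q : State | Admissible q ∧ sxx q ≤ k}) ⟨ha _, hs _⟩
        ⟨admissible_stateLS hp (ha _) (ha _), (by rw [sxx_stateLS hp (ha _) (ha _)]; exact hs _)⟩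
        ⟨admissible_stateRS hp (ha _) (ha _), (by rw [sxx_stateRS hp (ha _) (ha _)]; exact hs _)⟩
        ⟨ha _, hs _⟩ j
    exact (schemeStep_mem hp (h.stepData hp hn') (convex_sxx_le hk) hfan i).1.2

theorem SchemeRun.le_szz (hp : p.Positive) (h : SchemeRun p X dt q N) {k : ℝ} (hk : 0 < k)
    (h0 : ∀ i, k ≤ szz (q 0 i)) {n : ℕ} (hn : n ≤ N) (i : ℤ) : k ≤ szz (q n i) := by
  induction n generalizing i with
  | zero => exact h0 i
  | succ n ih =>
    have hn' : n < N := hn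
    have ha := fun i => h.admissible hp hn'.le i
    have hs := ih hn'.le
    rw [h.step n hn' i]
    have hfan : ∀ i j, fanStates p (q n i) (q n (i + 1)) j ∈
        {q : State | Admissible q ∧ k ≤ szz q} := fun i j =>
      fanStates_mem (S := {q : State | Admissible q ∧ k ≤ szz q}) ⟨ha _, hs _⟩
        ⟨admissible_stateLS hp (ha _) (ha _), (by rw [szz_stateLS hp (ha _) (ha _)]; exact hs _)⟩
        ⟨admissible_stateRS hp (ha _) (ha _), (by rw [szz_stateRS hp (ha _) (ha _)]; exact hs _)⟩
        ⟨ha _, hs _⟩ j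
    exact (schemeStep_mem hp (h.stepData hp hn') (convex_le_szz hk) hfan i).1.2

theorem SchemeRun.energy_le (hp : p.Positive) (h : SchemeRun p X dt q N) {H : State → State → ℝ}
    (hH : ∀ ql qr : State, Admissible ql → Admissible qr →
      energyFluxR p ql qr ≤ H ql qr ∧ H ql qr ≤ energyFluxL p ql qr) {n : ℕ} (hn : n < N) (i : ℤ) :
    energy p (q (n + 1) i) - energy p (q n i)
      + dt n / cellLength X i * (H (q n i) (q n (i + 1)) - H (q n (i - 1)) (q n i)) ≤ 0 := by
  have ha := fun i => h.admissible hp hn.le i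
  have hd := h.stepData hp hn
  have h1 := (schemeStep_mem hp hd convex_admissible
    (fun i j => admissible_fanStates hp (ha _) (ha _) j) i).2 _ (convexOn_energy hp)
  have h2 := (hH _ _ (ha i) (ha (i + 1))).2
  have h3 := (hH _ _ (ha (i - 1)) (ha i)).1
  rw [energyFluxL_eq hp (ha _) (ha _)] at h2
  rw [energyFluxR_eq hp (ha _) (ha _)] at h3
  rw [h.step n hn i]
  -- The flux `G(q_i)` bounds the two interface fluxes from opposite sides and cancels, leaving the
  -- Jensen inequality for `E`.
  have h4 : H (q n i) (q n (i + 1)) - H (q n (i - 1)) (q n i) ≤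
    waveL p (energy p) (q n i) (q n (i + 1)) + waveR p (energy p) (q n (i - 1)) (q n i) := by
    linarith
  have h5 := mul_le_mul_of_nonneg_left h4 (div_pos hd.dt_pos (cellLength_pos h.mesh i)).le
  linarith

theorem sum_Ico_int_sub (f : ℤ → ℝ) {a b : ℤ} (hab : a ≤ b) :
    ∑ i ∈ Finset.Ico a b, (f (i + 1) - f i) = f b - f a := by
  induction b, hab using Int.leInduction with
  | base => simp
  | succ b hb ih =>
    rw [← Finset.insert_Ico_right_eq_Ico_add_one hb, Finset.sum_insert (by simp), ih]
    ring

theorem SchemeRun.sum_eq (h : SchemeRun p X dt q N) (k : Fin 4) (φ : State → State → ℝ) {n : ℕ}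
    (hn : n < N) (hL : ∀ i, fluxL p (q n i) (q n (i + 1)) k = φ (q n i) (q n (i + 1)))
    (hR : ∀ i, fluxR p (q n (i - 1)) (q n i) k = φ (q n (i - 1)) (q n i)) {a b : ℤ} (hab : a ≤ b) :
    ∑ i ∈ Finset.Ico a b, cellLength X i * (q (n + 1) i k - q n i k)
      = -(dt n * (φ (q n (b - 1)) (q n b) - φ (q n (a - 1)) (q n a))) := by
  rw [← sum_Ico_int_sub (fun i => φ (q n (i - 1)) (q n i)) hab, Finset.mul_sum,
    ← Finset.sum_neg_distrib]
  refine Finset.sum_congr rfl fun i _ => ?_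
  have hΔ := cellLength_pos h.mesh i
  rw [h.step n hn i, schemeStep, Pi.sub_apply, Pi.smul_apply, Pi.sub_apply, hL, hR, smul_eq_mul,
    add_sub_cancel_right]
  field_simp
  ring

end Run

/-! ### Steady contact discontinuities -/

theorem uStar_eq_of_contact (hp : p.Positive) (hl : Admissible ql) (hr : Admissible qr)
    (hu : vel ql = vel qr) (hP : pressure p ql = pressure p qr) : uStar p ql qr = vel ql := by
  have := uStar_sub_velL hp hl hr
  rw [hu, hP] at this
  simp at this
  linarith

theorem stateLS_of_contact (hp : p.Positive) (hl : Admissible ql) (hr : Admissible qr)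
    (hu : vel ql = vel qr) (hP : pressure p ql = pressure p qr) : (stateLS p ql qr).toState = ql := by
  have h1 := uStar_eq_of_contact hp hl hr hu hP
  have h2 : hStarL p ql qr = height ql := by rw [hStarL_eq hp hl hr, h1]; simp
  have h0 := hl.1.ne'
  refine Eq.trans ?_ (toState_stateL (p := p) (qr := qr) hl)
  simp [stateLS, stateL, relaxInit, RelaxState.toState, h1, h2, h0]

theorem stateRS_of_contact (hp : p.Positive) (hl : Admissible ql) (hr : Admissible qr)
    (hu : vel ql = vel qr) (hP : pressure p ql = pressure p qr) : (stateRS p ql qr).toState = qr := by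
  have h1 := (uStar_eq_of_contact hp hl hr hu hP).trans hu
  have h2 : hStarR p ql qr = height qr := by rw [hStarR_eq hp hl hr, h1]; simp
  have h0 := hr.1.ne'
  refine Eq.trans ?_ (toState_stateR (p := p) (ql := ql) hr)
  simp [stateRS, stateR, relaxInit, RelaxState.toState, h1, h2, h0]

/-- The acoustic jumps vanish and only the contact contributes. This covers steady contacts, where
the factor `min 0 (vel ql)` is zero, and also the diagonal `ql = qr`, where the jump is zero. -/
theorem waveL_of_contact (hp : p.Positive) (hl : Admissible ql) (hr : Admissible qr)
    (hu : vel ql = vel qr) (hP : pressure p ql = pressure p qr)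
    (f : State → ℝ) :
    waveL p f ql qr = min 0 (vel ql) * (f qr - f ql) := by
  rw [waveL, leftSum, stateLS_of_contact hp hl hr hu hP, stateRS_of_contact hp hl hr hu hP, speed2,
    uStar_eq_of_contact hp hl hr hu hP]
  ring

theorem waveR_of_contact (hp : p.Positive) (hl : Admissible ql) (hr : Admissible qr)
    (hu : vel ql = vel qr) (hP : pressure p ql = pressure p qr)
    (f : State → ℝ) :
    waveR p f ql qr = max 0 (vel ql) * (f qr - f ql) := by
  rw [waveR, rightSum, stateLS_of_contact hp hl hr hu hP, stateRS_of_contact hp hl hr hu hP, speed2,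
    uStar_eq_of_contact hp hl hr hu hP]
  ring

theorem riemannSolver_of_contact (hp : p.Positive) (hl : Admissible ql) (hr : Admissible qr)
    (hul : vel ql = 0) (hur : vel qr = 0) (hP : pressure p ql = pressure p qr) (ξ : ℝ) :
    (ξ < 0 → riemannSolver p ξ ql qr = ql) ∧ (0 < ξ → riemannSolver p ξ ql qr = qr) := by
  have hu := hul.trans hur.symm
  rw [riemannSolver, map_relaxSolution RelaxState.toState, toState_stateL hl, toState_stateR hr,
    stateLS_of_contact hp hl hr hu hP, stateRS_of_contact hp hl hr hu hP]
  have h2 : speed2 p ql qr = 0 := (uStar_eq_of_contact hp hl hr hu hP).trans hul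
  have h12 := speed1_lt_speed2 hp hl hr
  rw [h2] at h12 ⊢
  constructor <;> intro h
  · simp [h]
  · rw [if_neg (by linarith), if_neg (by linarith), ite_self]

theorem SchemeRun.steady {X : ℤ → ℝ} {dt : ℕ → ℝ} {q : ℕ → ℤ → State} {N : ℕ} (hp : p.Positive)
    (h : SchemeRun p X dt q N) (hu : ∀ i, vel (q 0 i) = 0)
    (hP : ∀ i j, pressure p (q 0 i) = pressure p (q 0 j)) {n : ℕ} (hn : n ≤ N) (i : ℤ) :
    q n i = q 0 i := by
  induction n generalizing i with
  | zero => rfl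
  | succ n ih =>
    have hn' : n < N := hn
    have hq : q n = q 0 := funext (ih hn'.le)
    ext k
    rw [h.step n hn' i, hq, schemeStep_eq hp h.init,
      waveL_of_contact hp (h.init _) (h.init _) ((hu _).trans (hu _).symm) (hP _ _),
      waveR_of_contact hp (h.init _) (h.init _) ((hu _).trans (hu _).symm) (hP _ _), hu, hu]
    simp

variable {q : State}

/-! ### Regularity of the physical quantities -/

theorem contDiffAt_height (q : State) : ContDiffAt ℝ 1 height q := contDiffAt_apply ℝ ℝ 0 q

theorem contDiffAt_vel (hq : Admissible q) : ContDiffAt ℝ 1 vel q :=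
  (contDiffAt_apply ℝ ℝ 1 q).div (contDiffAt_apply ℝ ℝ 0 q) hq.1.ne'

theorem contDiffAt_sigxx (hq : Admissible q) : ContDiffAt ℝ 1 sigxx q :=
  (contDiffAt_apply ℝ ℝ 2 q).div (contDiffAt_apply ℝ ℝ 0 q) hq.1.ne'

theorem contDiffAt_sigzz (hq : Admissible q) : ContDiffAt ℝ 1 sigzz q :=
  (contDiffAt_apply ℝ ℝ 3 q).div (contDiffAt_apply ℝ ℝ 0 q) hq.1.ne'

theorem contDiffAt_pressure (p : Params) (hq : Admissible q) : ContDiffAt ℝ 1 (pressure p) q :=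
  ((contDiffAt_const.mul ((contDiffAt_height q).pow 2)).div_const 2).add
    ((contDiffAt_const.mul (contDiffAt_height q)).mul
      ((contDiffAt_sigzz hq).sub (contDiffAt_sigxx hq)))

theorem contDiffAt_flux (p : Params) (hq : Admissible q) (k : Fin 4) :
    ContDiffAt ℝ 1 (fun q => flux p q k) q := by
  have h := contDiffAt_height q
  have hu := contDiffAt_vel hq
  fin_cases k
  · exact h.mul hu
  · exact (h.mul (hu.pow 2)).add (contDiffAt_pressure p hq)
  · exact (h.mul (contDiffAt_sigxx hq)).mul hu
  · exact (h.mul (contDiffAt_sigzz hq)).mul hu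

theorem eventually_admissible (hq : Admissible q) : ∀ᶠ q' in 𝓝 q, Admissible q' := by
  simp_rw [admissible_iff]
  obtain ⟨h0, h2, h3⟩ := admissible_iff.1 hq
  have hk : ∀ k : Fin 4, 0 < q k → ∀ᶠ q' : State in 𝓝 q, 0 < q' k := fun k h =>
    (continuous_apply k).continuousAt.eventually (lt_mem_nhds h)
  exact (hk 0 h0).and ((hk 2 h2).and (hk 3 h3))

theorem continuousAt_soundSpeed (p : Params) (hq : Admissible q) :
    ContinuousAt (soundSpeed p) q := by
  -- The sound speed is defined by a derivative; near `q`, where states are admissible, it has the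
  -- explicit form.
  have h : soundSpeed p =ᶠ[𝓝 q] fun q => Real.sqrt (soundSpeedSq p q) := by
    filter_upwards [eventually_admissible hq] with q' hq' using soundSpeed_eq p hq'
  refine ContinuousAt.congr ?_ h.symm
  exact ((continuousAt_const.mul (contDiffAt_height q).continuousAt).add
    (continuousAt_const.mul ((continuousAt_const.mul (contDiffAt_sigzz hq).continuousAt).add
      (contDiffAt_sigxx hq).continuousAt))).sqrt

/-! ### Limits of the solver at the diagonal -/

theorem tendsto_comp_fst {f : State → ℝ} (hf : ContinuousAt f q) :
    Tendsto (fun z : State × State => f z.1) (𝓝 (q, q)) (𝓝 (f q)) :=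
  hf.tendsto.comp (continuous_fst.tendsto (q, q))

theorem tendsto_comp_snd {f : State → ℝ} (hf : ContinuousAt f q) :
    Tendsto (fun z : State × State => f z.2) (𝓝 (q, q)) (𝓝 (f q)) :=
  hf.tendsto.comp (continuous_snd.tendsto (q, q))

theorem eventually_admissible_pair (hq : Admissible q) :
    ∀ᶠ z : State × State in 𝓝 (q, q), Admissible z.1 ∧ Admissible z.2 :=
  ((continuous_fst.tendsto (q, q)).eventually (eventually_admissible hq)).and
    ((continuous_snd.tendsto (q, q)).eventually (eventually_admissible hq))

theorem tendsto_sub_diag {f : State → ℝ} (hf : ContinuousAt f q) :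
    Tendsto (fun z : State × State => f z.2 - f z.1) (𝓝 (q, q)) (𝓝 0) := by
  simpa using (tendsto_comp_snd hf).sub (tendsto_comp_fst hf)

theorem tendsto_excess (hp : p.Positive) (hq : Admissible q) {P P' : State × State → ℝ}
    (hP : Tendsto (fun z => P' z - P z) (𝓝 (q, q)) (𝓝 0)) :
    Tendsto (fun z : State × State => excess p z.1 z.2 (P z) (P' z)) (𝓝 (q, q)) (𝓝 0) := by
  have hv := tendsto_sub_diag (contDiffAt_vel hq).continuousAt
  have hh := (contDiffAt_height q).continuousAt
  have ha := continuousAt_soundSpeed p hq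
  have hD := ((tendsto_comp_fst hh).mul (tendsto_comp_fst ha)).add ((tendsto_comp_snd hh).mul (tendsto_comp_snd ha))
  have h := ((tendsto_const_nhds (x := (0 : ℝ))).max hv.neg).add
    (((tendsto_const_nhds (x := (0 : ℝ))).max hP).div hD (impedance_pos hp hq hq).ne')
  simpa [excess] using h

theorem tendsto_cL (hp : p.Positive) (hq : Admissible q) :
    Tendsto (fun z : State × State => cL p z.1 z.2) (𝓝 (q, q))
      (𝓝 (height q * soundSpeed p q)) := by
  have h := (tendsto_comp_fst (contDiffAt_height q).continuousAt).mul
    ((tendsto_comp_fst (continuousAt_soundSpeed p hq)).add ((tendsto_excess hp hq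
      (tendsto_sub_diag (contDiffAt_pressure p hq).continuousAt)).const_mul 2))
  simpa [cL_eq] using h

theorem tendsto_cR (hp : p.Positive) (hq : Admissible q) :
    Tendsto (fun z : State × State => cR p z.1 z.2) (𝓝 (q, q))
      (𝓝 (height q * soundSpeed p q)) := by
  have hP := (tendsto_sub_diag (contDiffAt_pressure p hq).continuousAt).neg
  simp only [neg_sub, neg_zero] at hP
  have h := (tendsto_comp_snd (contDiffAt_height q).continuousAt).mul
    ((tendsto_comp_snd (continuousAt_soundSpeed p hq)).add ((tendsto_excess hp hq hP).const_mul 2))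
  simpa [cR_eq] using h

theorem tendsto_uStar (hp : p.Positive) (hq : Admissible q) :
    Tendsto (fun z : State × State => uStar p z.1 z.2) (𝓝 (q, q)) (𝓝 (vel q)) := by
  have hc := tendsto_cL hp hq
  have hc' := tendsto_cR hp hq
  have hv := (contDiffAt_vel hq).continuousAt
  have hP := (contDiffAt_pressure p hq).continuousAt
  have hpos := mul_pos hq.1 (soundSpeed_pos hp hq)
  have h := ((((hc.mul (tendsto_comp_fst hv)).add (hc'.mul (tendsto_comp_snd hv))).add
    (tendsto_comp_fst hP)).sub (tendsto_comp_snd hP)).div (hc.add hc') (add_pos hpos hpos).ne'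
  have e : (height q * soundSpeed p q * vel q + height q * soundSpeed p q * vel q
      + pressure p q - pressure p q) / (height q * soundSpeed p q + height q * soundSpeed p q)
      = vel q := by
    rw [div_eq_iff (add_pos hpos hpos).ne']; ring
  rw [e] at h
  exact h

theorem tendsto_hStarL (hp : p.Positive) (hq : Admissible q) :
    Tendsto (fun z : State × State => hStarL p z.1 z.2) (𝓝 (q, q)) (𝓝 (height q)) := by
  have hpos := mul_pos hq.1 (soundSpeed_pos hp hq)
  have h := (((tendsto_const_nhds (x := (1 : ℝ))).div
    (tendsto_comp_fst (contDiffAt_height q).continuousAt) hq.1.ne').add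
    (((tendsto_uStar hp hq).sub (tendsto_comp_fst (contDiffAt_vel hq).continuousAt)).div
      (tendsto_cL hp hq) hpos.ne')).inv₀ (by simpa using hq.1.ne')
  simp only [sub_self, zero_div, add_zero, one_div, inv_inv] at h
  refine h.congr' ?_
  filter_upwards [eventually_admissible_pair hq] with z hz
  rw [hStarL_eq hp hz.1 hz.2]
  simp only [Pi.div_apply, one_div]

theorem tendsto_hStarR (hp : p.Positive) (hq : Admissible q) :
    Tendsto (fun z : State × State => hStarR p z.1 z.2) (𝓝 (q, q)) (𝓝 (height q)) := by
  have hpos := mul_pos hq.1 (soundSpeed_pos hp hq)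
  have h := (((tendsto_const_nhds (x := (1 : ℝ))).div
    (tendsto_comp_snd (contDiffAt_height q).continuousAt) hq.1.ne').add
    (((tendsto_comp_snd (contDiffAt_vel hq).continuousAt).sub (tendsto_uStar hp hq)).div
      (tendsto_cR hp hq) hpos.ne')).inv₀ (by simpa using hq.1.ne')
  simp only [sub_self, zero_div, add_zero, one_div, inv_inv] at h
  refine h.congr' ?_
  filter_upwards [eventually_admissible_pair hq] with z hz
  rw [hStarR_eq hp hz.1 hz.2]
  simp only [Pi.div_apply, one_div]

theorem tendsto_speed1 (hp : p.Positive) (hq : Admissible q) :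
    Tendsto (fun z : State × State => speed1 p z.1 z.2) (𝓝 (q, q))
      (𝓝 (vel q - soundSpeed p q)) := by
  have h := (tendsto_comp_fst (contDiffAt_vel hq).continuousAt).sub ((tendsto_cL hp hq).div
    (tendsto_comp_fst (contDiffAt_height q).continuousAt) hq.1.ne')
  rwa [mul_div_cancel_left₀ _ hq.1.ne'] at h

theorem tendsto_speed3 (hp : p.Positive) (hq : Admissible q) :
    Tendsto (fun z : State × State => speed3 p z.1 z.2) (𝓝 (q, q))
      (𝓝 (vel q + soundSpeed p q)) := by
  have h := (tendsto_comp_snd (contDiffAt_vel hq).continuousAt).add ((tendsto_cR hp hq).div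
    (tendsto_comp_snd (contDiffAt_height q).continuousAt) hq.1.ne')
  rwa [mul_div_cancel_left₀ _ hq.1.ne'] at h

/-! ### Jumps of the solver -/

/-- Ratios of the jumps of `q` and of the jump of velocity through an acoustic wave. Here `ε` is
`1` for the left wave and `-1` for the right one. -/
noncomputable def jumpRatio (ε c h' : ℝ) (q : State) : State :=
  ![-(height q * h' / c), ε * h' - vel q * (height q * h' / c), sigxx q * height q ^ 2 / c,
    -(sigzz q * (h' ^ 2 + h' * height q + height q ^ 2) * h' / (height q * c))]

theorem state_eq (hq : Admissible q) :
    q = ![height q, height q * vel q, height q * sigxx q, height q * sigzz q] :=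
  -- The retained components of `relaxInit` do not involve the parameters, so any values will do.
  (toState_relaxInit (p := ⟨0, 0, 0⟩) hq.1.ne' 0).symm

/-- The relations `[1 / h] = d / c`, `σ_xx h²` constant and `σ_zz / h²` constant let `d` be factored
out of each jump. The factor involves no division by `d`, hence is continuous up to the diagonal,
where `d` vanishes. -/
theorem jump_eq_jumpRatio {w : RelaxState} {ε c d : ℝ} (hq : Admissible q) (hc : c ≠ 0)
    (hw : 0 < w.h) (hd : 1 / w.h = 1 / height q + d / c) (hu : w.u - vel q = ε * d)
    (hx : w.sigxx = sigxx q * (height q / w.h) ^ 2)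
    (hz : w.sigzz = sigzz q * (w.h / height q) ^ 2) (k : Fin 4) :
    w.toState k - q k = jumpRatio ε c w.h q k * d := by
  have h0 := hq.1
  have hd' : d = c * (1 / w.h - 1 / height q) := by rw [hd]; field_simp; ring
  have hu' : w.u = vel q + ε * d := by linarith
  conv_lhs => rw [state_eq hq]
  fin_cases k
  · simp [RelaxState.toState, jumpRatio]
    rw [hd']
    field_simp
    ring
  · simp [RelaxState.toState, jumpRatio]
    rw [hu', hd']
    field_simp
    ring
  · simp [RelaxState.toState, jumpRatio]
    rw [hx, hd']
    field_simp
  · simp [RelaxState.toState, jumpRatio]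
    rw [hz, hd']
    field_simp
    ring

theorem one_div_hStarL (hp : p.Positive) (hl : Admissible ql) (hr : Admissible qr) :
    1 / hStarL p ql qr = 1 / height ql + (uStar p ql qr - vel ql) / cL p ql qr := by
  rw [hStarL_eq hp hl hr, one_div, inv_inv]

theorem one_div_hStarR (hp : p.Positive) (hl : Admissible ql) (hr : Admissible qr) :
    1 / hStarR p ql qr = 1 / height qr + (vel qr - uStar p ql qr) / cR p ql qr := by
  rw [hStarR_eq hp hl hr, one_div, inv_inv]

theorem jumpL_eq (hp : p.Positive) (hl : Admissible ql) (hr : Admissible qr) (k : Fin 4) :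
    (stateLS p ql qr).toState k - ql k =
      jumpRatio 1 (cL p ql qr) (hStarL p ql qr) ql k * (uStar p ql qr - vel ql) :=
  jump_eq_jumpRatio (w := stateLS p ql qr) hl (cL_pos hp hl hr).ne' (hStarL_pos hp hl hr)
    (one_div_hStarL hp hl hr) (one_mul _).symm rfl rfl k

theorem jumpR_eq (hp : p.Positive) (hl : Admissible ql) (hr : Admissible qr) (k : Fin 4) :
    (stateRS p ql qr).toState k - qr k =
      jumpRatio (-1) (cR p ql qr) (hStarR p ql qr) qr k * (vel qr - uStar p ql qr) :=
  jump_eq_jumpRatio (w := stateRS p ql qr) hr (cR_pos hp hl hr).ne' (hStarR_pos hp hl hr)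
    (one_div_hStarR hp hl hr) (by simp [stateRS]) rfl rfl k

theorem tendsto_jumpRatio {ι : Type*} {l : Filter ι} {c h' : ι → ℝ} {y : ι → State} {ε c0 : ℝ}
    (hq : Admissible q) (hc0 : c0 ≠ 0) (hc : Tendsto c l (𝓝 c0))
    (hh : Tendsto h' l (𝓝 (height q))) (hy : Tendsto y l (𝓝 q)) (k : Fin 4) :
    Tendsto (fun i => jumpRatio ε (c i) (h' i) (y i) k) l
      (𝓝 (jumpRatio ε c0 (height q) q k)) := by
  have h0 := (contDiffAt_height q).continuousAt.tendsto.comp hy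
  have hv := (contDiffAt_vel hq).continuousAt.tendsto.comp hy
  have hx := (contDiffAt_sigxx hq).continuousAt.tendsto.comp hy
  have hz := (contDiffAt_sigzz hq).continuousAt.tendsto.comp hy
  fin_cases k
  · exact ((h0.mul hh).div hc hc0).neg
  · exact (hh.const_mul ε).sub (hv.mul ((h0.mul hh).div hc hc0))
  · exact (hx.mul (h0.pow 2)).div hc hc0
  · exact (((hz.mul (((hh.pow 2).add (hh.mul h0)).add (h0.pow 2))).mul hh).div (h0.mul hc)
      (mul_ne_zero hq.1.ne' hc0)).neg

theorem tendsto_jumpRatioL (hp : p.Positive) (hq : Admissible q) (k : Fin 4) :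
    Tendsto (fun z : State × State => jumpRatio 1 (cL p z.1 z.2) (hStarL p z.1 z.2) z.1 k)
      (𝓝 (q, q)) (𝓝 (jumpRatio 1 (height q * soundSpeed p q) (height q) q k)) :=
  tendsto_jumpRatio hq (mul_pos hq.1 (soundSpeed_pos hp hq)).ne' (tendsto_cL hp hq)
    (tendsto_hStarL hp hq) (continuous_fst.tendsto (q, q)) k

theorem tendsto_jumpRatioR (hp : p.Positive) (hq : Admissible q) (k : Fin 4) :
    Tendsto (fun z : State × State => jumpRatio (-1) (cR p z.1 z.2) (hStarR p z.1 z.2) z.2 k)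
      (𝓝 (q, q)) (𝓝 (jumpRatio (-1) (height q * soundSpeed p q) (height q) q k)) :=
  tendsto_jumpRatio hq (mul_pos hq.1 (soundSpeed_pos hp hq)).ne' (tendsto_cR hp hq)
    (tendsto_hStarR hp hq) (continuous_snd.tendsto (q, q)) k

/-! ### Pointwise consistency -/

theorem flux_diag (hp : p.Positive) (hq : Admissible q) :
    fluxL p q q = flux p q ∧ fluxR p q q = flux p q := by
  constructor <;> ext k
  · rw [fluxL_eq hp hq hq, waveL_of_contact hp hq hq rfl rfl]; ring
  · rw [fluxR_eq hp hq hq, waveR_of_contact hp hq hq rfl rfl]; ring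

theorem tendsto_jumps (hp : p.Positive) (hq : Admissible q) (k : Fin 4) :
    Tendsto (fun z : State × State => (stateLS p z.1 z.2).toState k) (𝓝 (q, q)) (𝓝 (q k)) ∧
      Tendsto (fun z : State × State => (stateRS p z.1 z.2).toState k) (𝓝 (q, q)) (𝓝 (q k)) := by
  have hu := tendsto_uStar hp hq
  have hv := (contDiffAt_vel hq).continuousAt
  have hk : ContinuousAt (fun q : State => q k) q := (continuous_apply k).continuousAt
  constructor
  · have h := ((tendsto_jumpRatioL hp hq k).mul (hu.sub (tendsto_comp_fst hv))).add (tendsto_comp_fst hk)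
    rw [sub_self, mul_zero, zero_add] at h
    refine h.congr' ?_
    filter_upwards [eventually_admissible_pair hq] with z hz
    rw [← jumpL_eq hp hz.1 hz.2, sub_add_cancel]
  · have h := ((tendsto_jumpRatioR hp hq k).mul ((tendsto_comp_snd hv).sub hu)).add (tendsto_comp_snd hk)
    rw [sub_self, mul_zero, zero_add] at h
    refine h.congr' ?_
    filter_upwards [eventually_admissible_pair hq] with z hz
    rw [← jumpR_eq hp hz.1 hz.2, sub_add_cancel]

theorem tendsto_waveL (hp : p.Positive) (hq : Admissible q) (k : Fin 4) :
    Tendsto (fun z : State × State => waveL p (fun q => q k) z.1 z.2) (𝓝 (q, q)) (𝓝 0) := by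
  have hk : ContinuousAt (fun q : State => q k) q := (continuous_apply k).continuousAt
  obtain ⟨h1, h2⟩ := tendsto_jumps hp hq k
  have c0 := tendsto_const_nhds (x := (0 : ℝ)) (f := 𝓝 (q, q))
  have h := (((c0.min (tendsto_speed1 hp hq)).mul (h1.sub (tendsto_comp_fst hk))).add
    ((c0.min (tendsto_uStar hp hq)).mul (h2.sub h1))).add
    ((c0.min (tendsto_speed3 hp hq)).mul ((tendsto_comp_snd hk).sub h2))
  simp only [sub_self, mul_zero, add_zero] at h
  exact h

theorem tendsto_waveR (hp : p.Positive) (hq : Admissible q) (k : Fin 4) :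
    Tendsto (fun z : State × State => waveR p (fun q => q k) z.1 z.2) (𝓝 (q, q)) (𝓝 0) := by
  have hk : ContinuousAt (fun q : State => q k) q := (continuous_apply k).continuousAt
  obtain ⟨h1, h2⟩ := tendsto_jumps hp hq k
  have c0 := tendsto_const_nhds (x := (0 : ℝ)) (f := 𝓝 (q, q))
  have h := (((c0.max (tendsto_speed1 hp hq)).mul (h1.sub (tendsto_comp_fst hk))).add
    ((c0.max (tendsto_uStar hp hq)).mul (h2.sub h1))).add
    ((c0.max (tendsto_speed3 hp hq)).mul ((tendsto_comp_snd hk).sub h2))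
  simp only [sub_self, mul_zero, add_zero] at h
  exact h

theorem tendsto_fluxL (hp : p.Positive) (hq : Admissible q) :
    Tendsto (fun z : State × State => fluxL p z.1 z.2) (𝓝 (q, q)) (𝓝 (flux p q)) := by
  refine tendsto_pi_nhds.2 fun k => ?_
  have h := (tendsto_comp_fst (contDiffAt_flux p hq k).continuousAt).add (tendsto_waveL hp hq k)
  rw [add_zero] at h
  refine h.congr' ?_
  filter_upwards [eventually_admissible_pair hq] with z hz
  rw [fluxL_eq hp hz.1 hz.2]

theorem tendsto_fluxR (hp : p.Positive) (hq : Admissible q) :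
    Tendsto (fun z : State × State => fluxR p z.1 z.2) (𝓝 (q, q)) (𝓝 (flux p q)) := by
  refine tendsto_pi_nhds.2 fun k => ?_
  have h := (tendsto_comp_snd (contDiffAt_flux p hq k).continuousAt).sub (tendsto_waveR hp hq k)
  rw [sub_zero] at h
  refine h.congr' ?_
  filter_upwards [eventually_admissible_pair hq] with z hz
  rw [fluxR_eq hp hz.1 hz.2]

/-! ### Consistency with the nonconservative products -/

/-- Both arguments move, so strict differentiability, available for `C¹` functions, is what is
needed. -/
theorem isBigO_sub_diag {f : State → ℝ} (hf : ContDiffAt ℝ 1 f q) :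
    (fun z : State × State => f z.2 - f z.1) =O[𝓝 (q, q)] fun z => z.2 - z.1 := by
  have h := (hf.hasStrictFDerivAt one_ne_zero).isBigO_sub
  refine (h.neg_left.congr_left fun z => neg_sub _ _).trans ?_
  exact (isBigO_refl _ _).neg_left.congr_left fun z => neg_sub _ _

theorem tendsto_cL_add_cR (hp : p.Positive) (hq : Admissible q) :
    ∃ c0 : ℝ, c0 ≠ 0 ∧
      Tendsto (fun z : State × State => cL p z.1 z.2 + cR p z.1 z.2) (𝓝 (q, q)) (𝓝 c0) :=
  have hpos := mul_pos hq.1 (soundSpeed_pos hp hq)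
  ⟨_, (add_pos hpos hpos).ne', (tendsto_cL hp hq).add (tendsto_cR hp hq)⟩

theorem isBigO_uStar_sub_velL (hp : p.Positive) (hq : Admissible q) :
    (fun z : State × State => uStar p z.1 z.2 - vel z.1) =O[𝓝 (q, q)] fun z => z.2 - z.1 := by
  obtain ⟨c0, h0, hc⟩ := tendsto_cL_add_cR hp hq
  have h1 := ((tendsto_cR hp hq).div hc h0).isBigO_one ℝ
  have h2 := ((tendsto_const_nhds (x := (1 : ℝ))).div hc h0).isBigO_one ℝ
  have h := (h1.mul (isBigO_sub_diag (contDiffAt_vel hq)).norm_right).sub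
    (h2.mul (isBigO_sub_diag (contDiffAt_pressure p hq)).norm_right)
  simp only [one_mul] at h
  refine (isBigO_norm_right.1 h).congr' ?_ EventuallyEq.rfl
  filter_upwards [eventually_admissible_pair hq] with z hz
  rw [uStar_sub_velL hp hz.1 hz.2]
  simp only [Pi.div_apply]
  ring

theorem isBigO_velR_sub_uStar (hp : p.Positive) (hq : Admissible q) :
    (fun z : State × State => vel z.2 - uStar p z.1 z.2) =O[𝓝 (q, q)] fun z => z.2 - z.1 :=
  ((isBigO_sub_diag (contDiffAt_vel hq)).sub (isBigO_uStar_sub_velL hp hq)).congr_left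
    fun z => by ring

/-- The difference of the numerical fluxes for an advected quantity `h φ`. -/
theorem advected_flux_sub {ul us ur hl hls hrs hr φl φls φrs φr s1 s3 cl cr : ℝ}
    (h1 : hl * (ul - s1) = cl) (h2 : hls * (us - s1) = cl) (h3 : hrs * (us - s3) = -cr)
    (h4 : hr * (ur - s3) = -cr) :
    hr * φr * ur - hl * φl * ul - (s1 * (hls * φls - hl * φl) + us * (hrs * φrs - hls * φls)
      + s3 * (hr * φr - hrs * φrs)) = cl * (φls - φl) + cr * (φrs - φr) := by
  -- The contact drops out because no mass crosses it; each acoustic wave contributes its mass flux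
  -- times the jump of `φ`.
  linear_combination φr * h4 - φrs * h3 + φls * h2 - φl * h1

theorem fluxR_sub_fluxL (hp : p.Positive) (hl : Admissible ql) (hr : Admissible qr) (k : Fin 4) :
    fluxR p ql qr k - fluxL p ql qr k = flux p qr k - flux p ql k
      - (speed1 p ql qr * ((stateLS p ql qr).toState k - ql k)
        + uStar p ql qr * ((stateRS p ql qr).toState k - (stateLS p ql qr).toState k)
        + speed3 p ql qr * (qr k - (stateRS p ql qr).toState k)) := by
  have h := leftSum_add_rightSum (s1 := speed1 p ql qr) (s2 := speed2 p ql qr)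
    (s3 := speed3 p ql qr) (ql k) ((stateLS p ql qr).toState k) ((stateRS p ql qr).toState k) (qr k)
  rw [fluxL_eq hp hl hr, fluxR_eq hp hl hr, waveL, waveR]
  rw [speed2] at h ⊢
  linarith

theorem height_mul_sigxx (hq : Admissible q) : height q * sigxx q = q 2 :=
  mul_div_cancel₀ _ hq.1.ne'

theorem height_mul_sigzz (hq : Admissible q) : height q * sigzz q = q 3 :=
  mul_div_cancel₀ _ hq.1.ne'

/-- Since `σ_xx h²` is constant through an acoustic wave, `c [σ_xx]` is a difference of squares of
`1 / h`, and its factor `c [1 / h]` is a velocity jump. Both coefficients tend to `2 h σ_xx` on the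
diagonal. -/
theorem fluxR_sub_fluxL_xx (hp : p.Positive) (hl : Admissible ql) (hr : Admissible qr) :
    fluxR p ql qr 2 - fluxL p ql qr 2 =
      sigxx ql * height ql ^ 2 * (1 / hStarL p ql qr + 1 / height ql) * (uStar p ql qr - vel ql)
      + sigxx qr * height qr ^ 2 * (1 / hStarR p ql qr + 1 / height qr)
        * (vel qr - uStar p ql qr) := by
  have h := advected_flux_sub (φl := sigxx ql) (φls := (stateLS p ql qr).sigxx)
    (φrs := (stateRS p ql qr).sigxx) (φr := sigxx qr) (height_mul_speed1 (p := p) (qr := qr) hl)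
    (hStarL_mul hp hl hr) (hStarR_mul hp hl hr) (height_mul_speed3 hr)
  rw [fluxR_sub_fluxL hp hl hr, ← height_mul_sigxx hl, ← height_mul_sigxx hr]
  refine h.trans ?_
  have hL := hStarL_pos hp hl hr
  have hR := hStarR_pos hp hl hr
  have e1 : uStar p ql qr - vel ql
      = cL p ql qr * (1 / hStarL p ql qr - 1 / height ql) := by
    linear_combination -cL_div_hStarL hp hl hr
  have e2 : vel qr - uStar p ql qr
      = cR p ql qr * (1 / hStarR p ql qr - 1 / height qr) := by
    linear_combination -cR_div_hStarR hp hl hr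
  have := hl.1
  have := hr.1
  rw [e1, e2]
  simp only [stateLS, stateRS]
  field_simp
  ring

/-- Here `σ_zz / h²` is constant through an acoustic wave, so `c [σ_zz]` factors through `[h²]`, and
`c [h]` is the opposite of a velocity jump times the two heights. Both coefficients tend to `-2 h
σ_zz`. -/
theorem fluxR_sub_fluxL_zz (hp : p.Positive) (hl : Admissible ql) (hr : Admissible qr) :
    fluxR p ql qr 3 - fluxL p ql qr 3 =
      -(sigzz ql * hStarL p ql qr * (hStarL p ql qr + height ql) / height ql)
        * (uStar p ql qr - vel ql)
      + -(sigzz qr * hStarR p ql qr * (hStarR p ql qr + height qr) / height qr)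
        * (vel qr - uStar p ql qr) := by
  have h := advected_flux_sub (φl := sigzz ql) (φls := (stateLS p ql qr).sigzz)
    (φrs := (stateRS p ql qr).sigzz) (φr := sigzz qr) (height_mul_speed1 (p := p) (qr := qr) hl)
    (hStarL_mul hp hl hr) (hStarR_mul hp hl hr) (height_mul_speed3 hr)
  rw [fluxR_sub_fluxL hp hl hr, ← height_mul_sigzz hl, ← height_mul_sigzz hr]
  refine h.trans ?_
  have hL := hStarL_pos hp hl hr
  have hR := hStarR_pos hp hl hr
  have e1 : uStar p ql qr - vel ql
      = cL p ql qr * (1 / hStarL p ql qr - 1 / height ql) := by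
    linear_combination -cL_div_hStarL hp hl hr
  have e2 : vel qr - uStar p ql qr
      = cR p ql qr * (1 / hStarR p ql qr - 1 / height qr) := by
    linear_combination -cR_div_hStarR hp hl hr
  have := hl.1
  have := hr.1
  rw [e1, e2]
  simp only [stateLS, stateRS]
  field_simp
  ring

/-- The two velocity jumps add up to `u_r - u_l`. Replacing both coefficients by the common limit
`-N` gives exactly `-(u_r - u_l) N`, with an error `o(1)` times `O(q_r - q_l)`. -/
theorem isLittleO_of_coefficients (hp : p.Positive) (hq : Admissible q) {A B : State × State → ℝ}
    {N : ℝ} (hA : Tendsto A (𝓝 (q, q)) (𝓝 (-N))) (hB : Tendsto B (𝓝 (q, q)) (𝓝 (-N))) :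
    (fun z : State × State => A z * (uStar p z.1 z.2 - vel z.1)
      + B z * (vel z.2 - uStar p z.1 z.2) + (vel z.2 - vel z.1) * N)
      =o[𝓝 (q, q)] fun z => z.2 - z.1 := by
  have hA' : (fun z => A z + N) =o[𝓝 (q, q)] fun _ => (1 : ℝ) :=
    (isLittleO_one_iff ℝ).2 (by simpa using hA.add_const N)
  have hB' : (fun z => B z + N) =o[𝓝 (q, q)] fun _ => (1 : ℝ) :=
    (isLittleO_one_iff ℝ).2 (by simpa using hB.add_const N)
  have h := (hA'.mul_isBigO (isBigO_uStar_sub_velL hp hq).norm_right).add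
    (hB'.mul_isBigO (isBigO_velR_sub_uStar hp hq).norm_right)
  simp only [one_mul] at h
  exact (isLittleO_norm_right.1 h).congr_left fun z => by ring

theorem isLittleO_flux_sub (hp : p.Positive) (hq : Admissible q) :
    (fun z : State × State =>
        fluxR p z.1 z.2 - fluxL p z.1 z.2 + (vel z.2 - vel z.1) • ncVec q)
      =o[𝓝 (q, q)] fun z : State × State => z.2 - z.1 := by
  refine isLittleO_pi.2 fun k => ?_
  have hh := (contDiffAt_height q).continuousAt
  have hx := (contDiffAt_sigxx hq).continuousAt
  have hz := (contDiffAt_sigzz hq).continuousAt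
  have hL := tendsto_hStarL hp hq
  have hR := tendsto_hStarR hp hq
  have c1 := tendsto_const_nhds (x := (1 : ℝ)) (f := 𝓝 (q, q))
  have h0 := hq.1.ne'
  simp only [Pi.add_apply, Pi.sub_apply, Pi.smul_apply, smul_eq_mul]
  fin_cases k
  · refine (isLittleO_zero _ _).congr' ?_ EventuallyEq.rfl
    filter_upwards [eventually_admissible_pair hq] with z hz
    have h := flux_eq_massFlux hp hz.1 hz.2
    simp [ncVec, h.1, h.2]
  · refine (isLittleO_zero _ _).congr' ?_ EventuallyEq.rfl
    filter_upwards [eventually_admissible_pair hq] with z hz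
    have h := flux_eq_momentumFlux hp hz.1 hz.2
    simp [ncVec, h.1, h.2]
  · have e : sigxx q * height q ^ 2 * (1 / height q + 1 / height q) = -ncVec q 2 := by
      simp only [ncVec, Matrix.cons_val]; field_simp; ring
    have hA := ((tendsto_comp_fst hx).mul ((tendsto_comp_fst hh).pow 2)).mul
      ((c1.div hL h0).add (c1.div (tendsto_comp_fst hh) h0))
    have hB := ((tendsto_comp_snd hx).mul ((tendsto_comp_snd hh).pow 2)).mul
      ((c1.div hR h0).add (c1.div (tendsto_comp_snd hh) h0))
    rw [e] at hA hB
    refine (isLittleO_of_coefficients hp hq hA hB).congr' ?_ EventuallyEq.rfl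
    filter_upwards [eventually_admissible_pair hq] with z hz
    exact congrArg (· + (vel z.2 - vel z.1) * ncVec q 2) (fluxR_sub_fluxL_xx hp hz.1 hz.2).symm
  · have e : -(sigzz q * height q * (height q + height q) / height q) = -ncVec q 3 := by
      simp only [ncVec, Matrix.cons_val]; field_simp; ring
    have hA := ((((tendsto_comp_fst hz).mul hL).mul (hL.add (tendsto_comp_fst hh))).div
      (tendsto_comp_fst hh) h0).neg
    have hB := ((((tendsto_comp_snd hz).mul hR).mul (hR.add (tendsto_comp_snd hh))).div
      (tendsto_comp_snd hh) h0).neg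
    rw [e] at hA hB
    refine (isLittleO_of_coefficients hp hq hA hB).congr' ?_ EventuallyEq.rfl
    filter_upwards [eventually_admissible_pair hq] with z hz
    exact congrArg (· + (vel z.2 - vel z.1) * ncVec q 3) (fluxR_sub_fluxL_zz hp hz.1 hz.2).symm

/-! ### Truncation error -/

section Difference

variable {ι : Type*} {l : Filter ι} {z : ι → State × State} {δ : ι → ℝ} {D : State}

theorem tendsto_smul_of_isLittleO {R : State × State → ℝ} (hz : Tendsto z l (𝓝 (q, q)))
    (hD : Tendsto (fun i => (δ i)⁻¹ • ((z i).2 - (z i).1)) l (𝓝 D))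
    (hR : R =o[𝓝 (q, q)] fun z => z.2 - z.1) :
    Tendsto (fun i => (δ i)⁻¹ * R (z i)) l (𝓝 0) := by
  have h := (isBigO_refl (fun i => (δ i)⁻¹) l).smul_isLittleO (hR.comp_tendsto hz)
  have h' := h.trans_isBigO (hD.isBigO_one ℝ)
  exact (isLittleO_one_iff ℝ).1 h'

theorem tendsto_difference_quotient {f : State → ℝ} (hf : ContDiffAt ℝ 1 f q)
    (hz : Tendsto z l (𝓝 (q, q)))
    (hD : Tendsto (fun i => (δ i)⁻¹ • ((z i).2 - (z i).1)) l (𝓝 D)) :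
    Tendsto (fun i => (δ i)⁻¹ * (f (z i).2 - f (z i).1)) l (𝓝 (fderiv ℝ f q D)) := by
  have hs := (hf.hasStrictFDerivAt one_ne_zero).isLittleO
  have hs' : (fun z : State × State => f z.2 - f z.1 - fderiv ℝ f q (z.2 - z.1))
      =o[𝓝 (q, q)] fun z => z.2 - z.1 := by
    have h0 : (fun z : State × State => z.1 - z.2) =O[𝓝 (q, q)] fun z => z.2 - z.1 :=
      (isBigO_refl _ _).neg_left.congr_left fun z => neg_sub _ _
    refine (hs.neg_left.trans_isBigO h0).congr_left fun z => ?_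
    simp only [map_sub]
    ring
  have h := (tendsto_smul_of_isLittleO hz hD hs').add
    (((fderiv ℝ f q).continuous.tendsto D).comp hD)
  rw [zero_add] at h
  refine h.congr fun i => ?_
  simp only [Function.comp_apply, map_smul, smul_eq_mul]
  ring

theorem tendsto_uStar_quotient (hp : p.Positive) (hq : Admissible q) (hz : Tendsto z l (𝓝 (q, q)))
    (hD : Tendsto (fun i => (δ i)⁻¹ • ((z i).2 - (z i).1)) l (𝓝 D)) :
    Tendsto (fun i => (δ i)⁻¹ * (uStar p (z i).1 (z i).2 - vel (z i).1)) l
      (𝓝 ((height q * soundSpeed p q * fderiv ℝ vel q D - fderiv ℝ (pressure p) q D)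
        / (height q * soundSpeed p q + height q * soundSpeed p q))) := by
  have hpos := mul_pos hq.1 (soundSpeed_pos hp hq)
  have hv := tendsto_difference_quotient (contDiffAt_vel hq) hz hD
  have hP := tendsto_difference_quotient (contDiffAt_pressure p hq) hz hD
  have hcl := (tendsto_cL hp hq).comp hz
  have hcr := (tendsto_cR hp hq).comp hz
  refine (((hcr.mul hv).sub hP).div (hcl.add hcr) (add_pos hpos hpos).ne').congr' ?_
  filter_upwards [hz.eventually (eventually_admissible_pair hq)] with i hi
  rw [uStar_sub_velL hp hi.1 hi.2]
  simp only [Function.comp_apply, Pi.div_apply]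
  ring

/-- Along pairs of states that approach the diagonal in a given direction, the contribution of
the right-going waves to the right flux has a limit that depends on the direction only. -/
theorem exists_tendsto_waveR_quotient (hp : p.Positive) (hq : Admissible q) (D : State)
    (k : Fin 4) : ∃ ω : ℝ, ∀ (ι : Type) (l : Filter ι) (z : ι → State × State) (δ : ι → ℝ),
      Tendsto z l (𝓝 (q, q)) → Tendsto (fun i => (δ i)⁻¹ • ((z i).2 - (z i).1)) l (𝓝 D) →
      Tendsto (fun i => (δ i)⁻¹ * waveR p (fun q => q k) (z i).1 (z i).2) l (𝓝 ω) := by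
  set c := height q * soundSpeed p q
  set U := (c * fderiv ℝ vel q D - fderiv ℝ (pressure p) q D) / (c + c) with hUdef
  set J1 := jumpRatio 1 c (height q) q k * U with hJ1
  set J3 := -(jumpRatio (-1) c (height q) q k * (fderiv ℝ vel q D - U)) with hJ3
  -- Each term is the positive part of a limit speed times the limit of a jump divided by `δ`: `J1`,
  -- `J3` for the acoustic waves, and for the contact what remains of the total jump `D k`.
  refine ⟨max 0 (vel q - soundSpeed p q) * J1 + max 0 (vel q) * (D k - J1 - J3)
    + max 0 (vel q + soundSpeed p q) * J3, fun ι l z δ hz hD => ?_⟩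
  have hU := tendsto_uStar_quotient hp hq hz hD
  have hv := tendsto_difference_quotient (contDiffAt_vel hq) hz hD
  have hDk := (tendsto_pi_nhds.1 hD) k
  have j1 := ((tendsto_jumpRatioL hp hq k).comp hz).mul hU
  have j3 := (((tendsto_jumpRatioR hp hq k).comp hz).mul (hv.sub hU)).neg
  have c0 := tendsto_const_nhds (x := (0 : ℝ)) (f := 𝓝 (q, q))
  have m1 := (c0.max (tendsto_speed1 hp hq)).comp hz
  have m2 := (c0.max (tendsto_uStar hp hq)).comp hz
  have m3 := (c0.max (tendsto_speed3 hp hq)).comp hz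
  refine (((m1.mul j1).add (m2.mul ((hDk.sub j1).sub j3))).add (m3.mul j3)).congr' ?_
  filter_upwards [hz.eventually (eventually_admissible_pair hq)] with i hi
  have e1 := jumpL_eq hp hi.1 hi.2 k
  have e3 := jumpR_eq hp hi.1 hi.2 k
  simp only [Function.comp_apply, Pi.smul_apply, Pi.sub_apply, smul_eq_mul]
  rw [waveR, rightSum, speed2]
  linear_combination (δ i)⁻¹ * (max 0 (uStar p (z i).1 (z i).2)
    - max 0 (speed1 p (z i).1 (z i).2)) * e1 + (δ i)⁻¹ * (max 0 (speed3 p (z i).1 (z i).2)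
    - max 0 (uStar p (z i).1 (z i).2)) * e3

/-- The fluctuations have the limit `∂_x F + N ∂_x u`. -/
theorem tendsto_wave_quotient (hp : p.Positive) (hq : Admissible q) (k : Fin 4)
    (hz : Tendsto z l (𝓝 (q, q)))
    (hD : Tendsto (fun i => (δ i)⁻¹ • ((z i).2 - (z i).1)) l (𝓝 D)) :
    Tendsto (fun i => (δ i)⁻¹ * (waveL p (fun q => q k) (z i).1 (z i).2
        + waveR p (fun q => q k) (z i).1 (z i).2)) l
      (𝓝 (fderiv ℝ (fun q => flux p q k) q D + fderiv ℝ vel q D * ncVec q k)) := by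
  have h1 := tendsto_difference_quotient (contDiffAt_flux p hq k) hz hD
  have h2 := tendsto_difference_quotient (contDiffAt_vel hq) hz hD
  have h3 := tendsto_smul_of_isLittleO hz hD (isLittleO_pi.1 (isLittleO_flux_sub hp hq) k)
  have h := (h1.add (h2.mul_const (ncVec q k))).sub h3
  rw [sub_zero] at h
  refine h.congr' ?_
  filter_upwards [hz.eventually (eventually_admissible_pair hq)] with i hi
  simp only [Pi.add_apply, Pi.sub_apply, Pi.smul_apply, smul_eq_mul]
  rw [fluxL_eq hp hi.1 hi.2, fluxR_eq hp hi.1 hi.2]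
  ring

end Difference

theorem tendsto_truncation (hp : p.Positive) {Ω : Set (ℝ × ℝ)} {Q : ℝ → ℝ → State}
    (hQ : IsSmoothSolution p Ω Q) {t x : ℝ} (htx : (t, x) ∈ Ω) :
    Tendsto (fun d : ℝ × ℝ =>
        (1 / d.1) • (Q (t + d.1) x - Q t x)
          + (1 / d.2) • (fluxL p (Q t x) (Q t (x + d.2)) - fluxR p (Q t (x - d.2)) (Q t x)))
      (𝓝[>] 0 ×ˢ 𝓝[>] 0) (𝓝 0) := by
  have hq := hQ.admissible t x htx
  have hdiff : DifferentiableAt ℝ (fun z : ℝ × ℝ => Q z.1 z.2) (t, x) :=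
    (hQ.contDiffOn.differentiableOn one_ne_zero).differentiableAt (hQ.isOpen.mem_nhds htx)
  have hdt : HasDerivAt (fun s => Q s x) (deriv (fun s => Q s x) t) t := by
    have : DifferentiableAt ℝ (fun s => Q s x) t :=
      hdiff.comp t (f := fun s : ℝ => (s, x)) (by fun_prop)
    exact this.hasDerivAt
  have hdx : HasDerivAt (fun y => Q t y) (deriv (fun y => Q t y) x) x := by
    have : DifferentiableAt ℝ (fun y => Q t y) x :=
      hdiff.comp x (f := fun y : ℝ => (t, y)) (by fun_prop)
    exact this.hasDerivAt
  set D := deriv (fun y => Q t y) x with hDdef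
  have s1 : Tendsto (fun d : ℝ × ℝ => d.1) (𝓝[>] 0 ×ˢ 𝓝[>] 0) (𝓝[>] (0 : ℝ)) := tendsto_fst
  have s2 : Tendsto (fun d : ℝ × ℝ => d.2) (𝓝[>] 0 ×ˢ 𝓝[>] 0) (𝓝[>] (0 : ℝ)) := tendsto_snd
  have s2' : Tendsto (fun d : ℝ × ℝ => d.2) (𝓝[>] 0 ×ˢ 𝓝[>] 0) (𝓝 (0 : ℝ)) :=
    s2.mono_right nhdsWithin_le_nhds
  have hpos : ∀ᶠ d : ℝ × ℝ in 𝓝[>] 0 ×ˢ 𝓝[>] 0, 0 < d.2 := s2.eventually self_mem_nhdsWithin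
  have hT := hdt.tendsto_slope_zero_right.comp s1
  have hX := hdx.tendsto_slope_zero_right.comp s2
  have hneg : Tendsto (fun d : ℝ × ℝ => -d.2) (𝓝[>] 0 ×ˢ 𝓝[>] 0) (𝓝[<] (0 : ℝ)) := by
    refine tendsto_nhdsWithin_iff.2 ⟨by simpa using s2'.neg, ?_⟩
    filter_upwards [hpos] with d hd
    exact neg_lt_zero.2 hd
  have hX' : Tendsto (fun d : ℝ × ℝ => d.2⁻¹ • (Q t x - Q t (x - d.2))) (𝓝[>] 0 ×ˢ 𝓝[>] 0)
      (𝓝 D) := by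
    refine (hdx.tendsto_slope_zero_left.comp hneg).congr fun d => ?_
    simp only [Function.comp_apply, inv_neg, neg_smul, ← smul_neg, neg_sub, ← sub_eq_add_neg]
  have z1 : Tendsto (fun d : ℝ × ℝ => (Q t x, Q t (x + d.2))) (𝓝[>] 0 ×ˢ 𝓝[>] 0)
      (𝓝 (Q t x, Q t x)) := by
    refine tendsto_const_nhds.prodMk_nhds ?_
    have h : Tendsto (fun d : ℝ × ℝ => x + d.2) (𝓝[>] 0 ×ˢ 𝓝[>] 0) (𝓝 x) := by
      simpa using s2'.const_add x
    exact hdx.continuousAt.tendsto.comp h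
  have z2 : Tendsto (fun d : ℝ × ℝ => (Q t (x - d.2), Q t x)) (𝓝[>] 0 ×ˢ 𝓝[>] 0)
      (𝓝 (Q t x, Q t x)) := by
    refine Tendsto.prodMk_nhds ?_ tendsto_const_nhds
    have h : Tendsto (fun d : ℝ × ℝ => x - d.2) (𝓝[>] 0 ×ˢ 𝓝[>] 0) (𝓝 x) := by
      simpa using s2'.const_sub x
    exact hdx.continuousAt.tendsto.comp h
  refine tendsto_pi_nhds.2 fun k => ?_
  -- The right-going waves at the left and right interfaces have difference quotients with the same
  -- limit `ω`, since both pairs of states approach the diagonal in the direction `D`.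
  obtain ⟨ω, hω⟩ := exists_tendsto_waveR_quotient hp hq D k
  have w1 := hω _ _ _ (fun d : ℝ × ℝ => d.2) z1 hX
  have w2 := hω _ _ _ (fun d : ℝ × ℝ => d.2) z2 hX'
  have w := tendsto_wave_quotient hp hq k (δ := fun d : ℝ × ℝ => d.2) z1 hX
  have hTk := tendsto_pi_nhds.1 hT k
  have e1 : deriv (fun s => Q s x k) t = deriv (fun s => Q s x) t k :=
    ((hasDerivAt_pi.1 hdt) k).deriv
  have e2 : deriv (fun y => flux p (Q t y) k) x = fderiv ℝ (fun q => flux p q k) (Q t x) D :=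
    (((contDiffAt_flux p hq k).differentiableAt one_ne_zero).hasFDerivAt.comp_hasDerivAt x
      hdx).deriv
  have e3 : deriv (fun y => vel (Q t y)) x = fderiv ℝ vel (Q t x) D :=
    (((contDiffAt_vel hq).differentiableAt one_ne_zero).hasFDerivAt.comp_hasDerivAt x hdx).deriv
  have heq := hQ.equation t x htx k
  rw [e1, e2, e3] at heq
  -- The cell receives left-going waves from its right interface and right-going waves from its left
  -- one. Adding and subtracting the right-going waves of the right interface gives a full
  -- fluctuation there, which tends to `∂_x F + N ∂_x u`, and a difference that tends to `ω - ω`.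
  have h := (hTk.add w).add (w2.sub w1)
  rw [sub_self, add_zero, ← add_assoc, heq] at h
  refine h.congr' ?_
  filter_upwards [z1.eventually (eventually_admissible_pair hq),
    z2.eventually (eventually_admissible_pair hq)] with d h1 h2
  simp only [Function.comp_apply, Pi.add_apply, Pi.sub_apply, Pi.smul_apply, smul_eq_mul, one_div]
  rw [fluxL_eq hp h1.1 h1.2, fluxR_eq hp h2.1 h2.2]
  ring

/-! ### Characteristic speeds -/

theorem fderiv_eq_of_hasDerivAt {f : State → ℝ} (hf : DifferentiableAt ℝ f q) {v : State} {d : ℝ}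
    (h : HasDerivAt (fun t : ℝ => f (q + t • v)) d 0) : fderiv ℝ f q v = d :=
  (hf.hasFDerivAt.hasLineDerivAt v).unique h

theorem hasDerivAt_coord (q v : State) (k : Fin 4) :
    HasDerivAt (fun t : ℝ => (q + t • v) k) (v k) 0 := by
  simpa using ((hasDerivAt_id (0 : ℝ)).mul_const (v k)).const_add (q k)

theorem hasDerivAt_div_height (hq : Admissible q) (v : State) (k : Fin 4) :
    HasDerivAt (fun t : ℝ => (q + t • v) k / height (q + t • v))
      ((v k - q k / height q * v 0) / height q) 0 := by
  have h0 : q 0 ≠ 0 := hq.1.ne'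
  have h := (hasDerivAt_coord q v k).div (hasDerivAt_coord q v 0) (by simpa using h0)
  refine h.congr_deriv ?_
  simp only [zero_smul, add_zero, height]
  field_simp

theorem hasDerivAt_height (q v : State) :
    HasDerivAt (fun t : ℝ => height (q + t • v)) (v 0) 0 := hasDerivAt_coord q v 0

theorem hasDerivAt_vel (hq : Admissible q) (v : State) :
    HasDerivAt (fun t : ℝ => vel (q + t • v)) ((v 1 - vel q * v 0) / height q) 0 :=
  hasDerivAt_div_height hq v 1

theorem hasDerivAt_sigxx (hq : Admissible q) (v : State) :
    HasDerivAt (fun t : ℝ => sigxx (q + t • v)) ((v 2 - sigxx q * v 0) / height q) 0 :=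
  hasDerivAt_div_height hq v 2

theorem hasDerivAt_sigzz (hq : Admissible q) (v : State) :
    HasDerivAt (fun t : ℝ => sigzz (q + t • v)) ((v 3 - sigzz q * v 0) / height q) 0 :=
  hasDerivAt_div_height hq v 3

theorem hasDerivAt_pressure (p : Params) (hq : Admissible q) (v : State) :
    HasDerivAt (fun t : ℝ => pressure p (q + t • v))
      (p.g * height q * v 0 + p.elastic * (v 3 - v 2)) 0 := by
  have h0 := hq.1
  have h := ((((hasDerivAt_height q v).pow 2).const_mul p.g).div_const 2).add
    (((hasDerivAt_height q v).const_mul p.elastic).mul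
      ((hasDerivAt_sigzz hq v).sub (hasDerivAt_sigxx hq v)))
  refine h.congr_deriv ?_
  simp only [zero_smul, add_zero, Pi.sub_apply]
  field_simp
  ring

/-- The coefficients `-σ_xx` and `3 σ_zz` come from `1 - 2` and `1 + 2`: the derivative of the flux
plus the nonconservative term. They are the source of `3 σ_zz + σ_xx` in `a²`. -/
theorem charMap_apply (p : Params) (hq : Admissible q) (v : State) :
    charMap p q v = ![v 1,
      2 * vel q * v 1 - vel q ^ 2 * v 0 + p.g * height q * v 0 + p.elastic * (v 3 - v 2),
      vel q * v 2 - sigxx q * (v 1 - vel q * v 0),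
      vel q * v 3 + 3 * sigzz q * (v 1 - vel q * v 0)] := by
  have h0 := hq.1
  have hF : ∀ k, DifferentiableAt ℝ (fun q => flux p q k) q := fun k =>
    (contDiffAt_flux p hq k).differentiableAt one_ne_zero
  have hh := hasDerivAt_height q v
  have hu := hasDerivAt_vel hq v
  have eu : fderiv ℝ vel q v = (v 1 - vel q * v 0) / height q :=
    fderiv_eq_of_hasDerivAt ((contDiffAt_vel hq).differentiableAt one_ne_zero) hu
  have ef : ∀ k, fderiv ℝ (flux p) q v k = fderiv ℝ (fun q => flux p q k) q v := fun k => by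
    rw [fderiv_pi hF, ContinuousLinearMap.pi_apply]
  ext k
  simp only [charMap, _root_.add_apply, ContinuousLinearMap.smulRight_apply,
    Pi.add_apply, Pi.smul_apply, smul_eq_mul, ef, eu]
  fin_cases k
  · refine (congrArg (· + _) (fderiv_eq_of_hasDerivAt (f := fun q => flux p q 0) (hF 0)
      (hh.mul hu))).trans ?_
    simp [ncVec]
    field_simp
    ring
  · refine (congrArg (· + _) (fderiv_eq_of_hasDerivAt (f := fun q => flux p q 1) (hF 1)
      ((hh.mul (hu.pow 2)).add (hasDerivAt_pressure p hq v)))).trans ?_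
    simp [ncVec]
    field_simp
    ring
  · refine (congrArg (· + _) (fderiv_eq_of_hasDerivAt (f := fun q => flux p q 2) (hF 2)
      ((hh.mul (hasDerivAt_sigxx hq v)).mul hu))).trans ?_
    simp [ncVec]
    field_simp
    ring
  · refine (congrArg (· + _) (fderiv_eq_of_hasDerivAt (f := fun q => flux p q 3) (hF 3)
      ((hh.mul (hasDerivAt_sigzz hq v)).mul hu))).trans ?_
    simp [ncVec]
    field_simp
    ring

theorem isCharSpeed_iff_exists {μ : ℝ} :
    IsCharSpeed p q μ ↔ ∃ v : State, v ≠ 0 ∧ charMap p q v = μ • v := by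
  constructor
  · intro h
    obtain ⟨v, hv⟩ := h.exists_hasEigenvector
    exact ⟨v, hv.2, hv.apply_eq_smul⟩
  · rintro ⟨v, h0, hv⟩
    exact Module.End.hasEigenvalue_of_hasEigenvector
      ⟨Module.End.mem_eigenspace_iff.2 hv, h0⟩

theorem isCharSpeed_iff (hp : p.Positive) (hq : Admissible q) (μ : ℝ) :
    IsCharSpeed p q μ ↔
      μ = vel q - soundSpeed p q ∨ μ = vel q ∨ μ = vel q + soundSpeed p q := by
  rw [isCharSpeed_iff_exists]
  have ha := soundSpeed_sq hp hq
  rw [soundSpeedSq] at ha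
  have of_sq : (μ - vel q) ^ 2 = soundSpeed p q ^ 2 → ∃ v : State, v ≠ 0 ∧
      charMap p q v = μ • v := by
    intro h
    -- Normalizing the height component to `1`, the other rows for `μ ≠ u` dictate this vector; the
    -- momentum row then says `(μ - u)² = a²`.
    refine ⟨![1, μ, -sigxx q, 3 * sigzz q], fun h0 => one_ne_zero (congrFun h0 0), ?_⟩
    rw [charMap_apply p hq]
    ext k
    fin_cases k
    · simp
    · simp
      linear_combination -h - ha
    · simp
      ring
    · simp
      ring
  constructor
  · rintro ⟨v, h0, hv⟩
    rw [charMap_apply p hq] at hv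
    have e0 := congrFun hv 0
    have e1 := congrFun hv 1
    have e2 := congrFun hv 2
    have e3 := congrFun hv 3
    simp at e0 e1 e2 e3
    by_cases hμ : μ = vel q
    · exact Or.inr (Or.inl hμ)
    have hν : μ - vel q ≠ 0 := sub_ne_zero.2 hμ
    -- Off the speed `u`, an eigenvector is determined by its height component, which therefore
    -- cannot vanish.
    have f2 : v 2 = -sigxx q * v 0 :=
      mul_left_cancel₀ hν (by linear_combination -e2 - sigxx q * e0)
    have f3 : v 3 = 3 * sigzz q * v 0 :=
      mul_left_cancel₀ hν (by linear_combination -e3 + 3 * sigzz q * e0)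
    have hv0 : v 0 ≠ 0 := by
      intro hv0
      refine h0 (funext fun k => ?_)
      rw [hv0, mul_zero] at e0 f2 f3
      fin_cases k
      exacts [hv0, e0, f2, f3]
    have key : ((μ - vel q) ^ 2 - soundSpeed p q ^ 2) * v 0 = 0 := by
      rw [f2, f3, e0] at e1
      linear_combination -e1 - v 0 * ha
    have hsq := sub_eq_zero.1 ((mul_eq_zero.1 key).resolve_right hv0)
    rcases sq_eq_sq_iff_eq_or_eq_neg.1 hsq with h | h
    · exact Or.inr (Or.inr (by linarith))
    · exact Or.inl (by linarith)
  · rintro (h | h | h)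
    · exact of_sq (by rw [h]; ring)
    -- A contact perturbation: height and velocity are kept, and equal increments of `h σ_xx` and `h
    -- σ_zz` leave the pressure unchanged.
    · refine ⟨![0, 0, 1, 1], fun h0 => one_ne_zero (congrFun h0 2), ?_⟩
      rw [charMap_apply p hq, h]
      ext k
      fin_cases k <;> simp
    · exact of_sq (by rw [h]; ring)

end ViscoSV



theorem mainTheorem1 :
    -- finite numerical propagation speed, with an absolute constant
    (∃ C : ℝ, 0 < C ∧ ∀ p : Params, p.Positive → ∀ ql qr : State,
      Admissible ql → Admissible qr →
        max (cL p ql qr / height ql) (cR p ql qr / height qr)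
            ≤ C * (|vel ql| + |vel qr| + soundSpeed p ql + soundSpeed p qr) ∧
        maxSpeed p ql qr
            ≤ C * (|vel ql| + |vel qr| + soundSpeed p ql + soundSpeed p qr)) ∧
    ∀ p : Params, p.Positive →
      -- the solver is the solution of the relaxation Riemann problem, with positive heights
      (∀ ql qr : State, Admissible ql → Admissible qr →
        0 < cL p ql qr ∧ 0 < cR p ql qr ∧ 0 < hStarL p ql qr ∧ 0 < hStarR p ql qr ∧
        speed1 p ql qr < speed2 p ql qr ∧ speed2 p ql qr < speed3 p ql qr ∧
        (stateL p ql qr).toState = ql ∧ (stateR p ql qr).toState = qr ∧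
        RankineHugoniot (speed1 p ql qr) (stateL p ql qr) (stateLS p ql qr) ∧
        RankineHugoniot (speed2 p ql qr) (stateLS p ql qr) (stateRS p ql qr) ∧
        RankineHugoniot (speed3 p ql qr) (stateRS p ql qr) (stateR p ql qr)) ∧
      -- closed formulas for the nonconservative components of the numerical fluxes
      (∀ ql qr : State, Admissible ql → Admissible qr → ∀ k : Fin 4, k = 2 ∨ k = 3 →
        fluxL p ql qr k = fluxLFormula p ql qr k ∧
        fluxR p ql qr k = fluxRFormula p ql qr k) ∧
      -- the scheme is the averaging of the approximate Riemann solutions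
      (∀ X dt q N, SchemeRun p X dt q N → ∀ n < N, ∀ i : ℤ,
        q (n + 1) i = cellAverage p X (dt n) (q n) i) ∧
      -- consistency
      (∀ q : State, Admissible q →
        fluxL p q q = flux p q ∧ fluxR p q q = flux p q ∧
        Tendsto (fun z : State × State => fluxL p z.1 z.2) (𝓝 (q, q)) (𝓝 (flux p q)) ∧
        Tendsto (fun z : State × State => fluxR p z.1 z.2) (𝓝 (q, q)) (𝓝 (flux p q)) ∧
        (fun z : State × State =>
            fluxR p z.1 z.2 - fluxL p z.1 z.2 + (vel z.2 - vel z.1) • ncVec q)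
          =o[𝓝 (q, q)] (fun z : State × State => z.2 - z.1)) ∧
      (∀ (Ω : Set (ℝ × ℝ)) (Q : ℝ → ℝ → State), IsSmoothSolution p Ω Q →
        ∀ t x : ℝ, (t, x) ∈ Ω →
          Tendsto (fun d : ℝ × ℝ =>
              (1 / d.1) • (Q (t + d.1) x - Q t x)
                + (1 / d.2) • (fluxL p (Q t x) (Q t (x + d.2))
                    - fluxR p (Q t (x - d.2)) (Q t x)))
            (𝓝[>] 0 ×ˢ 𝓝[>] 0) (𝓝 0)) ∧
      -- positivity
      (∀ X dt q N, SchemeRun p X dt q N → ∀ n ≤ N, ∀ i : ℤ, Admissible (q n i)) ∧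
      -- conservativity in `h` and `h u`
      (∀ ql qr : State, Admissible ql → Admissible qr →
        fluxL p ql qr 0 = massFlux p ql qr ∧ fluxR p ql qr 0 = massFlux p ql qr ∧
        fluxL p ql qr 1 = momentumFlux p ql qr ∧ fluxR p ql qr 1 = momentumFlux p ql qr) ∧
      (∀ X dt q N, SchemeRun p X dt q N → ∀ n < N, ∀ a b : ℤ, a ≤ b →
        ∑ i ∈ Finset.Ico a b, cellLength X i * (q (n + 1) i 0 - q n i 0)
            = -(dt n * (massFlux p (q n (b - 1)) (q n b) - massFlux p (q n (a - 1)) (q n a))) ∧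
        ∑ i ∈ Finset.Ico a b, cellLength X i * (q (n + 1) i 1 - q n i 1)
            = -(dt n * (momentumFlux p (q n (b - 1)) (q n b)
                - momentumFlux p (q n (a - 1)) (q n a)))) ∧
      -- discrete energy inequality
      (∀ ql qr : State, Admissible ql → Admissible qr →
        energyFluxR p ql qr ≤ numEnergyFlux p ql qr ∧
        numEnergyFlux p ql qr ≤ energyFluxL p ql qr) ∧
      (∀ H : State → State → ℝ,
        (∀ ql qr : State, Admissible ql → Admissible qr →
          energyFluxR p ql qr ≤ H ql qr ∧ H ql qr ≤ energyFluxL p ql qr) →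
        ∀ X dt q N, SchemeRun p X dt q N → ∀ n < N, ∀ i : ℤ,
          energy p (q (n + 1) i) - energy p (q n i)
            + dt n / cellLength X i * (H (q n i) (q n (i + 1)) - H (q n (i - 1)) (q n i)) ≤ 0) ∧
      -- maximum principle on `s_xx`, minimum principle on `s_zz`
      (∀ X dt q N, SchemeRun p X dt q N → ∀ k : ℝ, 0 < k →
        ((∀ i : ℤ, sxx (q 0 i) ≤ k) → ∀ n ≤ N, ∀ i : ℤ, sxx (q n i) ≤ k) ∧
        ((∀ i : ℤ, k ≤ szz (q 0 i)) → ∀ n ≤ N, ∀ i : ℤ, k ≤ szz (q n i))) ∧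
      -- steady contact discontinuities
      (∀ ql qr : State, Admissible ql → Admissible qr → vel ql = 0 → vel qr = 0 →
        pressure p ql = pressure p qr → ∀ ξ : ℝ,
          (ξ < 0 → riemannSolver p ξ ql qr = ql) ∧ (0 < ξ → riemannSolver p ξ ql qr = qr)) ∧
      (∀ X dt q N, SchemeRun p X dt q N → (∀ i : ℤ, vel (q 0 i) = 0) →
        (∀ i j : ℤ, pressure p (q 0 i) = pressure p (q 0 j)) →
          ∀ n ≤ N, ∀ i : ℤ, q n i = q 0 i) ∧
      -- sharp numerical viscosity
      (∀ q : State, Admissible q →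
        (∀ μ : ℝ, IsCharSpeed p q μ ↔
          μ = vel q - soundSpeed p q ∨ μ = vel q ∨ μ = vel q + soundSpeed p q) ∧
        Tendsto (fun z : State × State => speed1 p z.1 z.2) (𝓝 (q, q))
          (𝓝 (vel q - soundSpeed p q)) ∧
        Tendsto (fun z : State × State => speed2 p z.1 z.2) (𝓝 (q, q)) (𝓝 (vel q)) ∧
        Tendsto (fun z : State × State => speed3 p z.1 z.2) (𝓝 (q, q))
          (𝓝 (vel q + soundSpeed p q))) := by
  -- The bound on `c / h` holds with `3`; adding a velocity to it to form a wave speed costs one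
  -- more.
  refine ⟨⟨4, by norm_num, fun p hp ql qr hl hr => ⟨?_, maxSpeed_le hp hl hr⟩⟩, fun p hp => ?_⟩
  · have h1 := soundSpeed_pos hp hl
    have h2 := soundSpeed_pos hp hr
    have h3 := abs_nonneg (vel ql)
    have h4 := abs_nonneg (vel qr)
    exact max_le (by linarith [cL_div_le hp hl hr]) (by linarith [cR_div_le hp hl hr])
  refine ⟨fun ql qr hl hr => ?_, fun ql qr hl hr k _ => ?_, fun X dt q N h n hn i => ?_,
    fun q hq => ?_, fun Ω Q hQ t x htx => tendsto_truncation hp hQ htx,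
    fun X dt q N h n hn i => h.admissible hp hn i, fun ql qr hl hr => ?_,
    fun X dt q N h n hn a b hab => ?_, fun ql qr hl hr => ?_,
    fun H hH X dt q N h n hn i => h.energy_le hp hH hn i, fun X dt q N h k hk => ?_,
    fun ql qr hl hr hul hur hP ξ => riemannSolver_of_contact hp hl hr hul hur hP ξ,
    fun X dt q N h hu hP n hn i => h.steady hp hu hP hn i, fun q hq => ?_⟩
  · exact ⟨cL_pos hp hl hr, cR_pos hp hl hr, hStarL_pos hp hl hr, hStarR_pos hp hl hr,
      speed1_lt_speed2 hp hl hr, speed2_lt_speed3 hp hl hr, toState_stateL hl, toState_stateR hr,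
      rankineHugoniot_left hp hl hr, rankineHugoniot_middle p ql qr, rankineHugoniot_right hp hl hr⟩
  · exact ⟨fluxL_eq_formula hp hl hr k, fluxR_eq_formula hp hl hr k⟩
  · rw [h.step n hn i, schemeStep_eq_cellAverage hp (h.stepData hp hn)]
  · exact ⟨(flux_diag hp hq).1, (flux_diag hp hq).2, tendsto_fluxL hp hq, tendsto_fluxR hp hq,
      isLittleO_flux_sub hp hq⟩
  · exact ⟨(flux_eq_massFlux hp hl hr).1, (flux_eq_massFlux hp hl hr).2,
      (flux_eq_momentumFlux hp hl hr).1, (flux_eq_momentumFlux hp hl hr).2⟩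
  · have ha := fun i => h.admissible hp hn.le i
    exact ⟨h.sum_eq 0 (massFlux p) hn (fun i => (flux_eq_massFlux hp (ha _) (ha _)).1)
        (fun i => (flux_eq_massFlux hp (ha _) (ha _)).2) hab,
      h.sum_eq 1 (momentumFlux p) hn (fun i => (flux_eq_momentumFlux hp (ha _) (ha _)).1)
        (fun i => (flux_eq_momentumFlux hp (ha _) (ha _)).2) hab⟩
  · exact ⟨le_numEnergyFlux hp hl hr, numEnergyFlux_le hp hl hr⟩
  · exact ⟨fun h0 n hn i => h.sxx_le hp hk h0 hn i, fun h0 n hn i => h.le_szz hp hk h0 hn i⟩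
  · exact ⟨isCharSpeed_iff hp hq, tendsto_speed1 hp hq, tendsto_uStar hp hq, tendsto_speed3 hp hq⟩
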